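/- Let $\mathcal C$ be an $\infty$-category (a quasicategory), let $K$ be a simplicial set and let $p\colon K\to\mathcal C$ be a map of simplicial sets. Let $\star$ denote the join of simplicial sets, so that a map $X\to A\star B$ is the same as a triple consisting of a map $X\to\Delta^1$ together with maps $X_0\to A$ and $X_1\to B$, where $X_i=\{i\}\times_{\Delta^1}X$. Put $K^\triangleleft=\Delta^0\star K$. Let $\mathcal C_{/p}$ be the slice, whose $n$-simplices are the maps $\Delta^n\star K\to\mathcal C$ that restrict to $p$ on $K$, and let $\mathcal C^{K^\triangleleft}\times_{\mathcal C^K}\{p\}$ be the fiber over $p$ of the restriction map $\mathcal C^{K^\triangleleft}\to\mathcal C^K$ between simplicial sets of maps. For every simplicial set $W$, let $W\times K^\triangleleft\to W\star K$ be the map corresponding to the triple consisting of the composite $W\times K^\triangleleft\to K^\triangleleft\to\Delta^1$ and the projections $W\times\Delta^0\cong W$ and $W\times K\to K$. Composing a map $\Delta^n\star K\to\mathcal C$ that restricts to $p$ on $K$ with the map $\Delta^n\times K^\triangleleft\to\Delta^n\star K$ defines a canonical map of simplicial sets $$\varphi\colon\ \mathcal C_{/p}\longrightarrow \mathcal C^{K^\triangleleft}\times_{\mathcal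 C^K}\{p\}.$$ Then $\mathcal C_{/p}$ and $\mathcal C^{K^\triangleleft}\times_{\mathcal C^K}\{p\}$ are $\infty$-categories and $\varphi$ is an equivalence of $\infty$-categories: there is a map $\psi$ in the opposite direction such that $\psi\varphi$ and $\varphi\psi$ are isomorphic to the identity functors, as objects of the corresponding functor $\infty$-categories. -/

import Mathlib

open CategoryTheory Simplicial MonoidalCategory CartesianMonoidalCategory Limits Opposite

universe u

noncomputable section

namespace InftySlice

/-- The fiber over the vertex `i` of a simplicial set `X` over `Δ[1]`, as a subcomplex of `X`:
the simplices all of whose vertices are sent to `i`. -/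
def fiberOver {X : SSet.{u}} (χ : X ⟶ Δ[1]) (i : Fin 2) : X.Subcomplex :=
  (SSet.stdSimplex.face {i}).preimage χ

/-- The map induced on fibers by a morphism `g : Y ⟶ X` over `Δ[1]`. -/
def fiberOverMap {X Y : SSet.{u}} (g : Y ⟶ X) (χ : X ⟶ Δ[1]) (i : Fin 2) :
    (fiberOver (g ≫ χ) i : SSet.{u}) ⟶ (fiberOver χ i : SSet.{u}) :=
  Subfunctor.lift ((fiberOver (g ≫ χ) i).ι ≫ g) (by
    rintro n _ ⟨⟨x, hx⟩, rfl⟩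
    exact hx)

/-- The data of a map from `X` to the join `A ⋆ B`: a map `χ : X ⟶ Δ[1]` together with a map to `A`
from the fiber of `χ` over `0` and a map to `B` from the fiber of `χ` over `1`. -/
structure JoinData (X A B : SSet.{u}) where
  χ : X ⟶ Δ[1]
  left : (fiberOver χ 0 : SSet.{u}) ⟶ A
  right : (fiberOver χ 1 : SSet.{u}) ⟶ B

theorem JoinData.ext_of_apply {X A B : SSet.{u}} {d d' : JoinData X A B} (h : d.χ = d'.χ)
    (hl : ∀ n x hx hx', d.left.app n ⟨x, hx⟩ = d'.left.app n ⟨x, hx'⟩)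
    (hr : ∀ n x hx hx', d.right.app n ⟨x, hx⟩ = d'.right.app n ⟨x, hx'⟩) : d = d' := by
  obtain ⟨χ, l, r⟩ := d
  obtain ⟨χ', l', r'⟩ := d'
  obtain rfl : χ = χ' := h
  have h₁ : l = l' := NatTrans.ext (funext fun n => ConcreteCategory.hom_ext _ _ fun x =>
    hl n x.1 x.2 x.2)
  have h₂ : r = r' := NatTrans.ext (funext fun n => ConcreteCategory.hom_ext _ _ fun x =>
    hr n x.1 x.2 x.2)
  rw [h₁, h₂]

/-- Restriction of `JoinData` along a morphism. -/
def JoinData.precomp {X Y A B : SSet.{u}} (g : Y ⟶ X) (d : JoinData X A B) : JoinData Y A B where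
  χ := g ≫ d.χ
  left := fiberOverMap g d.χ 0 ≫ d.left
  right := fiberOverMap g d.χ 1 ≫ d.right

theorem JoinData.precomp_id {X A B : SSet.{u}} (d : JoinData X A B) : d.precomp (𝟙 X) = d := rfl

theorem JoinData.precomp_precomp {X Y Z A B : SSet.{u}} (h : Z ⟶ Y) (g : Y ⟶ X)
    (d : JoinData X A B) : (d.precomp g).precomp h = d.precomp (h ≫ g) := rfl

/-- The join `A ⋆ B` of simplicial sets. An `n`-simplex consists of a map `Δ[n] ⟶ Δ[1]`, a map to
`A` from its fiber over `0` and a map to `B` from its fiber over `1`. (Such a fiber is empty or a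
face of `Δ[n]`, so this is a simplex of `A`, or a simplex of `B`, or one of each.) -/
def join (A B : SSet.{u}) : SSet.{u} where
  obj n := JoinData (SSet.stdSimplex.obj n.unop) A B
  map f := ↾fun d => d.precomp (SSet.stdSimplex.map f.unop)
  map_id n := by
    refine ConcreteCategory.hom_ext _ _ fun d => ?_
    exact (congrArg (fun g => d.precomp g) (SSet.stdSimplex.map_id n.unop)).trans d.precomp_id
  map_comp f g := by
    refine ConcreteCategory.hom_ext _ _ fun d => ?_
    exact (congrArg (fun h => d.precomp h) (SSet.stdSimplex.map_comp g.unop f.unop)).trans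
      (d.precomp_precomp _ _).symm

/-- The map to a join determined by `JoinData`: a simplex `x` of `X` is sent to the restriction of
the data along `x : Δ[n] ⟶ X`. -/
def JoinData.toHom {X A B : SSet.{u}} (d : JoinData X A B) : X ⟶ join A B where
  app n := ↾fun x => (d.precomp (SSet.yonedaEquiv.symm x : SSet.stdSimplex.obj n.unop ⟶ X))
  naturality n m f := by
    refine ConcreteCategory.hom_ext _ _ fun x => ?_
    exact congrArg (fun g => d.precomp g)
      (SSet.yonedaEquiv_symm_naturality_left f.unop x).symm

theorem comp_toHom {X Y A B : SSet.{u}} (g : Y ⟶ X) (d : JoinData X A B) :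
    g ≫ d.toHom = (d.precomp g).toHom := by
  refine NatTrans.ext (funext fun n => ConcreteCategory.hom_ext _ _ fun x => ?_)
  exact congrArg (fun k => d.precomp k) (SSet.yonedaEquiv_symm_comp x g).symm

/-- The projection `A ⋆ B ⟶ Δ[1]`. -/
def joinProj (A B : SSet.{u}) : join A B ⟶ Δ[1] where
  app n := ↾fun (d : JoinData (SSet.stdSimplex.obj n.unop) A B) => SSet.yonedaEquiv d.χ
  naturality n m f := by
    refine ConcreteCategory.hom_ext _ _ fun d => ?_
    exact (SSet.yonedaEquiv_naturality f.unop
      (JoinData.χ (X := SSet.stdSimplex.obj n.unop) d)).symm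

/-- The functoriality of the join in its first variable. -/
def joinMap {A A' : SSet.{u}} (f : A ⟶ A') (B : SSet.{u}) : join A B ⟶ join A' B where
  app n := ↾fun (d : JoinData (SSet.stdSimplex.obj n.unop) A B) =>
    (⟨d.χ, d.left ≫ f, d.right⟩ : JoinData (SSet.stdSimplex.obj n.unop) A' B)
  naturality _ _ _ := rfl

theorem toHom_comp_joinMap {X A A' B : SSet.{u}} (d : JoinData X A B) (f : A ⟶ A') :
    d.toHom ≫ joinMap f B = JoinData.toHom ⟨d.χ, d.left ≫ f, d.right⟩ := rfl

/-- The canonical map from the fiber of `A ⋆ B ⟶ Δ[1]` over `1` to `B`. -/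
def joinFiberOne (A B : SSet.{u}) : (fiberOver (joinProj A B) 1 : SSet.{u}) ⟶ B where
  app n := ↾fun d => (JoinData.right (X := SSet.stdSimplex.obj n.unop) d.1).app n
    ⟨SSet.yonedaEquiv (𝟙 (SSet.stdSimplex.obj n.unop)), d.2⟩
  naturality n m f := by
    refine ConcreteCategory.hom_ext _ _ fun d => ?_
    have h := NatTrans.naturality_apply (JoinData.right (X := SSet.stdSimplex.obj n.unop) d.1) f
      ⟨SSet.yonedaEquiv (𝟙 (SSet.stdSimplex.obj n.unop)), d.2⟩
    refine Eq.trans ?_ h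
    refine congrArg ((JoinData.right (X := SSet.stdSimplex.obj n.unop) d.1).app m) ?_
    refine Subtype.ext ?_
    exact (SSet.yonedaEquiv_naturality f.unop (𝟙 (SSet.stdSimplex.obj n.unop))).symm

/-- The fiber over `0` of a map to `Δ[1]` that is constant with value `1` is empty. -/
theorem isEmpty_fiberOver_zero (X : SSet.{u}) (n : SimplexCategoryᵒᵖ)
    (x : (fiberOver (SSet.const (SSet.stdSimplex.obj₀Equiv.symm 1) : X ⟶ Δ[1]) 0).obj n) :
    False := by
  have h := (SSet.stdSimplex.mem_face_iff (n := 1) (d := n.unop.len) _ _).1 x.2 0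
  exact absurd (Finset.mem_singleton.1 h) (by change ¬ (1 : Fin 2) = 0; decide)

/-- The inclusion `B ⟶ A ⋆ B`. -/
def joinInr (A B : SSet.{u}) : B ⟶ join A B :=
  JoinData.toHom
    { χ := SSet.const (SSet.stdSimplex.obj₀Equiv.symm 1)
      left :=
        { app := fun n => ↾fun x => (isEmpty_fiberOver_zero B n x).elim
          naturality := fun n _ _ => by
            refine ConcreteCategory.hom_ext _ _ fun x => ?_
            exact (isEmpty_fiberOver_zero B n x).elim }
      right := (fiberOver (SSet.const (SSet.stdSimplex.obj₀Equiv.symm 1)) 1).ι }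

theorem joinInr_joinMap {A A' : SSet.{u}} (f : A ⟶ A') (B : SSet.{u}) :
    joinInr A B ≫ joinMap f B = joinInr A' B := by
  rw [joinInr, joinInr, toHom_comp_joinMap]
  refine congrArg JoinData.toHom (JoinData.ext_of_apply rfl ?_ ?_)
  · exact fun n x hx _ => (isEmpty_fiberOver_zero B n ⟨x, hx⟩).elim
  · exact fun _ _ _ _ => rfl

/-- The left cone `K^◁ = Δ[0] ⋆ K`. -/
abbrev leftCone (K : SSet.{u}) : SSet.{u} := join Δ[0] K

/-- The slice `C_{/p}`: its `n`-simplices are the maps `Δ[n] ⋆ K ⟶ C` that restrict to `p` on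
`K`. -/
def slice {K C : SSet.{u}} (p : K ⟶ C) : SSet.{u} where
  obj n := {f : join (SSet.stdSimplex.obj n.unop) K ⟶ C // joinInr _ K ≫ f = p}
  map g := ↾fun f => ⟨joinMap (SSet.stdSimplex.map g.unop) K ≫ f.1, by
    rw [← Category.assoc, joinInr_joinMap, f.2]⟩
  map_id n := by
    refine ConcreteCategory.hom_ext _ _ fun f => Subtype.ext ?_
    exact (congrArg (fun h => joinMap h K ≫ f.1) (SSet.stdSimplex.map_id n.unop))
  map_comp g h := by
    refine ConcreteCategory.hom_ext _ _ fun f => Subtype.ext ?_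
    exact (congrArg (fun k => joinMap k K ≫ f.1) (SSet.stdSimplex.map_comp h.unop g.unop))

/-- The vertex of the simplicial set `Y ^ X` of maps corresponding to a map `f : X ⟶ Y`. -/
def mapVertex {X Y : SSet.{u}} (f : X ⟶ Y) : ((ihom X).obj Y) _⦋0⦌ :=
  SSet.yonedaEquiv (MonoidalClosed.curry (fst X Δ[0] ≫ f))

/-- The restriction map `C ^ (K^◁) ⟶ C ^ K`. -/
abbrev restrictCone (K C : SSet.{u}) :
    (ihom (leftCone K)).obj C ⟶ (ihom K).obj C :=
  (MonoidalClosed.pre (joinInr Δ[0] K)).app C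

/-- The fiber `C ^ (K^◁) ×_{C ^ K} {p}`. -/
abbrev coneFiber {K C : SSet.{u}} (p : K ⟶ C) : SSet.{u} :=
  pullback (restrictCone K C) (SSet.yonedaEquiv.symm (mapVertex p) : Δ[0] ⟶ (ihom K).obj C)

/-- The map `K^◁ × W ⟶ W ⋆ K` which lies over the projection `K^◁ ⟶ Δ[1]` and is given by the
projections to `W` and `K` on the fibers `Δ[0] × W` and `K × W` over `0` and `1`. -/
def coneToJoin (W K : SSet.{u}) : leftCone K ⊗ W ⟶ join W K :=
  JoinData.toHom
    { χ := fst (leftCone K) W ≫ joinProj Δ[0] K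
      left := (fiberOver (fst (leftCone K) W ≫ joinProj Δ[0] K) 0).ι ≫ snd (leftCone K) W
      right := fiberOverMap (fst (leftCone K) W) (joinProj Δ[0] K) 1 ≫ joinFiberOne Δ[0] K }

theorem coneToJoin_natural {W W' : SSet.{u}} (g : W ⟶ W') (K : SSet.{u}) :
    leftCone K ◁ g ≫ coneToJoin W' K = coneToJoin W K ≫ joinMap g K := by
  rw [coneToJoin, comp_toHom]
  rfl

theorem joinInr_coneToJoin (W K : SSet.{u}) :
    joinInr Δ[0] K ▷ W ≫ coneToJoin W K = fst K W ≫ joinInr W K := by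
  rw [coneToJoin, joinInr, joinInr, comp_toHom, comp_toHom]
  refine congrArg JoinData.toHom (JoinData.ext_of_apply rfl ?_ ?_)
  · exact fun n x _ hx => (isEmpty_fiberOver_zero K n ⟨x.1, hx⟩).elim
  · intro n x hx hx'
    exact SSet.yonedaEquiv_symm_app_id x.1

/-- The map `C_{/p} ⟶ C ^ (K^◁)` sending `f : Δ[n] ⋆ K ⟶ C` to the simplex given by the composite
`K^◁ × Δ[n] ⟶ Δ[n] ⋆ K ⟶ C`. -/
def sliceToCone {K C : SSet.{u}} (p : K ⟶ C) : slice p ⟶ (ihom (leftCone K)).obj C where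
  app n := ↾fun f => SSet.yonedaEquiv
    (MonoidalClosed.curry (coneToJoin (SSet.stdSimplex.obj n.unop) K ≫ f.1))
  naturality n m g := by
    refine ConcreteCategory.hom_ext _ _ fun f => ?_
    refine Eq.trans (congrArg (fun k => SSet.yonedaEquiv (MonoidalClosed.curry k)) ?_)
      (Eq.trans (congrArg SSet.yonedaEquiv (MonoidalClosed.curry_natural_left
        (SSet.stdSimplex.map g.unop) (coneToJoin (SSet.stdSimplex.obj n.unop) K ≫ f.1)))
        (SSet.yonedaEquiv_naturality g.unop _).symm)
    exact (congrArg (fun k => k ≫ f.1) (coneToJoin_natural (SSet.stdSimplex.map g.unop) K)).symm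

theorem sliceToCone_restrictCone {K C : SSet.{u}} (p : K ⟶ C) :
    sliceToCone p ≫ restrictCone K C =
      SSet.stdSimplex.isTerminalObj₀.from (slice p) ≫ SSet.yonedaEquiv.symm (mapVertex p) := by
  refine NatTrans.ext (funext fun n => ConcreteCategory.hom_ext _ _ fun f => ?_)
  have h₁ : MonoidalClosed.curry (coneToJoin (SSet.stdSimplex.obj n.unop) K ≫ f.1) ≫
      restrictCone K C = MonoidalClosed.curry (fst K (SSet.stdSimplex.obj n.unop) ≫ p) := by
    rw [MonoidalClosed.curry_pre_app, ← Category.assoc, joinInr_coneToJoin, Category.assoc, f.2]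
  have h₂ : SSet.stdSimplex.isTerminalObj₀.from (SSet.stdSimplex.obj n.unop) ≫
      MonoidalClosed.curry (fst K Δ[0] ≫ p) =
        MonoidalClosed.curry (fst K (SSet.stdSimplex.obj n.unop) ≫ p) := by
    rw [← MonoidalClosed.curry_natural_left, whiskerLeft_fst_assoc]
  have h₃ : SSet.yonedaEquiv.symm f ≫ SSet.stdSimplex.isTerminalObj₀.from (slice p) =
      SSet.stdSimplex.isTerminalObj₀.from (SSet.stdSimplex.obj n.unop) :=
    SSet.stdSimplex.isTerminalObj₀.hom_ext _ _
  have h₄ : SSet.yonedaEquiv.symm f ≫ (SSet.stdSimplex.isTerminalObj₀.from (slice p) ≫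
      SSet.yonedaEquiv.symm (mapVertex p)) =
        MonoidalClosed.curry (fst K (SSet.stdSimplex.obj n.unop) ≫ p) := by
    rw [← Category.assoc, h₃, mapVertex, Equiv.symm_apply_apply, h₂]
  rw [SSet.yonedaEquiv_symm_comp] at h₄
  refine Eq.trans ?_ (SSet.yonedaEquiv.symm_apply_eq.1 h₄).symm
  exact congrArg SSet.yonedaEquiv h₁

/-- The canonical comparison map `C_{/p} ⟶ C ^ (K^◁) ×_{C ^ K} {p}`. -/
def sliceComparison {K C : SSet.{u}} (p : K ⟶ C) : slice p ⟶ coneFiber p :=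
  pullback.lift (sliceToCone p) (SSet.stdSimplex.isTerminalObj₀.from (slice p))
    (sliceToCone_restrictCone p)

/-- Two maps `f g : X ⟶ Y` are isomorphic as objects of `Y ^ X`: there is an edge from `f` to `g`
in `Y ^ X` that has a homotopy inverse. -/
def AreIsomorphic {X Y : SSet.{u}} (f g : X ⟶ Y) : Prop :=
  ∃ e : SSet.Edge (mapVertex f) (mapVertex g), Nonempty e.InvStruct

/-- A functor `F : X ⟶ Y` between `∞`-categories is an equivalence if it has an inverse up to
isomorphism of functors. -/
def IsInftyEquivalence {X Y : SSet.{u}} (F : X ⟶ Y) : Prop :=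
  ∃ G : Y ⟶ X, AreIsomorphic (F ≫ G) (𝟙 X) ∧ AreIsomorphic (G ≫ F) (𝟙 Y)

end InftySlice
end

/-! Both sides of the comparison are instances of one construction. A shape is an ordinal `⦋r⦌` with
a set `S` of vertices containing `0`. The generalized join of `W` and `K` of this shape has as
simplices the maps to `Δ[r]` together with a map to `W` from the part over `S` and a map to `K` from
the part over `{0}ᶜ`: it carries `W` over `0`, and over any other vertex `K × W` or `K`, according
to whether the vertex is in `S`. For `r = 1`, `S = {0}` gives `W ⋆ K` and `S = {0, 1}` gives `K^◁ ×
W`. Maps to `C` that restrict to `p` away from `0` then represent the slice `Q` and the fiber `P`,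
and `φ : Q ⟶ P` is restriction along a morphism of shapes.

The main point is `res_rlp`: restricting a generalized slice to the parts over `0` and `1` is a
trivial fibration. Working cell by cell (`StableFamily.extends_of_cells`), one is led to the
generalized join of `Δ[n]` (for `K`) and `Δ[m]` (for `W`), and to the subcomplex of simplices that
miss `0`, or lie over `{0, 1}`, or lie over the boundary of a factor. Its inclusion is inner
anodyne, because the remaining nondegenerate simplices are matched by adding or removing one vertex
over `1`, the corner (`outerCornerData`).

Two maps into the source of a trivial fibration that agree in the base are isomorphic
(`areIsomorphic_of_comp_eq`). Take the generalized slice of shape `{0, 1, 3}` in `⦋3⦌`, a section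
`t` of its restriction to the edge `01`, which is of type `P`, and let `ψ` be `t` followed by
restriction to the edge `02`, of type `Q`. The face `012`, compared with a degeneracy, gives `φ ≫ ψ
≅ 𝟙`. The face `013` shows that `t` followed by restriction to `03` is isomorphic to `𝟙`, and the
face `023` that it factors through `ψ` up to isomorphism. So `ψ` is invertible on both sides, and
`φ` is an equivalence. Finally, `Q` is a retract of the generalized slice of shape `{0, 1}` in
`⦋2⦌`, which is trivially fibered over `P`; hence it is an `∞`-category. -/

noncomputable section

namespace InftySlice

/-! ### Generalized joins -/

/-- The subcomplex of a simplicial set `X` over `Δ[r]` of the simplices all of whose vertices are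
sent to `S`. -/
def part {r : ℕ} {X : SSet.{u}} (χ : X ⟶ Δ[r]) (S : Finset (Fin (r + 1))) : X.Subcomplex :=
  (SSet.stdSimplex.face S).preimage χ

/-- The map induced on parts by a morphism over `Δ[r]`. -/
def partMap {r : ℕ} {X Y : SSet.{u}} (g : Y ⟶ X) (χ : X ⟶ Δ[r]) (S : Finset (Fin (r + 1))) :
    (part (g ≫ χ) S : SSet.{u}) ⟶ (part χ S : SSet.{u}) :=
  Subfunctor.lift ((part (g ≫ χ) S).ι ≫ g) (by
    rintro n _ ⟨⟨x, hx⟩, rfl⟩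
    exact hx)

/-- A map from `X` to the generalized join of `A` and `B`: a map to `Δ[r]` together with a map to
`A` from the part over `S` and a map to `B` from the part over `T`. -/
structure PartsData {r : ℕ} (S T : Finset (Fin (r + 1))) (X A B : SSet.{u}) where
  χ : X ⟶ Δ[r]
  left : (part χ S : SSet.{u}) ⟶ A
  right : (part χ T : SSet.{u}) ⟶ B

section

variable {r : ℕ} {S T : Finset (Fin (r + 1))}

theorem PartsData.ext_of_apply {X A B : SSet.{u}} {d d' : PartsData S T X A B} (h : d.χ = d'.χ)
    (hl : ∀ n x hx hx', d.left.app n ⟨x, hx⟩ = d'.left.app n ⟨x, hx'⟩)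
    (hr : ∀ n x hx hx', d.right.app n ⟨x, hx⟩ = d'.right.app n ⟨x, hx'⟩) : d = d' := by
  obtain ⟨χ, l, r⟩ := d
  obtain ⟨χ', l', r'⟩ := d'
  obtain rfl : χ = χ' := h
  have h₁ : l = l' := NatTrans.ext (funext fun n => ConcreteCategory.hom_ext _ _ fun x =>
    hl n x.1 x.2 x.2)
  have h₂ : r = r' := NatTrans.ext (funext fun n => ConcreteCategory.hom_ext _ _ fun x =>
    hr n x.1 x.2 x.2)
  rw [h₁, h₂]

/-- Restriction of `PartsData` along a morphism. -/
def PartsData.precomp {X Y A B : SSet.{u}} (g : Y ⟶ X) (d : PartsData S T X A B) :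
    PartsData S T Y A B where
  χ := g ≫ d.χ
  left := partMap g d.χ S ≫ d.left
  right := partMap g d.χ T ≫ d.right

variable (S T) in
/-- The generalized join of `A` and `B`. -/
def partsJoin (A B : SSet.{u}) : SSet.{u} where
  obj n := PartsData S T (SSet.stdSimplex.obj n.unop) A B
  map f := ↾fun d => d.precomp (SSet.stdSimplex.map f.unop)
  map_id n := by
    refine ConcreteCategory.hom_ext _ _ fun d => ?_
    exact congrArg (fun g => d.precomp g) (SSet.stdSimplex.map_id n.unop)
  map_comp f g := by
    refine ConcreteCategory.hom_ext _ _ fun d => ?_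
    exact congrArg (fun h => d.precomp h) (SSet.stdSimplex.map_comp g.unop f.unop)

/-- The functoriality of the generalized join in its first variable. -/
def mapLeft {A A' : SSet.{u}} (f : A ⟶ A') (B : SSet.{u}) :
    partsJoin S T A B ⟶ partsJoin S T A' B where
  app n := ↾fun (d : PartsData S T (SSet.stdSimplex.obj n.unop) A B) =>
    (⟨d.χ, d.left ≫ f, d.right⟩ : PartsData S T (SSet.stdSimplex.obj n.unop) A' B)
  naturality _ _ _ := rfl

variable (S T) in
/-- Exchanging the two variables of the generalized join. -/
def partsSwap (A B : SSet.{u}) : partsJoin S T A B ⟶ partsJoin T S B A where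
  app n := ↾fun (d : PartsData S T (SSet.stdSimplex.obj n.unop) A B) =>
    (⟨d.χ, d.right, d.left⟩ : PartsData T S (SSet.stdSimplex.obj n.unop) B A)
  naturality _ _ _ := rfl

/-- The vertices of a simplex of a standard simplex. -/
def vtx {n : SimplexCategory} {k : SimplexCategoryᵒᵖ}
    (x : (SSet.stdSimplex.obj n : SSet.{u}).obj k) (i : Fin (k.unop.len + 1)) : Fin (n.len + 1) :=
  (SSet.stdSimplex.objEquiv x).toOrderHom i

theorem vtx_ext {n : SimplexCategory} {k : SimplexCategoryᵒᵖ}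
    {x y : (SSet.stdSimplex.obj n : SSet.{u}).obj k} (h : ∀ i, vtx x i = vtx y i) : x = y :=
  SSet.stdSimplex.ext (n := n.len) (d := k.unop.len) _ _ h

theorem vtx_monotone {n : SimplexCategory} {k : SimplexCategoryᵒᵖ}
    (x : (SSet.stdSimplex.obj n : SSet.{u}).obj k) : Monotone (vtx x) :=
  (SSet.stdSimplex.objEquiv x).toOrderHom.monotone

/-- The vertices of `Δ[r]` corresponding to the vertices of a simplex of the generalized join. -/
def PartsData.vertex {n : SimplexCategory} {A B : SSet.{u}}
    (d : PartsData S T (SSet.stdSimplex.obj n) A B) (i : Fin (n.len + 1)) : Fin (r + 1) :=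
  vtx (SSet.yonedaEquiv d.χ) i

theorem vtx_app {n m : SimplexCategory}
    (χ : (SSet.stdSimplex.obj n : SSet.{u}) ⟶ SSet.stdSimplex.obj m)
    {k : SimplexCategoryᵒᵖ} (x : (SSet.stdSimplex.obj n : SSet.{u}).obj k)
    (i : Fin (k.unop.len + 1)) :
    vtx (χ.app k x) i = vtx (SSet.yonedaEquiv χ) (vtx x i) := by
  obtain ⟨y, rfl⟩ := SSet.yonedaEquiv.symm.surjective χ
  rw [Equiv.apply_symm_apply]
  rfl

theorem vtx_yonedaEquiv_comp {N' N m : SimplexCategory} (f : N' ⟶ N)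
    (χ : (SSet.stdSimplex.obj N : SSet.{u}) ⟶ SSet.stdSimplex.obj m) (i : Fin (N'.len + 1)) :
    vtx (SSet.yonedaEquiv (SSet.stdSimplex.map f ≫ χ)) i =
      vtx (SSet.yonedaEquiv χ) (f.toOrderHom i) :=
  congrArg (fun z => vtx z i) (SSet.yonedaEquiv_naturality f χ).symm

theorem mem_part_iff {N : SimplexCategory} (χ : SSet.stdSimplex.{u}.obj N ⟶ Δ[r])
    (U : Finset (Fin (r + 1))) {k : SimplexCategoryᵒᵖ}
    (x : (SSet.stdSimplex.obj N : SSet.{u}).obj k) :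
    x ∈ (part χ U).obj k ↔ ∀ i, vtx (SSet.yonedaEquiv χ) (vtx x i) ∈ U := by
  refine (SSet.stdSimplex.mem_face_iff (d := k.unop.len) _ _).trans ?_
  refine forall_congr' fun i => ?_
  exact iff_of_eq (congrArg (· ∈ U) (vtx_app χ x i))

/-- A nonempty part of a standard simplex is a face, the full subcomplex on the vertices sent to
`U`, so a monotone retraction of vertices suffices. It turns a map defined on the part into a
simplex of the target. -/
theorem exists_retraction {n : SimplexCategory} {χ : SSet.stdSimplex.{u}.obj n ⟶ Δ[r]}
    {U : Finset (Fin (r + 1))} {i₀ : Fin (n.len + 1)}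
    (h₀ : vtx (SSet.yonedaEquiv χ) i₀ ∈ U) :
    ∃ a : (SSet.stdSimplex.obj n : SSet.{u}) ⟶ (part χ U : SSet.{u}),
      (part χ U).ι ≫ a = 𝟙 _ := by
  classical
  let φ := vtx (SSet.yonedaEquiv χ)
  -- send `i` to the largest element of the part below `i`, or to the smallest element
  have hne : (Finset.univ.filter fun i => φ i ∈ U).Nonempty := ⟨i₀, by simpa using h₀⟩
  let m := (Finset.univ.filter fun i => φ i ∈ U).min' hne
  have hm : φ m ∈ U := by
    have := Finset.min'_mem _ hne
    simpa using this
  have hne' (i : Fin (n.len + 1)) :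
      (insert m (Finset.univ.filter fun j => φ j ∈ U ∧ j ≤ i)).Nonempty :=
    Finset.insert_nonempty _ _
  let a : Fin (n.len + 1) →o Fin (n.len + 1) :=
    { toFun := fun i => (insert m (Finset.univ.filter fun j => φ j ∈ U ∧ j ≤ i)).max'
        (hne' i)
      monotone' := fun i j hij => by
        refine Finset.max'_subset (hne' i) ?_
        refine Finset.insert_subset_insert _ ?_
        intro k hk
        simp only [Finset.mem_filter, Finset.mem_univ, true_and] at hk ⊢
        exact ⟨hk.1, hk.2.trans hij⟩ }
  have ha (i) : φ (a i) ∈ U := by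
    have h := Finset.max'_mem _ (hne' i)
    change a i ∈ _ at h
    rw [Finset.mem_insert] at h
    rcases h with h | h
    · rw [h]; exact hm
    · simp only [Finset.mem_filter, Finset.mem_univ, true_and] at h
      exact h.1
  have ha' (i) (hi : φ i ∈ U) : a i = i := by
    refine le_antisymm ?_ ?_
    · refine Finset.max'_le _ (hne' i) _ fun j hj => ?_
      rw [Finset.mem_insert] at hj
      rcases hj with rfl | hj
      · exact Finset.min'_le _ _ (by simpa using hi)
      · simp only [Finset.mem_filter, Finset.mem_univ, true_and] at hj
        exact hj.2
    · have hmem : i ∈ insert m (Finset.univ.filter fun j => φ j ∈ U ∧ j ≤ i) := by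
        simp [hi]
      exact Finset.le_max' _ _ hmem
  refine ⟨Subfunctor.lift (SSet.stdSimplex.map (SimplexCategory.Hom.mk a)) ?_, ?_⟩
  · rintro k _ ⟨x, rfl⟩
    rw [mem_part_iff]
    intro i
    exact ha _
  · refine NatTrans.ext (funext fun k => ConcreteCategory.hom_ext _ _ fun x => Subtype.ext ?_)
    refine vtx_ext fun i => ?_
    exact ha' _ ((mem_part_iff χ U x.1).1 x.2 i)

theorem part_comp_le {X : SSet.{u}} (χ : X ⟶ Δ[r]) {r' : ℕ} {U' : Finset (Fin (r' + 1))}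
    {U : Finset (Fin (r + 1))} (d : ⦋r⦌ ⟶ ⦋r'⦌) (h : ∀ i, d.toOrderHom i ∈ U' → i ∈ U) :
    part (χ ≫ SSet.stdSimplex.map d) U' ≤ part χ U := by
  intro k x hx
  exact (SSet.stdSimplex.mem_face_iff (d := k.unop.len) _ _).2 fun i =>
    h _ ((SSet.stdSimplex.mem_face_iff (d := k.unop.len) _ _).1 hx i)

/-- The functoriality of the generalized join in the shape. -/
def reindex {r' : ℕ} {S' T' : Finset (Fin (r' + 1))} (d : ⦋r⦌ ⟶ ⦋r'⦌)
    (hS : ∀ i, d.toOrderHom i ∈ S' → i ∈ S) (hT : ∀ i, d.toOrderHom i ∈ T' → i ∈ T)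
    (A B : SSet.{u}) : partsJoin S T A B ⟶ partsJoin S' T' A B where
  app n := ↾fun (t : PartsData S T (SSet.stdSimplex.obj n.unop) A B) =>
    (⟨t.χ ≫ SSet.stdSimplex.map d, SSet.Subcomplex.homOfLE (part_comp_le t.χ d hS) ≫ t.left,
      SSet.Subcomplex.homOfLE (part_comp_le t.χ d hT) ≫ t.right⟩ :
        PartsData S' T' (SSet.stdSimplex.obj n.unop) A B)
  naturality _ _ _ := rfl

end

/-! ### Gluing maps and extension from subcomplexes -/

/-- This glues maps given on overlapping subcomplexes: the relation lists the ways in which a value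
is prescribed, and single-valuedness is agreement on overlaps. -/
theorem exists_hom_of_rel {X C : SSet.{u}} (P : ∀ n, X.obj n → C.obj n → Prop)
    (nat : ∀ {n m} (f : n ⟶ m) {x c}, P n x c → P m (X.map f x) (C.map f c))
    (ex : ∀ n x, ∃ c, P n x c) (uniq : ∀ {n x c c'}, P n x c → P n x c' → c = c') :
    ∃ g : X ⟶ C, ∀ {n x c}, P n x c → g.app n x = c := by
  choose F hF using ex
  refine ⟨⟨fun n => ↾(F n), fun n m f => ConcreteCategory.hom_ext _ _ fun x => ?_⟩, ?_⟩
  · exact uniq (hF _ _) (nat f (hF n x))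
  · exact fun {n x c} h => uniq (hF n x) h

/-- Maps to `C` defined on the subcomplex `A` extend. -/
def Extends (C : SSet.{u}) {X : SSet.{u}} (A : X.Subcomplex) : Prop :=
  ∀ f : (A : SSet.{u}) ⟶ C, ∃ g : X ⟶ C, A.ι ≫ g = f

theorem Extends.exists_of_rel {X C : SSet.{u}} {A : X.Subcomplex} (hA : Extends C A)
    (P : ∀ n, X.obj n → C.obj n → Prop)
    (nat : ∀ {n m} (f : n ⟶ m) {x c}, P n x c → P m (X.map f x) (C.map f c))
    (ex : ∀ n, ∀ x ∈ A.obj n, ∃ c, P n x c)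
    (uniq : ∀ {n x c c'}, P n x c → P n x c' → c = c') :
    ∃ g : X ⟶ C, ∀ {n x c}, x ∈ A.obj n → P n x c → g.app n x = c := by
  obtain ⟨f, hf⟩ := exists_hom_of_rel (X := A) (fun n x c => P n x.1 c) (fun f _ _ h => nat f h)
    (fun n x => ex n x.1 x.2) uniq
  obtain ⟨g, hg⟩ := hA f
  refine ⟨g, fun {n x c} hx h => ?_⟩
  rw [← hf (x := ⟨x, hx⟩) h, ← hg]
  rfl

/-! ### Stable families and reduction of extension problems to cells -/

section

variable {r : ℕ} {S T : Finset (Fin (r + 1))}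

variable (S T) in
/-- A family of subcomplexes of the generalized joins `L ⋆ M`, for varying `L`, that is stable under
preimages and contains the simplices that do not meet the part of `L`. -/
structure StableFamily (M : SSet.{u}) where
  obj : ∀ L : SSet.{u}, (partsJoin S T L M).Subcomplex
  mem_iff : ∀ {L L' : SSet.{u}} (g : L ⟶ L') {n} (t : (partsJoin S T L M).obj n),
    (mapLeft g M).app n t ∈ (obj L').obj n ↔ t ∈ (obj L).obj n
  mem_of_forall_notMem : ∀ {L : SSet.{u}} {n : SimplexCategoryᵒᵖ}
    (t : PartsData S T (SSet.stdSimplex.obj n.unop) L M), (∀ i, t.vertex i ∉ S) →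
      (show (partsJoin S T L M).obj n from t) ∈ (obj L).obj n

namespace StableFamily

variable {M : SSet.{u}} (F : StableFamily S T M)

/-- The functoriality of a stable family. -/
def map {L L' : SSet.{u}} (g : L ⟶ L') : (F.obj L : SSet.{u}) ⟶ (F.obj L' : SSet.{u}) :=
  Subfunctor.lift ((F.obj L).ι ≫ mapLeft g M) (by
    rintro n _ ⟨⟨x, hx⟩, rfl⟩
    exact (F.mem_iff g x).2 hx)

variable {L C : SSet.{u}} (f : (F.obj L : SSet.{u}) ⟶ C)

/-- A simplex of `L` together with a map from its generalized join with `M` that is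
compatible with `f`. -/
structure RelMap (n : SimplexCategory) where
  base : L.obj (op n)
  hom : partsJoin S T (SSet.stdSimplex.obj n) M ⟶ C
  comm : (F.obj (SSet.stdSimplex.obj n)).ι ≫ hom = F.map (SSet.yonedaEquiv.symm base) ≫ f

theorem RelMap.ext' {n : SimplexCategory} {a b : F.RelMap f n} (h : a.base = b.base)
    (h' : a.hom = b.hom) : a = b := by
  cases a; cases b; cases h; cases h'; rfl

/-- Restriction of `RelMap` along a morphism of the simplex category. -/
def RelMap.restrict {n m : SimplexCategory} (g : m ⟶ n) (a : F.RelMap f n) : F.RelMap f m where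
  base := L.map g.op a.base
  hom := mapLeft (SSet.stdSimplex.map g) M ≫ a.hom
  comm := by
    have h₁ := congrArg (fun z => F.map (SSet.stdSimplex.map g) ≫ z) a.comm
    have h₂ := SSet.yonedaEquiv_symm_naturality_left g a.base
    refine Eq.trans h₁ ?_
    rw [← h₂]
    rfl

/-- The simplicial set of relative maps. -/
def relMaps : SSet.{u} where
  obj n := F.RelMap f n.unop
  map g := ↾fun a => a.restrict F f g.unop
  map_id n := by
    refine ConcreteCategory.hom_ext _ _ fun a => RelMap.ext' _ _ ?_ ?_
    · exact Functor.map_id_apply L (X := n) a.base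
    · exact congrArg (fun g => mapLeft g M ≫ a.hom) (SSet.stdSimplex.map_id n.unop)
  map_comp g h := by
    refine ConcreteCategory.hom_ext _ _ fun a => RelMap.ext' _ _ ?_ ?_
    · exact Functor.map_comp_apply L g h a.base
    · exact congrArg (fun g => mapLeft g M ≫ a.hom) (SSet.stdSimplex.map_comp h.unop g.unop)

/-- The projection from the simplicial set of relative maps to the base. -/
def relProj : F.relMaps f ⟶ L where
  app n := ↾fun (a : F.RelMap f n.unop) => a.base
  naturality _ _ _ := rfl

variable {F f}

/-- The map corresponding to a simplex of the simplicial set of relative maps. -/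
def evalHom {n : SimplexCategory} (x : SSet.stdSimplex.obj n ⟶ F.relMaps f) :
    partsJoin S T (SSet.stdSimplex.obj n) M ⟶ C :=
  RelMap.hom (n := n) (SSet.yonedaEquiv x)

theorem evalHom_comp {n m : SimplexCategory}
    (g : (SSet.stdSimplex.obj m : SSet.{u}) ⟶ SSet.stdSimplex.obj n)
    (x : SSet.stdSimplex.obj n ⟶ F.relMaps f) :
    evalHom (g ≫ x) = mapLeft g M ≫ evalHom x := by
  obtain ⟨θ, rfl⟩ : ∃ θ : m ⟶ n, SSet.stdSimplex.map θ = g :=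
    ⟨SSet.stdSimplex.objEquiv (SSet.yonedaEquiv g), by
      exact SSet.yonedaEquiv.injective (vtx_ext fun i => rfl)⟩
  exact (congrArg (RelMap.hom (n := m)) (SSet.yonedaEquiv_naturality θ x).symm)

theorem ι_evalHom {n : SimplexCategory} (x : SSet.stdSimplex.obj n ⟶ F.relMaps f) :
    (F.obj (SSet.stdSimplex.obj n)).ι ≫ evalHom x = F.map (x ≫ F.relProj f) ≫ f := by
  refine (RelMap.comm (n := n) (SSet.yonedaEquiv x)).trans ?_
  have h : (SSet.yonedaEquiv.symm (RelMap.base (n := n) (SSet.yonedaEquiv x))) =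
      x ≫ F.relProj f := by
    rw [Equiv.symm_apply_eq]
    rfl
  rw [h]

theorem evalHom_app_of_mem {n : SimplexCategory} (x : SSet.stdSimplex.obj n ⟶ F.relMaps f)
    {k} (t : (partsJoin S T (SSet.stdSimplex.obj n) M).obj k)
    (ht : t ∈ (F.obj (SSet.stdSimplex.obj n)).obj k) :
    (evalHom x).app k t = f.app k ⟨(mapLeft (x ≫ F.relProj f) M).app k t, (F.mem_iff _ _).2 ht⟩ :=
  ConcreteCategory.congr_hom (NatTrans.congr_app (ι_evalHom x) k) ⟨t, ht⟩

/-- A simplex meeting the part of the first variable comes from a universal one. -/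
theorem exists_eq_mapLeft {V : SSet.{u}} {n : SimplexCategoryᵒᵖ}
    (t : PartsData S T (SSet.stdSimplex.obj n.unop) V M) {i} (hi : t.vertex i ∈ S) :
    ∃ (y : SSet.stdSimplex.obj n.unop ⟶ V)
      (τ : (partsJoin S T (SSet.stdSimplex.obj n.unop) M).obj n), (mapLeft y M).app n τ = t ∧
      ∀ {m : SimplexCategory} (x : SSet.stdSimplex.obj m ⟶ V)
        (σ : (partsJoin S T (SSet.stdSimplex.obj m) M).obj n),
        (mapLeft x M).app n σ = t → ∃ g : SSet.stdSimplex.obj n.unop ⟶ SSet.stdSimplex.obj m,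
          (mapLeft g M).app n τ = σ ∧ g ≫ x = y := by
  -- The universal simplex keeps `t.χ` and `t.right` and has the inclusion of the part as first
  -- component; the retraction `a` extends `t.left` to a simplex of `V`.
  obtain ⟨a, ha⟩ := exists_retraction hi
  refine ⟨a ≫ t.left, (⟨t.χ, (part t.χ S).ι, t.right⟩ :
    PartsData S T (SSet.stdSimplex.obj n.unop) _ M), ?_, ?_⟩
  · exact congrArg (fun l => (⟨t.χ, l, t.right⟩ : PartsData S T (SSet.stdSimplex.obj n.unop) V M))
      (by rw [← Category.assoc, ha, Category.id_comp])
  · intro m x σ hσ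
    obtain ⟨χ, l, ρ⟩ := σ
    subst hσ
    refine ⟨a ≫ l, ?_, Category.assoc _ _ _⟩
    exact congrArg (fun l => (⟨χ, l, ρ⟩ : PartsData S T (SSet.stdSimplex.obj n.unop) _ M))
      ((Category.assoc _ _ _).symm.trans ((congrArg (· ≫ l) ha).trans (Category.id_comp l)))

/-- Compatible maps defined on the simplices of `V` assemble. -/
theorem exists_assembly {V : SSet.{u}} (ρ : V ⟶ F.relMaps f) :
    ∃ H : partsJoin S T V M ⟶ C,
      (∀ {n : SimplexCategory} (x : SSet.stdSimplex.obj n ⟶ V),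
        mapLeft x M ≫ H = evalHom (x ≫ ρ)) ∧
      (F.obj V).ι ≫ H = F.map (ρ ≫ F.relProj f) ≫ f := by
  -- Values are prescribed by `ρ` on simplices coming from a simplex of `V`, and by `f` on the
  -- stable family. A simplex that meets the part over `S` is of the first kind; any other one lies
  -- in the family.
  let P (n) (t : (partsJoin S T V M).obj n) (c : C.obj n) : Prop :=
    (∃ (m : SimplexCategory) (x : SSet.stdSimplex.obj m ⟶ V)
        (σ : (partsJoin S T (SSet.stdSimplex.obj m) M).obj n),
        (mapLeft x M).app n σ = t ∧ (evalHom (x ≫ ρ)).app n σ = c) ∨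
      ∃ ht : t ∈ (F.obj V).obj n, (F.map (ρ ≫ F.relProj f) ≫ f).app n ⟨t, ht⟩ = c
  obtain ⟨H, hH⟩ : ∃ H : partsJoin S T V M ⟶ C, ∀ {n t c}, P n t c → H.app n t = c := by
    refine exists_hom_of_rel P ?_ ?_ ?_
    · rintro n m g t c (⟨k, x, σ, rfl, rfl⟩ | ⟨ht, rfl⟩)
      · refine Or.inl ⟨k, x, (partsJoin S T _ M).map g σ, ?_, ?_⟩
        · exact NatTrans.naturality_apply (mapLeft x M) g σ
        · exact NatTrans.naturality_apply (evalHom (x ≫ ρ)) g σ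
      · refine Or.inr ⟨(F.obj V).map g ht, ?_⟩
        exact NatTrans.naturality_apply (F.map (ρ ≫ F.relProj f) ≫ f) g ⟨t, ht⟩
    · intro n t
      by_cases h : ∃ i, PartsData.vertex (n := n.unop) t i ∈ S
      · obtain ⟨i, hi⟩ := h
        obtain ⟨y, τ, h, -⟩ := exists_eq_mapLeft t hi
        exact ⟨_, Or.inl ⟨_, y, τ, h, rfl⟩⟩
      · push Not at h
        exact ⟨_, Or.inr ⟨F.mem_of_forall_notMem t h, rfl⟩⟩
    · have key {n t c} (h : ∃ (m : SimplexCategory) (x : SSet.stdSimplex.obj m ⟶ V)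
          (σ : (partsJoin S T (SSet.stdSimplex.obj m) M).obj n),
          (mapLeft x M).app n σ = t ∧ (evalHom (x ≫ ρ)).app n σ = c) (ht : t ∈ (F.obj V).obj n) :
          (F.map (ρ ≫ F.relProj f) ≫ f).app n ⟨t, ht⟩ = c := by
        obtain ⟨m, x, σ, rfl, rfl⟩ := h
        rw [evalHom_app_of_mem _ _ ((F.mem_iff _ _).1 ht)]
        rfl
      rintro n t c c' (h | ⟨ht, rfl⟩) (h' | ⟨ht', rfl⟩)
      -- Two presentations of a simplex that meets the part over `S` both factor through the
      -- universal one.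
      · by_cases hS : ∃ i, PartsData.vertex (n := n.unop) t i ∈ S
        · obtain ⟨i, hi⟩ := hS
          obtain ⟨y, τ, -, hu⟩ := exists_eq_mapLeft t hi
          have aux {c} (h : ∃ (m : SimplexCategory) (x : SSet.stdSimplex.obj m ⟶ V)
              (σ : (partsJoin S T (SSet.stdSimplex.obj m) M).obj n),
              (mapLeft x M).app n σ = t ∧ (evalHom (x ≫ ρ)).app n σ = c) :
              (evalHom (y ≫ ρ)).app n τ = c := by
            obtain ⟨m, x, σ, h, rfl⟩ := h
            obtain ⟨g, rfl, rfl⟩ := hu x σ h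
            rw [Category.assoc, evalHom_comp]
            rfl
          exact (aux h).symm.trans (aux h')
        · push Not at hS
          have ht := F.mem_of_forall_notMem t hS
          exact (key h ht).symm.trans (key h' ht)
      · exact (key h ht').symm
      · exact key h' ht
      · rfl
  refine ⟨H, fun {n} x => ?_, ?_⟩
  · refine NatTrans.ext (funext fun k => ConcreteCategory.hom_ext _ _ fun σ => ?_)
    exact hH (Or.inl ⟨n, x, σ, rfl, rfl⟩)
  · refine NatTrans.ext (funext fun k => ConcreteCategory.hom_ext _ _ fun t => ?_)
    exact hH (Or.inr ⟨t.2, rfl⟩)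

theorem assembly_unique {V : SSet.{u}} {H H' : partsJoin S T V M ⟶ C}
    (h : ∀ {n : SimplexCategory} (x : SSet.stdSimplex.obj n ⟶ V), mapLeft x M ≫ H =
      mapLeft x M ≫ H') (h' : (F.obj V).ι ≫ H = (F.obj V).ι ≫ H') : H = H' := by
  refine NatTrans.ext (funext fun n => ConcreteCategory.hom_ext _ _ fun t => ?_)
  by_cases hS : ∃ i, PartsData.vertex (n := n.unop) t i ∈ S
  · obtain ⟨i, hi⟩ := hS
    obtain ⟨y, τ, rfl, -⟩ := exists_eq_mapLeft t hi
    exact ConcreteCategory.congr_hom (NatTrans.congr_app (h y) n) τ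
  · push Not at hS
    exact ConcreteCategory.congr_hom (NatTrans.congr_app h' n) ⟨t, F.mem_of_forall_notMem t hS⟩

theorem mapLeft_app_injective {A A' : SSet.{u}} (g : A ⟶ A') [Mono g] {n}
    {t t' : (partsJoin S T A M).obj n} (h : (mapLeft g M).app n t = (mapLeft g M).app n t') :
    t = t' := by
  obtain ⟨χ, l, ρ⟩ := t
  obtain ⟨χ', l', ρ'⟩ := t'
  obtain rfl : χ = χ' := congrArg PartsData.χ h
  have h₁ : l ≫ g = l' ≫ g := eq_of_heq (PartsData.mk.inj h).2.1
  obtain rfl : l = l' := (cancel_mono g).1 h₁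
  obtain rfl : ρ = ρ' := eq_of_heq (PartsData.mk.inj h).2.2
  rfl

/-- The map to the simplicial set of relative maps given by a compatible map. -/
theorem exists_hom_relMaps {V : SSet.{u}} (b : V ⟶ L) (H : partsJoin S T V M ⟶ C)
    (hH : (F.obj V).ι ≫ H = F.map b ≫ f) :
    ∃ ρ : V ⟶ F.relMaps f, ρ ≫ F.relProj f = b ∧
      ∀ {n : SimplexCategory} (x : SSet.stdSimplex.obj n ⟶ V),
        evalHom (x ≫ ρ) = mapLeft x M ≫ H := by
  have hx {n} (x : SSet.stdSimplex.obj n ⟶ V) :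
      (F.obj _).ι ≫ mapLeft x M ≫ H = F.map (x ≫ b) ≫ f :=
    congrArg (fun z => F.map x ≫ z) hH
  let ρ : V ⟶ F.relMaps f :=
    { app n := ↾fun x => (⟨b.app n x, mapLeft (SSet.yonedaEquiv.symm x) M ≫ H, by
          rw [hx, SSet.yonedaEquiv_symm_comp]⟩ : F.RelMap f n.unop)
      naturality n m g := by
        refine ConcreteCategory.hom_ext _ _ fun x => RelMap.ext' _ _ ?_ ?_
        · exact NatTrans.naturality_apply b g x
        · exact congrArg (fun z => mapLeft z M ≫ H)
            (SSet.yonedaEquiv_symm_naturality_left g.unop x).symm }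
  refine ⟨ρ, rfl, fun {n} x => ?_⟩
  refine congrArg (fun z => mapLeft z M ≫ H) (Equiv.symm_apply_apply SSet.yonedaEquiv x)

theorem relMaps_hom_ext {V : SSet.{u}} {ρ ρ' : V ⟶ F.relMaps f}
    (hb : ρ ≫ F.relProj f = ρ' ≫ F.relProj f)
    (h : ∀ {n : SimplexCategory} (x : SSet.stdSimplex.obj n ⟶ V),
      evalHom (x ≫ ρ) = evalHom (x ≫ ρ')) : ρ = ρ' := by
  refine NatTrans.ext (funext fun n => ConcreteCategory.hom_ext _ _ fun x => ?_)
  refine RelMap.ext' F f ?_ ?_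
  · exact ConcreteCategory.congr_hom (NatTrans.congr_app hb n) x
  · have := h (n := n.unop) (SSet.yonedaEquiv.symm x)
    rw [evalHom, evalHom, SSet.yonedaEquiv_symm_comp, SSet.yonedaEquiv_symm_comp,
      Equiv.apply_symm_apply, Equiv.apply_symm_apply] at this
    exact this

/-- If maps to `C` extend in the relative cell case, then they extend in general. -/
theorem extends_of_cells
    (hC : ∀ n : ℕ, Extends C (F.obj Δ[n] ⊔
      SSet.Subcomplex.range (mapLeft (SSet.boundary n).ι M))) : Extends C (F.obj L) := by
  intro f
  -- A section of `relProj` assembles to an extension of `f`, so it is enough that `relProj` is a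
  -- trivial fibration. This is tested on boundary inclusions, where a lifting problem is an
  -- instance of the relative cell case.
  have hl : (MorphismProperty.monomorphisms SSet.{u}).rlp (F.relProj f) := by
    rw [SSet.rlp_monomorphisms]
    rintro _ _ _ ⟨n⟩
    refine ⟨fun {ρ x} sq => ?_⟩
    obtain ⟨H, hH, hH'⟩ := exists_assembly ρ
    rw [sq.w] at hH'
    let P (k) (t : (partsJoin S T Δ[n] M).obj k) (c : C.obj k) : Prop :=
      (∃ ht : t ∈ (F.obj Δ[n]).obj k, (F.map x ≫ f).app k ⟨t, ht⟩ = c) ∨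
        ∃ t', (mapLeft (SSet.boundary n).ι M).app k t' = t ∧ H.app k t' = c
    obtain ⟨g, hg⟩ : ∃ g : partsJoin S T Δ[n] M ⟶ C, ∀ {k t c},
        t ∈ (F.obj Δ[n] ⊔ SSet.Subcomplex.range (mapLeft (SSet.boundary n).ι M)).obj k →
          P k t c → g.app k t = c := by
      refine (hC n).exists_of_rel P ?_ ?_ ?_
      · rintro k m θ t c (⟨ht, rfl⟩ | ⟨t', rfl, rfl⟩)
        · refine Or.inl ⟨(F.obj _).map θ ht, ?_⟩
          exact NatTrans.naturality_apply (F.map x ≫ f) θ ⟨t, ht⟩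
        · refine Or.inr ⟨(partsJoin S T _ M).map θ t', ?_, ?_⟩
          · exact NatTrans.naturality_apply (mapLeft (SSet.boundary n).ι M) θ t'
          · exact NatTrans.naturality_apply H θ t'
      · rintro k t (ht | ⟨t', ht'⟩)
        · exact ⟨_, Or.inl ⟨ht, rfl⟩⟩
        · exact ⟨_, Or.inr ⟨t', ht', rfl⟩⟩
      · have key {k} (t) (ht) : (F.map x ≫ f).app k
            ⟨(mapLeft (SSet.boundary n).ι M).app k t, ht⟩ = H.app k t :=
          (ConcreteCategory.congr_hom (NatTrans.congr_app hH' k)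
            ⟨t, (F.mem_iff (SSet.boundary n).ι t).1 ht⟩).symm
        rintro k t c c' (⟨ht, rfl⟩ | ⟨t₁, rfl, rfl⟩) (⟨ht', rfl⟩ | ⟨t₂, h₂, rfl⟩)
        · rfl
        · subst h₂
          exact key _ _
        · exact (key _ _).symm
        · rw [mapLeft_app_injective _ h₂]
    have h₁ : (F.obj Δ[n]).ι ≫ g = F.map x ≫ f := by
      refine NatTrans.ext (funext fun k => ConcreteCategory.hom_ext _ _ fun t => ?_)
      exact hg (Or.inl t.2) (Or.inl ⟨t.2, rfl⟩)
    have h₂ : mapLeft (SSet.boundary n).ι M ≫ g = H := by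
      refine NatTrans.ext (funext fun k => ConcreteCategory.hom_ext _ _ fun t => ?_)
      exact hg (Or.inr ⟨t, rfl⟩) (Or.inr ⟨t, rfl, rfl⟩)
    obtain ⟨l, hl, hl'⟩ := exists_hom_relMaps x g h₁
    refine ⟨⟨⟨l, relMaps_hom_ext ?_ fun y => ?_, hl⟩⟩⟩
    · rw [Category.assoc, hl, sq.w]
    · rw [← hH, ← h₂, ← Category.assoc, hl']
      rfl
  -- Lifting against the inclusion of the empty simplicial set gives the section.
  have sq : CommSq (initial.to (F.relMaps f)) (initial.to L) (F.relProj f) (𝟙 L) :=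
    ⟨initialIsInitial.hom_ext _ _⟩
  have := hl (initial.to L) (MorphismProperty.monomorphisms.infer_property _)
  obtain ⟨H, -, hH⟩ := exists_assembly sq.lift
  refine ⟨H, hH.trans ?_⟩
  rw [sq.fac_right]
  rfl

end StableFamily
end
-- Inner anodyne inclusions from matchings of vertex sets
/-- A description of the simplices of `X` by their vertices in a linear order `V`:
the simplices are the increasing sequences whose underlying set is good. -/
structure VertexModel (X : SSet.{u}) (V : Type) [LinearOrder V] where
  vert : ∀ {n : ℕ}, X _⦋n⦌ → (Fin (n + 1) →o V)
  vert_map : ∀ {n m : ℕ} (f : ⦋m⦌ ⟶ ⦋n⦌) (x : X _⦋n⦌) (i : Fin (m + 1)),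
    vert (X.map f.op x) i = vert x (f.toOrderHom i)
  vert_injective : ∀ {n : ℕ} {x y : X _⦋n⦌}, (∀ i, vert x i = vert y i) → x = y
  Good : Finset V → Prop
  good_vert : ∀ {n : ℕ} (x : X _⦋n⦌), Good (Finset.univ.image (vert x))
  exists_simplex : ∀ {n : ℕ} (S : Finset V) (h : S.card = n + 1), Good S →
    ∃ x : X _⦋n⦌, ∀ i, vert x i = S.orderEmbOfFin h i

namespace VertexModel

variable {X : SSet.{u}} {V : Type} [LinearOrder V] (E : VertexModel X V)

/-- The set of vertices of a simplex. -/
def vset {n : ℕ} (x : X _⦋n⦌) : Finset V := Finset.univ.image (E.vert x)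

theorem vset_map_subset {n m : ℕ} (f : ⦋m⦌ ⟶ ⦋n⦌) (x : X _⦋n⦌) :
    E.vset (X.map f.op x) ⊆ E.vset x := by
  intro v hv
  obtain ⟨i, -, rfl⟩ := Finset.mem_image.1 hv
  rw [E.vert_map]
  exact Finset.mem_image_of_mem _ (Finset.mem_univ _)

theorem nonDegenerate_of_injective {n : ℕ} {x : X _⦋n⦌} (h : Function.Injective (E.vert x)) :
    x ∈ X.nonDegenerate n := by
  rw [SSet.mem_nonDegenerate_iff_notMem_degenerate]
  rintro ⟨m, hm, f, y, rfl⟩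
  have hf : Function.Injective f.toOrderHom := fun i j hij => h (by
    rw [E.vert_map, E.vert_map, hij])
  have := Fintype.card_le_of_injective _ hf
  simp only [Fintype.card_fin, SimplexCategory.len_mk] at this
  omega

/-- If a vertex is repeated, the set of vertices has fewer elements but is still good; it therefore
spans a simplex of lower dimension, of which `x` is a degeneracy. -/
theorem injective_of_nonDegenerate {n : ℕ} {x : X _⦋n⦌} (h : x ∈ X.nonDegenerate n) :
    Function.Injective (E.vert x) := by
  by_contra hinj
  have hcard : (E.vset x).card < n + 1 := by
    refine lt_of_le_of_ne (Finset.card_image_le.trans (by simp)) fun h' => hinj ?_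
    rw [← Set.injOn_univ, ← Finset.coe_univ]
    exact Finset.card_image_iff.1 (h'.trans (by simp))
  have hpos : 0 < (E.vset x).card :=
    Finset.card_pos.2 ⟨_, Finset.mem_image_of_mem _ (Finset.mem_univ 0)⟩
  obtain ⟨m, hm⟩ : ∃ m, (E.vset x).card = m + 1 := ⟨_, (Nat.succ_pred_eq_of_pos hpos).symm⟩
  obtain ⟨y, hy⟩ := E.exists_simplex _ hm (E.good_vert x)
  let e := (E.vset x).orderIsoOfFin hm
  have hx (i) : E.vert x i ∈ E.vset x := Finset.mem_image_of_mem _ (Finset.mem_univ i)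
  let f : ⦋n⦌ ⟶ ⦋m⦌ := SimplexCategory.mkHom
    { toFun := fun i => e.symm ⟨E.vert x i, hx i⟩
      monotone' := fun i j hij => e.symm.monotone (by exact (E.vert x).monotone hij) }
  refine (SSet.mem_nonDegenerate_iff_notMem_degenerate _ _).1 h ⟨m, by omega, f, y, ?_⟩
  refine E.vert_injective fun i => ?_
  rw [E.vert_map, hy]
  change (E.vset x).orderEmbOfFin hm (e.symm ⟨E.vert x i, hx i⟩) = _
  rw [← Finset.coe_orderIsoOfFin_apply]
  change ((e (e.symm ⟨E.vert x i, hx i⟩) : E.vset x) : V) = _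
  rw [OrderIso.apply_symm_apply]

theorem card_vset {n : ℕ} {x : X _⦋n⦌} (h : x ∈ X.nonDegenerate n) :
    (E.vset x).card = n + 1 := by
  rw [vset, Finset.card_image_of_injective _ (E.injective_of_nonDegenerate h)]
  simp

theorem vert_eq_orderEmbOfFin {n : ℕ} {x : X _⦋n⦌} (h : x ∈ X.nonDegenerate n) {S : Finset V}
    (hS : E.vset x = S) (hc : S.card = n + 1) (i) : E.vert x i = S.orderEmbOfFin hc i := by
  refine congrFun (Finset.orderEmbOfFin_unique hc (f := E.vert x) (fun i => ?_) ?_) i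
  · rw [← hS]
    exact Finset.mem_image_of_mem _ (Finset.mem_univ i)
  · exact (E.vert x).monotone.strictMono_of_injective (E.injective_of_nonDegenerate h)

theorem mk_eq_mk_iff {n m : ℕ} {x : X _⦋n⦌} {y : X _⦋m⦌} (hx : x ∈ X.nonDegenerate n)
    (hy : y ∈ X.nonDegenerate m) : SSet.S.mk x = SSet.S.mk y ↔ E.vset x = E.vset y := by
  refine ⟨fun h => congrArg (fun s : X.S => E.vset s.simplex) h, fun h => ?_⟩
  obtain rfl : n = m := by
    have h₁ := E.card_vset hx
    have h₂ := E.card_vset hy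
    rw [h] at h₁
    omega
  obtain rfl : x = y := E.vert_injective fun i => by
    rw [E.vert_eq_orderEmbOfFin hx h (E.card_vset hy),
      E.vert_eq_orderEmbOfFin hy rfl (E.card_vset hy)]
  rfl

/-- Data on the subsets of `V` that defines an inner regular pairing of the simplices that are
not in a subcomplex `A`: these are matched by adding or removing a corner. -/
structure CornerData (A : X.Subcomplex) where
  Full : Finset V → Prop
  notMem_iff : ∀ {n : ℕ} (x : X _⦋n⦌), x ∉ A.obj _ ↔ Full (E.vset x)
  corner : Finset V → V
  full_insert : ∀ {S : Finset V}, E.Good S → Full S → Full (insert (corner S) S)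
  good_insert : ∀ {S : Finset V}, E.Good S → Full S → E.Good (insert (corner S) S)
  corner_insert : ∀ {S : Finset V}, E.Good S → Full S → corner (insert (corner S) S) = corner S
  full_erase : ∀ {S : Finset V}, E.Good S → Full S → Full (S.erase (corner S))
  corner_erase : ∀ {S : Finset V}, E.Good S → Full S → corner (S.erase (corner S)) = corner S
  exists_lt : ∀ {S : Finset V}, E.Good S → Full S → ∃ a ∈ S, a < corner S
  exists_gt : ∀ {S : Finset V}, E.Good S → Full S → ∃ a ∈ S, corner S < a
  weight : V → ℕ
  weight_lt : ∀ {S : Finset V} {z : V}, E.Good S → Full S → corner S ∈ S → z ∈ S → z ≠ corner S →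
    corner (S.erase z) ∉ S.erase z → weight (corner S) < weight z

namespace CornerData

variable {E} {A : X.Subcomplex} (D : E.CornerData A)

/-- The index type of the pairing. -/
structure Index where
  dim : ℕ
  set : Finset V
  card_eq : set.card = dim + 2
  good : E.Good set
  full : D.Full set
  mem : D.corner set ∈ set

variable {D}

theorem Index.ext' {s t : D.Index} (h : s.set = t.set) : s = t := by
  obtain ⟨d, S, hc, _, _, _⟩ := s
  obtain ⟨d', S', hc', _, _, _⟩ := t
  subst h
  obtain rfl : d = d' := by dsimp at hc hc'; omega
  rfl

/-- The first simplex of a pair. -/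
def Index.simplex (s : D.Index) : X _⦋s.dim + 1⦌ :=
  (E.exists_simplex s.set s.card_eq s.good).choose

theorem Index.vert_simplex (s : D.Index) (i) :
    E.vert s.simplex i = s.set.orderEmbOfFin s.card_eq i :=
  (E.exists_simplex s.set s.card_eq s.good).choose_spec i

theorem Index.vset_simplex (s : D.Index) : E.vset s.simplex = s.set := by
  have : (E.vert s.simplex : Fin _ → V) = s.set.orderEmbOfFin s.card_eq :=
    funext s.vert_simplex
  rw [vset, this]
  exact Finset.image_orderEmbOfFin_univ _ _

theorem Index.injective_vert (s : D.Index) : Function.Injective (E.vert s.simplex) := by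
  intro i j h
  rw [s.vert_simplex, s.vert_simplex] at h
  exact (s.set.orderEmbOfFin s.card_eq).injective h

theorem Index.exists_index (s : D.Index) :
    ∃ i, E.vert s.simplex i = D.corner s.set := by
  have h := s.mem
  rw [← s.vset_simplex] at h
  obtain ⟨i, -, hi⟩ := Finset.mem_image.1 h
  refine ⟨i, hi.trans ?_⟩
  rw [s.vset_simplex]

/-- The position of the corner. -/
def Index.index (s : D.Index) : Fin (s.dim + 2) := s.exists_index.choose

theorem Index.vert_index (s : D.Index) : E.vert s.simplex s.index = D.corner s.set :=
  s.exists_index.choose_spec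

theorem Index.vert_δ (s : D.Index) (i : Fin (s.dim + 2)) (j : Fin (s.dim + 1)) :
    E.vert (X.δ i s.simplex) j = E.vert s.simplex (i.succAbove j) :=
  E.vert_map _ _ _

theorem Index.injective_vert_δ (s : D.Index) (i : Fin (s.dim + 2)) :
    Function.Injective (E.vert (X.δ i s.simplex)) := by
  intro j k h
  rw [s.vert_δ, s.vert_δ] at h
  exact Fin.succAbove_right_injective (s.injective_vert h)

theorem Index.vset_δ (s : D.Index) (i : Fin (s.dim + 2)) :
    E.vset (X.δ i s.simplex) = s.set.erase (E.vert s.simplex i) := by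
  ext v
  rw [← s.vset_simplex, Finset.mem_erase]
  simp only [vset, Finset.mem_image, Finset.mem_univ, true_and]
  constructor
  · rintro ⟨j, rfl⟩
    rw [s.vert_δ]
    exact ⟨fun h => Fin.succAbove_ne _ _ (s.injective_vert h), _, rfl⟩
  · rintro ⟨hv, j, rfl⟩
    obtain ⟨k, rfl⟩ := Fin.exists_succAbove_eq (x := j) (y := i) (fun h => hv (by rw [h]))
    exact ⟨k, s.vert_δ i k⟩

theorem Index.vset_δ_index (s : D.Index) :
    E.vset (X.δ s.index s.simplex) = s.set.erase (D.corner s.set) := by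
  rw [s.vset_δ, s.vert_index]

/-- Erasing the corner does not change the corner of the set, so the erased vertex can be recovered
and put back. -/
theorem Index.ext_of_erase {s t : D.Index}
    (h : s.set.erase (D.corner s.set) = t.set.erase (D.corner t.set)) : s = t := by
  have h' : D.corner s.set = D.corner t.set := by
    rw [← D.corner_erase s.good s.full, h, D.corner_erase t.good t.full]
  refine Index.ext' ?_
  rw [← Finset.insert_erase s.mem, h, h', Finset.insert_erase t.mem]

theorem Index.eq_of_δ_eq (s : D.Index) {i j : Fin (s.dim + 2)}
    (hij : X.δ i s.simplex = X.δ j s.simplex) : i = j := by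
  refine s.injective_vert ?_
  have h : s.set.erase (E.vert s.simplex i) = s.set.erase (E.vert s.simplex j) := by
    rw [← s.vset_δ, ← s.vset_δ, hij]
  have hi' : E.vert s.simplex i ∈ s.set := by
    rw [s.vert_simplex]
    exact Finset.orderEmbOfFin_mem _ _ _
  by_contra hne
  have := Finset.mem_erase.2 ⟨hne, hi'⟩
  rw [← h] at this
  exact Finset.notMem_erase _ _ this

/-- For reasons of cardinality, the second simplex of `s` is the first simplex of `t` with one
vertex `z` removed, and `z` is not the corner of `t` since `s ≠ t`. The two sums thus omit the
weights of `z` and of the corner of `t` from the same total, and `weight_lt` says that `z` is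
heavier. This descent makes the pairing regular. -/
theorem Index.sum_weight_lt {s t : D.Index} (hne : s ≠ t) (hd : s.dim = t.dim)
    (hsub : s.set.erase (D.corner s.set) ⊆ t.set) :
    ∑ x ∈ s.set.erase (D.corner s.set), D.weight x <
      ∑ x ∈ t.set.erase (D.corner t.set), D.weight x := by
  have hc := Finset.card_erase_of_mem s.mem
  have hcs := s.card_eq
  have hct := t.card_eq
  obtain ⟨z, hz, hz'⟩ := Finset.exists_mem_notMem_of_card_lt_card
    (s := s.set.erase (D.corner s.set)) (t := t.set) (by omega)
  have heq : s.set.erase (D.corner s.set) = t.set.erase z := by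
    refine Finset.eq_of_subset_of_card_le
      (fun a ha => Finset.mem_erase.2 ⟨fun h => hz' (h ▸ ha), hsub ha⟩) ?_
    rw [Finset.card_erase_of_mem hz]
    omega
  have hzu : z ≠ D.corner t.set := by
    rintro rfl
    exact hne (Index.ext_of_erase heq)
  have hlt' := D.weight_lt t.good t.full t.mem hz hzu
    (by rw [← heq, D.corner_erase s.good s.full]
        exact Finset.notMem_erase _ _)
  have h₁ := Finset.add_sum_erase _ D.weight hz
  have h₂ := Finset.add_sum_erase _ D.weight t.mem
  rw [heq]
  omega

variable (D)

/-- The pairing given by corners. -/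
def pairingCore : A.PairingCore where
  ι := D.Index
  dim s := s.dim
  simplex s := s.simplex
  index s := s.index
  nonDegenerate₁ s := E.nonDegenerate_of_injective s.injective_vert
  nonDegenerate₂ s := E.nonDegenerate_of_injective (s.injective_vert_δ _)
  notMem₁ s := by
    rw [D.notMem_iff, s.vset_simplex]
    exact s.full
  notMem₂ s := by
    rw [D.notMem_iff, s.vset_δ_index]
    exact D.full_erase s.good s.full
  injective_type₁' {s t} h := by
    rw [E.mk_eq_mk_iff (E.nonDegenerate_of_injective s.injective_vert)
      (E.nonDegenerate_of_injective t.injective_vert), s.vset_simplex, t.vset_simplex] at h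
    exact Index.ext' h
  injective_type₂' {s t} h := by
    rw [E.mk_eq_mk_iff (E.nonDegenerate_of_injective (s.injective_vert_δ _))
      (E.nonDegenerate_of_injective (t.injective_vert_δ _)), s.vset_δ_index, t.vset_δ_index] at h
    exact Index.ext_of_erase h
  type₁_ne_type₂' s t h := by
    rw [E.mk_eq_mk_iff (E.nonDegenerate_of_injective s.injective_vert)
      (E.nonDegenerate_of_injective (t.injective_vert_δ _)), s.vset_simplex, t.vset_δ_index] at h
    have h' := s.mem
    rw [h, D.corner_erase t.good t.full] at h'
    exact Finset.notMem_erase _ _ h'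
  surjective' x := by
    have hx := E.card_vset x.nonDegenerate
    have hfull := (D.notMem_iff _).1 x.notMem
    have hgood : E.Good (E.vset x.simplex) := E.good_vert _
    by_cases hu : D.corner (E.vset x.simplex) ∈ E.vset x.simplex
    -- A vertex below the corner ensures at least two vertices, so that the subtraction in `card -
    -- 2` is not truncated.
    · obtain ⟨a, ha, ha'⟩ := D.exists_lt hgood hfull
      have : 1 < (E.vset x.simplex).card := Finset.one_lt_card.2 ⟨a, ha, _, hu, ha'.ne⟩
      refine ⟨⟨(E.vset x.simplex).card - 2, _, by omega, hgood, hfull, hu⟩, Or.inl ?_⟩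
      refine (E.mk_eq_mk_iff x.nonDegenerate
        (E.nonDegenerate_of_injective (Index.injective_vert _))).2 ?_
      rw [Index.vset_simplex]
    · refine ⟨⟨x.dim, insert (D.corner (E.vset x.simplex)) (E.vset x.simplex), ?_,
        D.good_insert hgood hfull, D.full_insert hgood hfull, ?_⟩, Or.inr ?_⟩
      · rw [Finset.card_insert_of_notMem hu, hx]
      · rw [D.corner_insert hgood hfull]
        exact Finset.mem_insert_self _ _
      · refine (E.mk_eq_mk_iff x.nonDegenerate
          (E.nonDegenerate_of_injective (Index.injective_vert_δ _ _))).2 ?_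
        rw [Index.vset_δ_index]
        dsimp only
        rw [D.corner_insert hgood hfull, Finset.erase_insert hu]

instance : D.pairingCore.IsProper where
  isUniquelyCodimOneFace s := by
    exact (SSet.S.IsUniquelyCodimOneFace.iff _ _).2 ⟨_, rfl, fun i hi => Index.eq_of_δ_eq s hi⟩

instance : D.pairingCore.IsInner where
  ne_zero (s : D.Index) h := by
    obtain ⟨a, ha, ha'⟩ := D.exists_lt s.good s.full
    rw [← s.vset_simplex] at ha
    obtain ⟨i, -, rfl⟩ := Finset.mem_image.1 ha
    rw [← s.vert_index] at ha'
    have : s.index = 0 := h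
    rw [this] at ha'
    exact absurd ((E.vert _).monotone (Fin.zero_le i)) (not_le.2 ha')
  ne_last (s : D.Index) h := by
    obtain ⟨a, ha, ha'⟩ := D.exists_gt s.good s.full
    rw [← s.vset_simplex] at ha
    obtain ⟨i, -, rfl⟩ := Finset.mem_image.1 ha
    rw [← s.vert_index] at ha'
    have : s.index = Fin.last _ := h
    rw [this] at ha'
    exact absurd ((E.vert _).monotone (Fin.le_last i)) (not_le.2 ha')

/-- The weight of the vertices of the second simplex of a pair decreases along the
ancestrality relation. -/
def weakRankFunction : D.pairingCore.WeakRankFunction ℕ where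
  rank (s : D.Index) := ∑ x ∈ s.set.erase (D.corner s.set), D.weight x
  lt {s t} hst hd := by
    obtain ⟨f, hf⟩ := SSet.S.le_iff.1 (show (D.pairingCore.type₂ s).toS ≤
      (D.pairingCore.type₁ t).toS from hst.2.le)
    refine Index.sum_weight_lt hst.1 hd ?_
    refine (Index.vset_δ_index s).symm.subset.trans (Finset.Subset.trans ?_
      (Index.vset_simplex t).subset)
    exact (congrArg E.vset hf).symm.subset.trans (E.vset_map_subset f (Index.simplex t))

theorem innerAnodyneExtensions (D : E.CornerData A) : SSet.innerAnodyneExtensions A.ι :=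
  have : D.pairingCore.IsRegular := D.weakRankFunction.isRegular
  D.pairingCore.pairing.innerAnodyneExtensions

end CornerData
end VertexModel
-- The combinatorics of corners
/-- The vertices of the generalized join of two standard simplices. -/
@[ext]
structure JoinVertex where
  c : ℕ
  k : ℕ
  w : ℕ

namespace JoinVertex

instance : LinearOrder JoinVertex :=
  LinearOrder.lift' (fun v => toLex (v.c, toLex (v.k, v.w))) (by
    rintro ⟨c, k, w⟩ ⟨c', k', w'⟩ h
    have h' := congrArg ofLex h
    simp only [ofLex_toLex, Prod.mk.injEq, EmbeddingLike.apply_eq_iff_eq] at h'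
    obtain ⟨rfl, rfl, rfl⟩ := h'
    rfl)

theorem le_iff {a b : JoinVertex} :
    a ≤ b ↔ a.c < b.c ∨ a.c = b.c ∧ (a.k < b.k ∨ a.k = b.k ∧ a.w ≤ b.w) := by
  change toLex (a.c, toLex (a.k, a.w)) ≤ toLex (b.c, toLex (b.k, b.w)) ↔ _
  simp only [Prod.Lex.toLex_le_toLex]

theorem lt_of_c_lt {a b : JoinVertex} (h : a.c < b.c) : a < b :=
  lt_of_not_ge fun h' => by
    rw [le_iff] at h'
    omega

/-- The conditions for a set to be the set of vertices of a simplex, where the vertices in the parts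
satisfying `ty` have a component `w` that increases, and those in the positive parts have a
component `k` that increases. -/
structure IsGood (r n m : ℕ) (ty : ℕ → Prop) (S : Finset JoinVertex) : Prop where
  c_le : ∀ x ∈ S, x.c ≤ r
  k_le : ∀ x ∈ S, x.k ≤ n
  w_le : ∀ x ∈ S, x.w ≤ m
  k_eq : ∀ x ∈ S, x.c = 0 → x.k = 0
  w_eq : ∀ x ∈ S, ¬ ty x.c → x.w = 0
  k_mono : ∀ x ∈ S, ∀ y ∈ S, x ≤ y → x.k ≤ y.k
  w_mono : ∀ x ∈ S, ∀ y ∈ S, x ≤ y → ty x.c → ty y.c → x.w ≤ y.w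

/-- The conditions for a set to be the set of vertices of a simplex that is not in a certain
subcomplex. -/
structure IsFull (n m : ℕ) (ty : ℕ → Prop) (S : Finset JoinVertex) : Prop where
  zero : ∃ x ∈ S, x.c = 0
  two : ∃ x ∈ S, 2 ≤ x.c
  k : ∀ k ≤ n, ∃ x ∈ S, x.c ≠ 0 ∧ x.k = k
  w : ∀ w ≤ m, ∃ x ∈ S, ty x.c ∧ x.w = w

/-- The least component `k` in the parts from the second on. -/
def minK (S : Finset JoinVertex) : ℕ := sInf {k | ∃ b ∈ S, 2 ≤ b.c ∧ b.k = k}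

/-- The largest component `w` among the vertices before the corner. -/
def maxW (S : Finset JoinVertex) : ℕ :=
  (S.filter fun x => x.c = 0 ∨ x.c = 1 ∧ x.k < minK S).sup w

open Classical in
/-- The vertex that is added or removed in order to match simplices. -/
def corner (ty : ℕ → Prop) (S : Finset JoinVertex) : JoinVertex :=
  ⟨1, minK S, if ty 1 then maxW S else 0⟩

variable {r n m : ℕ} {ty : ℕ → Prop} {S S' : Finset JoinVertex}

/-- The corner is read off from the vertices over `2, …, r` and from those over `0`, or over `1`
with `k < minK S`. It is itself of neither kind, which is why adding or removing it does not move
it. -/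
theorem corner_congr (h₂ : ∀ x, 2 ≤ x.c → (x ∈ S ↔ x ∈ S'))
    (h₁ : ∀ x, (x.c = 0 ∨ x.c = 1 ∧ x.k < minK S) → (x ∈ S ↔ x ∈ S')) :
    corner ty S = corner ty S' := by
  have hk : minK S = minK S' := by
    refine congrArg sInf (Set.ext fun k => exists_congr fun b => ?_)
    exact and_congr_left fun hb => h₂ b hb.1
  have hw : maxW S = maxW S' := by
    rw [maxW, maxW, ← hk]
    refine congrArg (fun F : Finset JoinVertex => F.sup w) (Finset.ext fun x => ?_)
    rw [Finset.mem_filter, Finset.mem_filter]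
    exact and_congr_left (h₁ x)
  rw [corner, corner, hk, hw]

theorem minK_le {b : JoinVertex} (hb : b ∈ S) (hb' : 2 ≤ b.c) : minK S ≤ b.k :=
  Nat.sInf_le ⟨b, hb, hb', rfl⟩

theorem IsFull.exists_minK (h : IsFull n m ty S) : ∃ b ∈ S, 2 ≤ b.c ∧ b.k = minK S := by
  obtain ⟨b, hb, hb'⟩ := h.two
  exact Nat.sInf_mem (s := {k | ∃ b ∈ S, 2 ≤ b.c ∧ b.k = k}) ⟨_, b, hb, hb', rfl⟩

theorem le_maxW {x : JoinVertex} (hx : x ∈ S) (hx' : x.c = 0 ∨ x.c = 1 ∧ x.k < minK S) :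
    x.w ≤ maxW S :=
  Finset.le_sup (f := w) (Finset.mem_filter.2 ⟨hx, hx'⟩)

theorem IsFull.exists_maxW (h : IsFull n m ty S) :
    ∃ x ∈ S, (x.c = 0 ∨ x.c = 1 ∧ x.k < minK S) ∧ x.w = maxW S := by
  obtain ⟨a, ha, ha'⟩ := h.zero
  obtain ⟨x, hx, hx'⟩ := Finset.exists_mem_eq_sup
    (S.filter fun x => x.c = 0 ∨ x.c = 1 ∧ x.k < minK S)
    ⟨a, Finset.mem_filter.2 ⟨ha, Or.inl ha'⟩⟩ JoinVertex.w
  rw [Finset.mem_filter] at hx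
  exact ⟨x, hx.1, hx.2, hx'.symm⟩

theorem corner_w (h : ty 1) : (corner ty S).w = maxW S := if_pos h

theorem corner_w_of_not (h : ¬ ty 1) : (corner ty S).w = 0 := if_neg h

/-- Seen as an increasing path, `S` receives the corner over `1` right after the vertices counted in
`maxW`. Its `k` is the least one over `2, …, r`, so no later vertex has a smaller `k`; its `w`, if
the part over `1` has this component, is the largest one before it, so all later typed vertices have
at least this `w`. -/
theorem IsGood.insert_corner (h0 : ty 0) (hg : IsGood r n m ty S) (hf : IsFull n m ty S) :
    IsGood r n m ty (insert (corner ty S) S) := by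
  obtain ⟨b, hb, hbc, hbk⟩ := hf.exists_minK
  obtain ⟨p, hp, hpc, hpw⟩ := hf.exists_maxW
  have hc : (corner ty S).c = 1 := rfl
  have hk : (corner ty S).k = minK S := rfl
  have hp_ty (h1 : ty 1) : ty p.c := by
    rcases hpc with h | ⟨h, -⟩ <;> rwa [h]
  refine ⟨?_, ?_, ?_, ?_, ?_, ?_, ?_⟩
  · intro x hx
    rcases Finset.mem_insert.1 hx with rfl | hx
    · have := hg.c_le b hb
      omega
    · exact hg.c_le x hx
  · intro x hx
    rcases Finset.mem_insert.1 hx with rfl | hx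
    · rw [hk, ← hbk]
      exact hg.k_le b hb
    · exact hg.k_le x hx
  · intro x hx
    rcases Finset.mem_insert.1 hx with rfl | hx
    · by_cases h1 : ty 1
      · rw [corner_w h1, ← hpw]
        exact hg.w_le p hp
      · rw [corner_w_of_not h1]
        exact Nat.zero_le _
    · exact hg.w_le x hx
  · intro x hx hx'
    rcases Finset.mem_insert.1 hx with rfl | hx
    · omega
    · exact hg.k_eq x hx hx'
  · intro x hx hx'
    rcases Finset.mem_insert.1 hx with rfl | hx
    · exact corner_w_of_not hx'
    · exact hg.w_eq x hx hx'
  · intro x hx y hy hxy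
    rcases Finset.mem_insert.1 hx with rfl | hx <;> rcases Finset.mem_insert.1 hy with rfl | hy
    · rfl
    · rw [le_iff] at hxy
      by_cases h2 : 2 ≤ y.c
      · exact minK_le hy h2
      · omega
    · rw [le_iff] at hxy
      by_cases h0 : x.c = 0
      · rw [hg.k_eq x hx h0]
        exact Nat.zero_le _
      · omega
    · exact hg.k_mono x hx y hy hxy
  · intro x hx y hy hxy hx' hy'
    rcases Finset.mem_insert.1 hx with rfl | hx <;> rcases Finset.mem_insert.1 hy with rfl | hy
    · rfl
    · rw [corner_w hx', ← hpw]
      refine hg.w_mono p hp y hy ?_ (hp_ty hx') hy'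
      rw [le_iff] at hxy ⊢
      omega
    · rw [corner_w hy']
      by_cases hx₁ : x.c = 0 ∨ x.c = 1 ∧ x.k < minK S
      · exact le_maxW hx hx₁
      · rw [le_iff, corner_w hy'] at hxy
        omega
    · exact hg.w_mono x hx y hy hxy hx' hy'

theorem IsFull.mono (h : IsFull n m ty S) (hs : S ⊆ S') : IsFull n m ty S' where
  zero := h.zero.imp fun _ h => ⟨hs h.1, h.2⟩
  two := h.two.imp fun _ h => ⟨hs h.1, h.2⟩
  k k hk := (h.k k hk).imp fun _ h => ⟨hs h.1, h.2⟩
  w w hw := (h.w w hw).imp fun _ h => ⟨hs h.1, h.2⟩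

theorem ne_corner_of_c {x : JoinVertex} (h : x.c ≠ 1) : x ≠ corner ty S := by
  rintro rfl
  exact h rfl

theorem ne_corner_of_k {x : JoinVertex} (h : x.k < minK S) : x ≠ corner ty S := by
  rintro rfl
  exact lt_irrefl _ h

/-- The `k` of the corner is also attained by the vertex over `2, …, r` that realizes `minK`, and
its `w` by the earlier vertex that realizes `maxW`. No witness over `0` or over `2, …, r` is lost,
since the corner lies over `1`. -/
theorem IsFull.erase_corner (h0 : ty 0) (hf : IsFull n m ty S) :
    IsFull n m ty (S.erase (corner ty S)) where
  zero := hf.zero.imp fun _ h => ⟨Finset.mem_erase.2 ⟨ne_corner_of_c (by omega), h.1⟩, h.2⟩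
  two := hf.two.imp fun _ h => ⟨Finset.mem_erase.2 ⟨ne_corner_of_c (by omega), h.1⟩, h.2⟩
  k k hk := by
    obtain ⟨x, hx, hxc, rfl⟩ := hf.k k hk
    by_cases h : x = corner ty S
    · obtain ⟨b, hb, hbc, hbk⟩ := hf.exists_minK
      refine ⟨b, Finset.mem_erase.2 ⟨ne_corner_of_c (by omega), hb⟩, by omega, ?_⟩
      rw [hbk, h]
      rfl
    · exact ⟨x, Finset.mem_erase.2 ⟨h, hx⟩, hxc, rfl⟩
  w w hw := by
    obtain ⟨x, hx, hxc, rfl⟩ := hf.w w hw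
    by_cases h : x = corner ty S
    · have h1 : ty 1 := by rwa [h] at hxc
      obtain ⟨p, hp, hpc, hpw⟩ := hf.exists_maxW
      refine ⟨p, Finset.mem_erase.2 ⟨?_, hp⟩, ?_, ?_⟩
      · rcases hpc with hpc | hpc
        · exact ne_corner_of_c (by omega)
        · exact ne_corner_of_k hpc.2
      · rcases hpc with h | ⟨h, -⟩ <;> rwa [h]
      · rw [hpw, h, corner_w h1]
    · exact ⟨x, Finset.mem_erase.2 ⟨h, hx⟩, hxc, rfl⟩

theorem corner_insert_corner : corner ty (insert (corner ty S) S) = corner ty S := by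
  refine (corner_congr (fun x hx => ?_) fun x hx => ?_).symm <;> rw [Finset.mem_insert]
  · exact (or_iff_right (ne_corner_of_c (by omega))).symm
  · refine (or_iff_right ?_).symm
    rcases hx with hx | hx
    · exact ne_corner_of_c (by omega)
    · exact ne_corner_of_k hx.2

theorem corner_erase {z : JoinVertex} (hz : z.c = 1) (hz' : minK S ≤ z.k) :
    corner ty (S.erase z) = corner ty S := by
  refine (corner_congr (fun x hx => ?_) fun x hx => ?_).symm <;> rw [Finset.mem_erase]
  · refine (and_iff_right ?_).symm
    rintro rfl
    omega
  · refine (and_iff_right ?_).symm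
    rintro rfl
    omega

/-- The weight of a vertex. -/
def weight (n : ℕ) (x : JoinVertex) : ℕ := if x.c = 1 then n - x.k else n + 1

/-- If `z` lay over `1` with `minK S ≤ z.k`, removing it would leave the corner in place and in the
set. So either `z` lies over `1` with smaller `k`, hence larger `n - k`, or it lies elsewhere and
has weight `n + 1`. -/
theorem weight_lt (hg : IsGood r n m ty S) (hf : IsFull n m ty S) {z : JoinVertex}
    (hu : corner ty S ∈ S) (hz : z ∈ S) (hne : z ≠ corner ty S)
    (h : corner ty (S.erase z) ∉ S.erase z) :
    weight n (corner ty S) < weight n z := by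
  have hw : weight n (corner ty S) = n - minK S := rfl
  obtain ⟨b, hb, hbc, hbk⟩ := hf.exists_minK
  have hbn := hg.k_le b hb
  have hzn := hg.k_le z hz
  rw [hw, weight]
  split_ifs with hc
  · by_contra hlt
    rw [corner_erase hc (by omega)] at h
    exact h (Finset.mem_erase.2 ⟨hne.symm, hu⟩)
  · omega

end JoinVertex

/-! ### Vertices of simplices of generalized joins of standard simplices -/

/-- A vertex of a standard simplex. -/
def pt (N : SimplexCategory) (i : Fin (N.len + 1)) :
    (SSet.stdSimplex.obj N : SSet.{u}).obj (op ⦋0⦌) :=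
  SSet.stdSimplex.objEquiv.symm (SimplexCategory.const ⦋0⦌ N i)

section

variable {r : ℕ} {N : SimplexCategory} {χ : SSet.stdSimplex.{u}.obj N ⟶ Δ[r]}
  {U : Finset (Fin (r + 1))} {n : ℕ}

theorem pt_mem_part {i : Fin (N.len + 1)} (hi : vtx (SSet.yonedaEquiv χ) i ∈ U) :
    pt N i ∈ (part χ U).obj (op ⦋0⦌) :=
  (mem_part_iff χ U _).2 fun _ => hi

open Classical in
/-- The vertices of a map from a part of a standard simplex to a standard simplex. -/
def partVertex (l : (part χ U : SSet.{u}) ⟶ Δ[n]) (i : Fin (N.len + 1)) : ℕ :=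
  -- The value `0` off the part is what `k_eq` and `w_eq` in `JoinVertex.IsGood` require; it keeps
  -- vertex sets and simplices in bijection.
  if hi : vtx (SSet.yonedaEquiv χ) i ∈ U then
    (vtx (l.app (op ⦋0⦌) ⟨pt N i, pt_mem_part hi⟩) 0).val else 0

theorem partVertex_of_notMem (l : (part χ U : SSet.{u}) ⟶ Δ[n]) {i : Fin (N.len + 1)}
    (hi : vtx (SSet.yonedaEquiv χ) i ∉ U) : partVertex l i = 0 := dif_neg hi

theorem vtx_app_part (l : (part χ U : SSet.{u}) ⟶ Δ[n]) {k : SimplexCategoryᵒᵖ}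
    (x : (part χ U : SSet.{u}).obj k) (i : Fin (k.unop.len + 1)) :
    (vtx (l.app k x) i).val = partVertex l (vtx x.1 i) := by
  have hi := (mem_part_iff χ U _).1 x.2 i
  rw [partVertex, dif_pos hi]
  have h := NatTrans.naturality_apply l (SimplexCategory.const ⦋0⦌ k.unop i).op x
  have h' : (part χ U : SSet.{u}).map (SimplexCategory.const ⦋0⦌ k.unop i).op x =
      ⟨pt N (vtx x.1 i), pt_mem_part hi⟩ := Subtype.ext (vtx_ext fun j => rfl)
  rw [h'] at h
  rw [h]
  rfl

theorem partVertex_le (l : (part χ U : SSet.{u}) ⟶ Δ[n]) (i : Fin (N.len + 1)) :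
    partVertex l i ≤ n := by
  rw [partVertex]
  split_ifs
  · exact Fin.is_le _
  · exact Nat.zero_le _

theorem partVertex_mono (l : (part χ U : SSet.{u}) ⟶ Δ[n]) {i j : Fin (N.len + 1)} (hij : i ≤ j)
    (hi : vtx (SSet.yonedaEquiv χ) i ∈ U) (hj : vtx (SSet.yonedaEquiv χ) j ∈ U) :
    partVertex l i ≤ partVertex l j := by
  let e : (SSet.stdSimplex.obj N : SSet.{u}).obj (op ⦋1⦌) :=
    SSet.stdSimplex.objEquiv.symm (SimplexCategory.mkOfLe i j hij)
  have he : e ∈ (part χ U).obj (op ⦋1⦌) := by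
    rw [mem_part_iff, Fin.forall_fin_two]
    exact ⟨hi, hj⟩
  have h₀ := vtx_app_part l ⟨e, he⟩ 0
  have h₁ := vtx_app_part l ⟨e, he⟩ 1
  refine h₀.symm.le.trans (le_trans ?_ h₁.le)
  exact vtx_monotone (l.app (op ⦋1⦌) ⟨e, he⟩) (Fin.zero_le 1)

theorem part_hom_ext {l l' : (part χ U : SSet.{u}) ⟶ Δ[n]}
    (h : ∀ i, vtx (SSet.yonedaEquiv χ) i ∈ U → partVertex l i = partVertex l' i) : l = l' := by
  refine NatTrans.ext (funext fun k => ConcreteCategory.hom_ext _ _ fun x => ?_)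
  refine vtx_ext (n := ⦋n⦌) fun i => Fin.ext ?_
  rw [vtx_app_part, vtx_app_part]
  exact h _ ((mem_part_iff χ U _).1 x.2 i)

theorem partVertex_precomp {N' : SimplexCategory} (f : N' ⟶ N)
    (l : (part χ U : SSet.{u}) ⟶ Δ[n]) (i : Fin (N'.len + 1)) :
    partVertex (partMap (SSet.stdSimplex.map f) χ U ≫ l) i = partVertex l (f.toOrderHom i) := by
  have h := vtx_yonedaEquiv_comp f χ i
  by_cases hi : vtx (SSet.yonedaEquiv χ) (f.toOrderHom i) ∈ U
  · rw [partVertex, dif_pos (by rwa [h]), partVertex, dif_pos hi]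
    rfl
  · rw [partVertex, dif_neg (by rwa [h]), partVertex, dif_neg hi]

theorem exists_part_hom (g : Fin (N.len + 1) → ℕ)
    (hg : ∀ i, vtx (SSet.yonedaEquiv χ) i ∈ U → g i ≤ n)
    (hg' : ∀ i j, i ≤ j → vtx (SSet.yonedaEquiv χ) i ∈ U → vtx (SSet.yonedaEquiv χ) j ∈ U →
      g i ≤ g j) :
    ∃ l : (part χ U : SSet.{u}) ⟶ Δ[n],
      ∀ i, vtx (SSet.yonedaEquiv χ) i ∈ U → partVertex l i = g i := by
  have hU {k : SimplexCategoryᵒᵖ} (x : (part χ U : SSet.{u}).obj k) (i : Fin (k.unop.len + 1)) :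
      vtx (SSet.yonedaEquiv χ) (vtx x.1 i) ∈ U := (mem_part_iff χ U _).1 x.2 i
  let l : (part χ U : SSet.{u}) ⟶ Δ[n] :=
    { app k := ↾fun x => SSet.stdSimplex.objEquiv.symm (SimplexCategory.mkHom
        { toFun := fun i => ⟨g (vtx x.1 i), Nat.lt_succ_of_le (hg _ (hU x i))⟩
          monotone' := fun i j hij => hg' _ _ (vtx_monotone _ hij) (hU x i) (hU x j) })
      naturality k k' f := by
        refine ConcreteCategory.hom_ext _ _ fun x => ?_
        exact vtx_ext (n := ⦋n⦌) fun i => rfl }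
  refine ⟨l, fun i hi => ?_⟩
  rw [partVertex, dif_pos hi]
  rfl

theorem mem_boundary_iff {k : SimplexCategoryᵒᵖ} (x : (Δ[n] : SSet.{u}).obj k) :
    x ∈ (SSet.boundary n).obj k ↔ ∃ v ≤ n, ∀ i, (vtx (n := ⦋n⦌) x i).val ≠ v := by
  have h : x ∈ (SSet.boundary n).obj k ↔ ¬ Function.Surjective (vtx (n := ⦋n⦌) x) := Iff.rfl
  rw [h, Function.Surjective]
  push Not
  constructor
  · rintro ⟨b, hb⟩
    exact ⟨b.val, Nat.lt_succ_iff.1 b.isLt, fun i hi => hb i (Fin.ext hi)⟩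
  · rintro ⟨v, hv, h⟩
    exact ⟨⟨v, Nat.lt_succ_of_le hv⟩, fun i hi => h i (congrArg Fin.val hi)⟩

/-- One missed vertex has to serve for all simplices of the part. If the part is nonempty, the
retraction applied to the identity simplex gives a simplex of the part through all of its vertices,
and what this one misses is missed by all. If it is empty, any value will do. -/
theorem forall_mem_boundary_iff (l : (part χ U : SSet.{u}) ⟶ Δ[n]) :
    (∀ k x, l.app k x ∈ (SSet.boundary n).obj k) ↔
      ∃ v ≤ n, ∀ i, vtx (SSet.yonedaEquiv χ) i ∈ U → partVertex l i ≠ v := by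
  constructor
  · intro h
    by_cases hne : ∃ i₀, vtx (SSet.yonedaEquiv χ) i₀ ∈ U
    · obtain ⟨i₀, h₀⟩ := hne
      obtain ⟨a, ha⟩ := exists_retraction h₀
      let y := a.app (op N) (SSet.stdSimplex.objEquiv.symm (𝟙 N))
      obtain ⟨v, hv, h'⟩ := (mem_boundary_iff _).1 (h _ y)
      refine ⟨v, hv, fun i hi => ?_⟩
      have hy : vtx y.1 i = i := by
        have h₁ := ConcreteCategory.congr_hom (NatTrans.congr_app ha (op ⦋0⦌))
          ⟨pt N i, pt_mem_part hi⟩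
        have h₂ : (a.app (op ⦋0⦌) (pt N i)).1 = pt N i := congrArg Subtype.val h₁
        have h₃ := vtx_app (a ≫ (part χ U).ι) (SSet.stdSimplex.objEquiv.symm (𝟙 N)) i
        have h₄ := vtx_app (a ≫ (part χ U).ι) (pt N i) 0
        exact h₃.trans (h₄.symm.trans (congrArg (fun z => vtx z 0) h₂))
      rw [← hy, ← vtx_app_part]
      exact h' i
    · push Not at hne
      exact ⟨0, Nat.zero_le n, fun i hi => absurd hi (hne i)⟩
  · rintro ⟨v, hv, h⟩ k x
    refine (mem_boundary_iff _).2 ⟨v, hv, fun i => ?_⟩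
    rw [vtx_app_part]
    exact h _ ((mem_part_iff χ U _).1 x.2 i)

end

section

variable {r : ℕ} {S : Finset (Fin (r + 1))} {n m : ℕ}

/-- The parts with a component in the second variable. -/
def IsTyped (S : Finset (Fin (r + 1))) (c : ℕ) : Prop := ∃ h : c < r + 1, (⟨c, h⟩ : Fin (r + 1)) ∈ S

theorem isTyped_val {i : Fin (r + 1)} : IsTyped S i.val ↔ i ∈ S :=
  ⟨fun ⟨_, h⟩ => h, fun h => ⟨i.isLt, h⟩⟩

theorem mem_zero_compl_iff {i : Fin (r + 1)} : i ∈ ({0}ᶜ : Finset (Fin (r + 1))) ↔ i.val ≠ 0 := by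
  rw [Finset.mem_compl, Finset.mem_singleton, Fin.ext_iff]
  rfl

variable {N : SimplexCategory}

/-- The vertices of a simplex of a generalized join of standard simplices. -/
def PartsData.joinVertex (d : PartsData {0}ᶜ S (SSet.stdSimplex.{u}.obj N) Δ[n] Δ[m])
    (i : Fin (N.len + 1)) : JoinVertex :=
  ⟨(d.vertex i).val, partVertex d.left i, partVertex d.right i⟩

variable (d : PartsData {0}ᶜ S (SSet.stdSimplex.{u}.obj N) Δ[n] Δ[m])

theorem PartsData.vertex_mono {i j : Fin (N.len + 1)} (hij : i ≤ j) : d.vertex i ≤ d.vertex j :=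
  vtx_monotone _ hij

theorem PartsData.left_mono {i j : Fin (N.len + 1)} (hij : i ≤ j) :
    partVertex d.left i ≤ partVertex d.left j := by
  by_cases hi : d.vertex i ∈ ({0}ᶜ : Finset (Fin (r + 1)))
  · refine partVertex_mono _ hij hi ?_
    have : d.vertex j ∈ ({0}ᶜ : Finset (Fin (r + 1))) := by
      rw [mem_zero_compl_iff] at hi ⊢
      have := Fin.le_def.1 (d.vertex_mono hij)
      omega
    exact this
  · exact (partVertex_of_notMem d.left hi).trans_le (Nat.zero_le _)

theorem PartsData.joinVertex_mono : Monotone d.joinVertex := by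
  intro i j hij
  rw [JoinVertex.le_iff]
  have h₁ := Fin.le_def.1 (d.vertex_mono hij)
  have h₂ := d.left_mono hij
  by_cases h : d.vertex i = d.vertex j
  · refine Or.inr ⟨congrArg Fin.val h, ?_⟩
    have h₃ : partVertex d.right i ≤ partVertex d.right j := by
      by_cases hi : d.vertex i ∈ S
      · exact partVertex_mono _ hij hi (h ▸ hi : d.vertex j ∈ S)
      · exact (partVertex_of_notMem d.right hi).trans_le (Nat.zero_le _)
    change partVertex d.left i < partVertex d.left j ∨ partVertex d.left i = partVertex d.left j ∧ _
    rcases h₂.lt_or_eq with h₂ | h₂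
    · exact Or.inl h₂
    · exact Or.inr ⟨h₂, h₃⟩
  · exact Or.inl (lt_of_le_of_ne h₁ fun h' => h (Fin.ext h'))

theorem PartsData.joinVertex_injective
    {d d' : PartsData {0}ᶜ S (SSet.stdSimplex.{u}.obj N) Δ[n] Δ[m]}
    (h : ∀ i, d.joinVertex i = d'.joinVertex i) : d = d' := by
  obtain ⟨χ, l, ρ⟩ := d
  obtain ⟨χ', l', ρ'⟩ := d'
  obtain rfl : χ = χ' := SSet.yonedaEquiv.injective (vtx_ext (n := ⦋r⦌) fun i =>
    Fin.ext (congrArg JoinVertex.c (h i)))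
  obtain rfl : l = l' := part_hom_ext fun i _ => congrArg JoinVertex.k (h i)
  obtain rfl : ρ = ρ' := part_hom_ext fun i _ => congrArg JoinVertex.w (h i)
  rfl

theorem PartsData.isGood :
    JoinVertex.IsGood r n m (IsTyped S) (Finset.univ.image d.joinVertex) := by
  have hle {i j} (h : d.joinVertex i ≤ d.joinVertex j) :
      i ≤ j ∨ d.joinVertex i = d.joinVertex j :=
    (le_total i j).imp_right fun h' => le_antisymm h (d.joinVertex_mono h')
  constructor
  all_goals simp only [Finset.mem_image, Finset.mem_univ, true_and, forall_exists_index,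
    forall_apply_eq_imp_iff]
  · exact fun i => Fin.is_le _
  · exact fun i => partVertex_le _ _
  · exact fun i => partVertex_le _ _
  · intro i hi
    refine partVertex_of_notMem d.left fun h => ?_
    exact mem_zero_compl_iff.1 h hi
  · intro i hi
    exact partVertex_of_notMem d.right fun h => hi (isTyped_val.2 h)
  · intro i j h
    rcases hle h with h | h
    · exact d.left_mono h
    · rw [h]
  · intro i j h hi hj
    rcases hle h with h | h
    · exact partVertex_mono _ h (isTyped_val.1 hi) (isTyped_val.1 hj)
    · rw [h]

theorem exists_partsData {N : ℕ} (F : Finset JoinVertex) (h : F.card = N + 1)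
    (hF : JoinVertex.IsGood r n m (IsTyped S) F) :
    ∃ d : PartsData {0}ᶜ S (SSet.stdSimplex.{u}.obj ⦋N⦌) Δ[n] Δ[m],
      ∀ i, d.joinVertex i = F.orderEmbOfFin h i := by
  let e := F.orderEmbOfFin h
  have he (i) : e i ∈ F := Finset.orderEmbOfFin_mem F h i
  have hc (i j) (hij : i ≤ j) : (e i).c ≤ (e j).c := by
    have := e.monotone hij
    rw [JoinVertex.le_iff] at this
    omega
  let χ : SSet.stdSimplex.{u}.obj ⦋N⦌ ⟶ Δ[r] := SSet.stdSimplex.map (SimplexCategory.mkHom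
    { toFun := fun i => ⟨(e i).c, Nat.lt_succ_of_le (hF.c_le _ (he i))⟩
      monotone' := fun i j hij => hc i j hij })
  have hχ (i : Fin (N + 1)) : (vtx (SSet.yonedaEquiv χ) i).val = (e i).c := rfl
  obtain ⟨l, hl⟩ := exists_part_hom (χ := χ) (U := {0}ᶜ) (n := n) (fun i => (e i).k)
    (fun i _ => hF.k_le _ (he i)) (fun i j hij _ _ => hF.k_mono _ (he i) _ (he j) (e.monotone hij))
  obtain ⟨ρ, hρ⟩ := exists_part_hom (χ := χ) (U := S) (n := m) (fun i => (e i).w)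
    (fun i _ => hF.w_le _ (he i)) (fun i j hij hi hj =>
      hF.w_mono _ (he i) _ (he j) (e.monotone hij) (isTyped_val.2 hi) (isTyped_val.2 hj))
  refine ⟨⟨χ, l, ρ⟩, fun i => JoinVertex.ext rfl ?_ ?_⟩
  · by_cases hi : vtx (SSet.yonedaEquiv χ) i ∈ ({0}ᶜ : Finset (Fin (r + 1)))
    · exact hl i hi
    · refine (partVertex_of_notMem l hi).trans (hF.k_eq _ (he i) ?_).symm
      rw [mem_zero_compl_iff, not_not] at hi
      exact hi
  · by_cases hi : vtx (SSet.yonedaEquiv χ) i ∈ S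
    · exact hρ i hi
    · exact (partVertex_of_notMem ρ hi).trans
        (hF.w_eq _ (he i) fun h' => hi (isTyped_val.1 h')).symm

variable (S n m) in
/-- The simplices of a generalized join of standard simplices in terms of their vertices. -/
def joinVertexModel : VertexModel.{u} (partsJoin {0}ᶜ S Δ[n] Δ[m]) JoinVertex where
  vert d := ⟨PartsData.joinVertex (N := ⦋_⦌) d, PartsData.joinVertex_mono (N := ⦋_⦌) d⟩
  vert_map f d i := by
    refine JoinVertex.ext ?_ ?_ ?_
    · exact congrArg Fin.val (vtx_yonedaEquiv_comp f (PartsData.χ (X := SSet.stdSimplex.obj ⦋_⦌) d) i)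
    · exact partVertex_precomp f _ i
    · exact partVertex_precomp f _ i
  vert_injective h := PartsData.joinVertex_injective (N := ⦋_⦌) h
  Good := JoinVertex.IsGood r n m (IsTyped S)
  good_vert d := PartsData.isGood (N := ⦋_⦌) d
  exists_simplex F h hF := exists_partsData F h hF

/-! ### The outer part of a generalized join and extension from it -/

variable (S) in
/-- The simplices that miss the part over `0`, or all the parts over `2, …, r`, or whose second
component is in `B`. -/
def outerFamily {M : SSet.{u}} (B : M.Subcomplex) :
    StableFamily ({0}ᶜ : Finset (Fin (r + 1))) S M where
  obj L :=
    { obj k := Set.ofPred fun (t : PartsData {0}ᶜ S (SSet.stdSimplex.obj k.unop) L M) =>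
        (∀ i, (t.vertex i).val ≠ 0) ∨ (∀ i, (t.vertex i).val < 2) ∨
          ∀ k x, t.right.app k x ∈ B.obj k
      map {k k'} f t ht := by
        have hv (i) := vtx_yonedaEquiv_comp f.unop
          (PartsData.χ (X := SSet.stdSimplex.obj k.unop) t) i
        rcases ht with ht | ht | ht
        · refine Or.inl fun i => ?_
          exact ne_of_eq_of_ne (congrArg Fin.val (hv i)) (ht _)
        · refine Or.inr (Or.inl fun i => ?_)
          exact lt_of_eq_of_lt (congrArg Fin.val (hv i)) (ht _)
        · exact Or.inr (Or.inr fun _ _ => ht _ _) }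
  mem_iff _ _ _ := Iff.rfl
  mem_of_forall_notMem t ht := Or.inr (Or.inl fun i => by
    have h := ht i
    rw [mem_zero_compl_iff, not_not] at h
    exact h.trans_lt Nat.zero_lt_two)

theorem mem_range_mapLeft_iff {r : ℕ} {S T : Finset (Fin (r + 1))} {A M : SSet.{u}}
    (B : A.Subcomplex) {k : SimplexCategoryᵒᵖ}
    (t : PartsData S T (SSet.stdSimplex.obj k.unop) A M) :
    (show (partsJoin S T A M).obj k from t) ∈ (SSet.Subcomplex.range (mapLeft B.ι M)).obj k ↔
      ∀ k x, t.left.app k x ∈ B.obj k := by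
  constructor
  · rintro ⟨t, rfl⟩ k x
    exact (t.left.app k x).2
  · intro h
    refine ⟨(⟨t.χ, Subfunctor.lift t.left ?_, t.right⟩ :
      PartsData S T (SSet.stdSimplex.obj k.unop) B M), rfl⟩
    rintro k _ ⟨x, rfl⟩
    exact h k x

/-- Simplices that are not in the outer part of a generalized join of standard simplices can be
matched. -/
def outerCornerData (h0 : 0 ∈ S) : (joinVertexModel.{u} S n m).CornerData
    ((outerFamily S (SSet.boundary m)).obj Δ[n] ⊔
      SSet.Subcomplex.range (mapLeft (SSet.boundary n).ι Δ[m])) where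
  Full := JoinVertex.IsFull n m (IsTyped S)
  notMem_iff {N} d := by
    have h₁ : d ∈ ((outerFamily S (SSet.boundary m)).obj Δ[n] ⊔
      SSet.Subcomplex.range (mapLeft (SSet.boundary n).ι Δ[m])).obj _ ↔
      ((∀ i, (PartsData.vertex (n := ⦋N⦌) d i).val ≠ 0) ∨
        (∀ i, (PartsData.vertex (n := ⦋N⦌) d i).val < 2) ∨
          ∀ k x, (PartsData.right (X := SSet.stdSimplex.obj ⦋N⦌) d).app k x ∈
            (SSet.boundary m).obj k) ∨
        ∀ k x, (PartsData.left (X := SSet.stdSimplex.obj ⦋N⦌) d).app k x ∈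
            (SSet.boundary n).obj k := or_congr Iff.rfl (mem_range_mapLeft_iff _ _)
    rw [h₁, forall_mem_boundary_iff (N := ⦋N⦌), forall_mem_boundary_iff (N := ⦋N⦌)]
    push Not
    have hd (i : Fin (N + 1)) : PartsData.joinVertex (N := ⦋N⦌) d i ∈
        (joinVertexModel S n m).vset d := Finset.mem_image_of_mem _ (Finset.mem_univ i)
    have hd' {P : JoinVertex → Prop} (h : ∃ x ∈ (joinVertexModel S n m).vset d, P x) :
        ∃ i, P (PartsData.joinVertex (N := ⦋N⦌) d i) := by
      obtain ⟨x, hx, hP⟩ := h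
      obtain ⟨i, -, rfl⟩ := Finset.mem_image.1 hx
      exact ⟨i, hP⟩
    constructor
    · rintro ⟨⟨⟨i₀, h₀⟩, ⟨i₂, h₂⟩, hm⟩, hn⟩
      refine ⟨⟨_, hd i₀, h₀⟩, ⟨_, hd i₂, h₂⟩, fun k hk => ?_, fun w hw => ?_⟩
      · obtain ⟨i, hi, hi'⟩ := hn k hk
        exact ⟨_, hd i, mem_zero_compl_iff.1 hi, hi'⟩
      · obtain ⟨i, hi, hi'⟩ := hm w hw
        exact ⟨_, hd i, isTyped_val.2 hi, hi'⟩
    · rintro ⟨h₀, h₂, hn, hm⟩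
      refine ⟨⟨hd' h₀, hd' h₂, fun w hw => ?_⟩, fun k hk => ?_⟩
      · obtain ⟨i, hi, hi'⟩ := hd' (hm w hw)
        exact ⟨i, isTyped_val.1 hi, hi'⟩
      · obtain ⟨i, hi, hi'⟩ := hd' (hn k hk)
        exact ⟨i, mem_zero_compl_iff.2 hi, hi'⟩
  corner := JoinVertex.corner (IsTyped S)
  full_insert _ hf := hf.mono (Finset.subset_insert _ _)
  good_insert hg hf := hg.insert_corner (isTyped_val.2 h0) hf
  corner_insert _ _ := JoinVertex.corner_insert_corner
  full_erase _ hf := hf.erase_corner (isTyped_val.2 h0)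
  corner_erase _ _ := JoinVertex.corner_erase rfl le_rfl
  exists_lt _ hf := hf.zero.imp fun _ h =>
    ⟨h.1, JoinVertex.lt_of_c_lt (h.2.trans_lt Nat.zero_lt_one)⟩
  exists_gt _ hf := hf.two.imp fun _ h => ⟨h.1, JoinVertex.lt_of_c_lt h.2⟩
  weight := JoinVertex.weight n
  weight_lt hg hf hu hz hne h := JoinVertex.weight_lt hg hf hu hz hne h

/-- The family is stable in the variable `K`, so `K` may be replaced by a cell `Δ[n]`; there the
matching by corners makes the inclusion inner anodyne. -/
theorem extends_outerFamily (h0 : 0 ∈ S) {C : SSet.{u}} [SSet.Quasicategory C] (K : SSet.{u}) :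
    Extends C ((outerFamily S (SSet.boundary m)).obj K) := by
  refine StableFamily.extends_of_cells fun n f => ?_
  have hA := (outerCornerData.{u} (n := n) (m := m) h0).innerAnodyneExtensions
  have hC : SSet.innerFibrations (terminal.from C) :=
    ((SSet.quasicategory_iff_innerFibration C).1 inferInstance).mem
  have sq : CommSq f ((outerFamily S (SSet.boundary m)).obj Δ[n] ⊔
      SSet.Subcomplex.range (mapLeft (SSet.boundary n).ι Δ[m])).ι (terminal.from C)
      (terminal.from _) := ⟨terminal.hom_ext _ _⟩
  have := hA _ hC
  exact ⟨sq.lift, sq.fac_left⟩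

end

/-! ### Generalized slices and their universal property -/

section

variable {r : ℕ} {S : Finset (Fin (r + 1))}

/-- The simplices that miss the part over `0`. -/
def missFamily (h0 : 0 ∈ S) (K : SSet.{u}) : StableFamily S ({0}ᶜ : Finset (Fin (r + 1))) K where
  obj L :=
    { obj k := Set.ofPred fun (t : PartsData S {0}ᶜ (SSet.stdSimplex.obj k.unop) L K) =>
        ∀ i, t.vertex i ∈ ({0}ᶜ : Finset (Fin (r + 1)))
      map {k k'} f t ht i := by
        have h := vtx_yonedaEquiv_comp f.unop
          (PartsData.χ (X := SSet.stdSimplex.obj k.unop) t) i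
        exact (congrArg (· ∈ ({0}ᶜ : Finset (Fin (r + 1)))) h).mpr (ht _) }
  mem_iff _ _ _ := Iff.rfl
  mem_of_forall_notMem t ht i := by
    rw [Finset.mem_compl, Finset.mem_singleton]
    exact fun h => ht i ((congrArg (· ∈ S) h).mpr h0)

/-- The map to the second variable on the simplices that miss the part over `0`. -/
def missRight (h0 : 0 ∈ S) (K L : SSet.{u}) : ((missFamily h0 K).obj L : SSet.{u}) ⟶ K where
  app k := ↾fun t => (PartsData.right (X := SSet.stdSimplex.obj k.unop) t.1).app k
    ⟨SSet.yonedaEquiv (𝟙 (SSet.stdSimplex.obj k.unop)), (mem_part_iff _ _ _).2 fun i => t.2 i⟩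
  naturality k k' f := by
    refine ConcreteCategory.hom_ext _ _ fun t => ?_
    refine Eq.trans ?_ (NatTrans.naturality_apply
      (PartsData.right (X := SSet.stdSimplex.obj k.unop) t.1) f
      ⟨SSet.yonedaEquiv (𝟙 (SSet.stdSimplex.obj k.unop)), (mem_part_iff _ _ _).2 fun i => t.2 i⟩)
    refine congrArg ((PartsData.right (X := SSet.stdSimplex.obj k.unop) t.1).app k') ?_
    exact Subtype.ext (SSet.yonedaEquiv_naturality f.unop
      (𝟙 (SSet.stdSimplex.obj k.unop))).symm

variable {K C : SSet.{u}} (h0 : 0 ∈ S) (p : K ⟶ C)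

/-- The generalized slice: its `n`-simplices are the maps from the generalized join of `Δ[n]` and
`K` to `C` that restrict to `p` away from the part over `0`. -/
def partsSlice : SSet.{u} := (missFamily h0 K).relMaps (missRight h0 K Δ[0] ≫ p)

/-- The condition for a map from a generalized join to restrict to `p`. -/
def RestrictsTo {V : SSet.{u}} (H : partsJoin S {0}ᶜ V K ⟶ C) : Prop :=
  ((missFamily h0 K).obj V).ι ≫ H = missRight h0 K V ≫ p

variable {h0 p}

theorem RestrictsTo.apply {V : SSet.{u}} {H : partsJoin S {0}ᶜ V K ⟶ C} (hH : RestrictsTo h0 p H)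
    {k} (t : (partsJoin S {0}ᶜ V K).obj k) (ht : t ∈ ((missFamily h0 K).obj V).obj k) :
    H.app k t = p.app k ((missRight h0 K V).app k ⟨t, ht⟩) :=
  ConcreteCategory.congr_hom (NatTrans.congr_app hH k) ⟨t, ht⟩

/-- The base of the relative maps is `Δ[0]`, so only the restriction to `p` remains as a condition.
With `uncurry_injective` and `exists_uncurry_eq`, this gives the universal property: maps from `V`
to the generalized slice are the maps from the generalized join of `V` and `K` that restrict to `p`.
-/
theorem exists_uncurry {V : SSet.{u}} (ρ : V ⟶ partsSlice h0 p) :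
    ∃ H : partsJoin S {0}ᶜ V K ⟶ C, RestrictsTo h0 p H ∧
      ∀ {n : SimplexCategory} (x : SSet.stdSimplex.obj n ⟶ V),
        mapLeft x K ≫ H = StableFamily.evalHom (F := missFamily h0 K)
          (f := missRight h0 K Δ[0] ≫ p) (x ≫ ρ) := by
  obtain ⟨H, h, h'⟩ := StableFamily.exists_assembly (F := missFamily h0 K)
    (f := missRight h0 K Δ[0] ≫ p) ρ
  exact ⟨H, h', h⟩

/-- The map from a generalized join corresponding to a map to a generalized slice. -/
def uncurry {V : SSet.{u}} (ρ : V ⟶ partsSlice h0 p) : partsJoin S {0}ᶜ V K ⟶ C :=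
  (exists_uncurry ρ).choose

theorem restrictsTo_uncurry {V : SSet.{u}} (ρ : V ⟶ partsSlice h0 p) :
    RestrictsTo h0 p (uncurry ρ) := (exists_uncurry ρ).choose_spec.1

theorem mapLeft_uncurry {V : SSet.{u}} (ρ : V ⟶ partsSlice h0 p)
    {n : SimplexCategory} (x : SSet.stdSimplex.obj n ⟶ V) :
    mapLeft x K ≫ uncurry ρ = StableFamily.evalHom (F := missFamily h0 K)
      (f := missRight h0 K Δ[0] ≫ p) (x ≫ ρ) := (exists_uncurry ρ).choose_spec.2 x

theorem restrictsTo_ext {V : SSet.{u}} {H H' : partsJoin S {0}ᶜ V K ⟶ C}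
    (hH : RestrictsTo h0 p H) (hH' : RestrictsTo h0 p H')
    (h : ∀ {n : SimplexCategory} (x : SSet.stdSimplex.obj n ⟶ V),
      mapLeft x K ≫ H = mapLeft x K ≫ H') : H = H' :=
  StableFamily.assembly_unique (F := missFamily h0 K) h (hH.trans hH'.symm)

theorem uncurry_injective {V : SSet.{u}} {ρ ρ' : V ⟶ partsSlice h0 p}
    (h : uncurry ρ = uncurry ρ') : ρ = ρ' :=
  StableFamily.relMaps_hom_ext (SSet.stdSimplex.isTerminalObj₀.hom_ext _ _) fun x => by
    rw [← mapLeft_uncurry, ← mapLeft_uncurry, h]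

theorem exists_uncurry_eq {V : SSet.{u}} {H : partsJoin S {0}ᶜ V K ⟶ C}
    (hH : RestrictsTo h0 p H) : ∃ ρ : V ⟶ partsSlice h0 p, uncurry ρ = H := by
  obtain ⟨ρ, -, h⟩ := StableFamily.exists_hom_relMaps (F := missFamily h0 K)
    (f := missRight h0 K Δ[0] ≫ p) (SSet.stdSimplex.isTerminalObj₀.from V) H hH
  refine ⟨ρ, restrictsTo_ext (restrictsTo_uncurry _) hH fun x => ?_⟩
  exact (mapLeft_uncurry ρ x).trans (h x)

theorem RestrictsTo.mapLeft {V V' : SSet.{u}} (g : V' ⟶ V) {H : partsJoin S {0}ᶜ V K ⟶ C}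
    (hH : RestrictsTo h0 p H) : RestrictsTo h0 p (mapLeft g K ≫ H) :=
  congrArg (fun z => (missFamily h0 K).map g ≫ z) hH

theorem uncurry_comp {V V' : SSet.{u}} (g : V' ⟶ V) (ρ : V ⟶ partsSlice h0 p) :
    uncurry (g ≫ ρ) = mapLeft g K ≫ uncurry ρ := by
  refine restrictsTo_ext (restrictsTo_uncurry _) ((restrictsTo_uncurry _).mapLeft g) fun x => ?_
  exact (mapLeft_uncurry (g ≫ ρ) x).trans (mapLeft_uncurry ρ (x ≫ g)).symm

/-- The map to a generalized slice corresponding to a map from a generalized join. -/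
def curry {V : SSet.{u}} {H : partsJoin S {0}ᶜ V K ⟶ C} (hH : RestrictsTo h0 p H) :
    V ⟶ partsSlice h0 p := (exists_uncurry_eq hH).choose

theorem uncurry_curry {V : SSet.{u}} {H : partsJoin S {0}ᶜ V K ⟶ C} (hH : RestrictsTo h0 p H) :
    uncurry (curry hH) = H := (exists_uncurry_eq hH).choose_spec

end

/-! ### Functoriality of generalized slices in the shape -/

section

variable {r r' : ℕ} {S : Finset (Fin (r + 1))} {S' : Finset (Fin (r' + 1))} {h0 : 0 ∈ S}
  {h0' : 0 ∈ S'} {K C : SSet.{u}} {p : K ⟶ C}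

/-- A morphism of shapes of generalized joins. -/
structure ShapeHom (S : Finset (Fin (r + 1))) (S' : Finset (Fin (r' + 1))) where
  hom : ⦋r⦌ ⟶ ⦋r'⦌
  mem : ∀ i, hom.toOrderHom i ∈ S' → i ∈ S
  zero : ∀ i, hom.toOrderHom i ∈ ({0}ᶜ : Finset (Fin (r' + 1))) ↔ i ∈ ({0}ᶜ : Finset (Fin (r + 1)))

/-- The functoriality of the generalized join in the shape. -/
def ShapeHom.map (d : ShapeHom S S') (V K : SSet.{u}) :
    partsJoin S {0}ᶜ V K ⟶ partsJoin S' {0}ᶜ V K :=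
  reindex d.hom d.mem (fun i => (d.zero i).1) V K

theorem shapeHom_map_mem_iff (d : ShapeHom S S') {V K : SSet.{u}} {k : SimplexCategoryᵒᵖ}
    (t : (partsJoin S {0}ᶜ V K).obj k) :
    (d.map V K).app k t ∈ ((missFamily h0' K).obj V).obj k ↔
      t ∈ ((missFamily h0 K).obj V).obj k :=
  forall_congr' fun _ => d.zero _

theorem RestrictsTo.shapeHom (d : ShapeHom S S') {V : SSet.{u}} {H : partsJoin S' {0}ᶜ V K ⟶ C}
    (hH : RestrictsTo h0' p H) : RestrictsTo h0 p (d.map V K ≫ H) := by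
  refine NatTrans.ext (funext fun k => ConcreteCategory.hom_ext _ _ fun t => ?_)
  exact hH.apply _ ((shapeHom_map_mem_iff d t.1).2 t.2)

theorem ShapeHom.map_eq_id (d : ShapeHom S S) (hd : d.hom = 𝟙 _) (V K : SSet.{u}) :
    d.map V K = 𝟙 _ := by
  refine NatTrans.ext (funext fun k => ConcreteCategory.hom_ext _ _ fun t => ?_)
  refine PartsData.ext_of_apply (X := SSet.stdSimplex.obj k.unop) ?_ (fun _ _ _ _ => rfl)
    (fun _ _ _ _ => rfl)
  have h : (SSet.stdSimplex.map d.hom : Δ[r] ⟶ Δ[r]) = 𝟙 _ :=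
    (congrArg SSet.stdSimplex.map hd).trans (SSet.stdSimplex.map_id _)
  exact (congrArg (PartsData.χ (X := SSet.stdSimplex.obj k.unop) t ≫ ·) h).trans
    (Category.comp_id _)

variable (h0 h0' p) in
/-- The functoriality of the generalized slice in the shape. -/
def ShapeHom.res (d : ShapeHom S S') : partsSlice h0' p ⟶ partsSlice h0 p :=
  curry ((restrictsTo_uncurry (𝟙 (partsSlice h0' p))).shapeHom d)

theorem uncurry_res (d : ShapeHom S S') {V : SSet.{u}} (ρ : V ⟶ partsSlice h0' p) :
    uncurry (ρ ≫ d.res h0 h0' p) = d.map V K ≫ uncurry ρ := by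
  rw [uncurry_comp, ShapeHom.res, uncurry_curry]
  have h := uncurry_comp ρ (𝟙 (partsSlice h0' p))
  rw [Category.comp_id] at h
  rw [h]
  rfl

theorem res_eq_id (d : ShapeHom S S) (hd : d.hom = 𝟙 _) : d.res h0 h0 p = 𝟙 _ := by
  refine uncurry_injective ?_
  have h := uncurry_res (h0 := h0) d (𝟙 (partsSlice h0 p))
  rw [Category.id_comp] at h
  rw [h, ShapeHom.map_eq_id d hd, Category.id_comp]

theorem res_comp_res {r'' : ℕ} {S'' : Finset (Fin (r'' + 1))} {h0'' : 0 ∈ S''}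
    (d : ShapeHom S S') (d' : ShapeHom S' S'') (d'' : ShapeHom S S'')
    (h : d.hom ≫ d'.hom = d''.hom) :
    d'.res h0' h0'' p ≫ d.res h0 h0' p = d''.res h0 h0'' p := by
  refine uncurry_injective ?_
  have h₁ := uncurry_res (h0 := h0) d'' (𝟙 (partsSlice h0'' p))
  have h₂ := uncurry_res (h0 := h0') d' (𝟙 (partsSlice h0'' p))
  rw [Category.id_comp] at h₁ h₂
  rw [uncurry_res, h₁, h₂]
  obtain ⟨d'', h₃, h₄⟩ := d''
  subst h
  rfl

/-- The retraction `s` recovers the map to `Δ[r]`. By `hS` and `d.zero` the parts over `S` and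
`{0}ᶜ` do not shrink, so neither component loses information. -/
theorem shapeHom_map_injective (d : ShapeHom S S') (s : ⦋r'⦌ ⟶ ⦋r⦌) (hs : d.hom ≫ s = 𝟙 _)
    (hS : ∀ i, i ∈ S → d.hom.toOrderHom i ∈ S') {V K : SSet.{u}} {k}
    {t t' : (partsJoin S {0}ᶜ V K).obj k}
    (h : (d.map V K).app k t = (d.map V K).app k t') : t = t' := by
  obtain ⟨χ, l, ρ⟩ := t
  obtain ⟨χ', l', ρ'⟩ := t'
  have hχ : χ ≫ SSet.stdSimplex.map d.hom = χ' ≫ SSet.stdSimplex.map d.hom :=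
    congrArg PartsData.χ h
  have hd : (SSet.stdSimplex.map d.hom : Δ[r] ⟶ Δ[r']) ≫ SSet.stdSimplex.map s = 𝟙 _ :=
    (SSet.stdSimplex.map_comp d.hom s).symm.trans
      ((congrArg SSet.stdSimplex.map hs).trans (SSet.stdSimplex.map_id _))
  obtain rfl : χ = χ' := by
    refine (Category.comp_id χ).symm.trans (Eq.trans ?_ (Category.comp_id χ'))
    rw [← hd]
    exact congrArg (fun z => z ≫ SSet.stdSimplex.map s) hχ
  have hl := eq_of_heq (PartsData.mk.inj h).2.1
  have hr := eq_of_heq (PartsData.mk.inj h).2.2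
  refine PartsData.ext_of_apply rfl (fun n x hx _ => ?_) fun n x hx _ => ?_
  · have hx' : x ∈ (part (χ ≫ SSet.stdSimplex.map d.hom) S').obj n :=
      (mem_part_iff _ _ _).2 fun i => hS _ ((mem_part_iff _ _ _).1 hx i)
    exact ConcreteCategory.congr_hom (NatTrans.congr_app hl n) ⟨x, hx'⟩
  · have hx' : x ∈ (part (χ ≫ SSet.stdSimplex.map d.hom) {0}ᶜ).obj n :=
      (mem_part_iff _ _ _).2 fun i => (d.zero _).2 ((mem_part_iff _ _ _).1 hx i)
    exact ConcreteCategory.congr_hom (NatTrans.congr_app hr n) ⟨x, hx'⟩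

theorem exists_shapeHom_map_eq (d : ShapeHom S S') (s : ⦋r'⦌ ⟶ ⦋r⦌)
    (hS : ∀ i, i ∈ S → d.hom.toOrderHom i ∈ S') {V K : SSet.{u}} {k : SimplexCategoryᵒᵖ}
    (t : PartsData S' {0}ᶜ (SSet.stdSimplex.obj k.unop) V K)
    (ht : ∀ i, d.hom.toOrderHom (s.toOrderHom (t.vertex i)) = t.vertex i) :
    ∃ τ : (partsJoin S {0}ᶜ V K).obj k, (d.map V K).app k τ = t := by
  have hle {U : Finset (Fin (r + 1))} {U' : Finset (Fin (r' + 1))}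
      (hU : ∀ i, i ∈ U → d.hom.toOrderHom i ∈ U') :
      part (t.χ ≫ SSet.stdSimplex.map s) U ≤ part t.χ U' := by
    intro n x hx
    refine (mem_part_iff _ _ _).2 fun i => ?_
    have := hU _ ((mem_part_iff _ _ _).1 hx i)
    exact (congrArg (· ∈ U') (ht _)).mp this
  refine ⟨(⟨t.χ ≫ SSet.stdSimplex.map s, SSet.Subcomplex.homOfLE (hle hS) ≫ t.left,
    SSet.Subcomplex.homOfLE (hle fun i => (d.zero i).2) ≫ t.right⟩ :
      PartsData S {0}ᶜ (SSet.stdSimplex.obj k.unop) V K), ?_⟩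
  refine PartsData.ext_of_apply ?_ (fun _ _ _ _ => rfl) (fun _ _ _ _ => rfl)
  exact SSet.yonedaEquiv.injective (vtx_ext (n := ⦋r'⦌) fun i => ht i)

end

/-! ### Restriction to the first two parts is a trivial fibration -/

/-- The map `⦋r⦌ ⟶ ⦋1⦌` that sends only `0` to `0`. -/
def collapse (r : ℕ) : ⦋r⦌ ⟶ ⦋1⦌ :=
  SimplexCategory.mkHom
    { toFun := fun i => if i.val = 0 then 0 else 1
      monotone' := fun i j hij => by
        have := Fin.le_def.1 hij
        dsimp only
        split_ifs
        · rfl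
        · exact Fin.zero_le _
        · omega
        · rfl }

theorem collapse_of_eq {r : ℕ} {i : Fin (r + 1)} (h : i.val = 0) :
    (collapse r).toOrderHom i = 0 := if_pos h

theorem collapse_of_ne {r : ℕ} {i : Fin (r + 1)} (h : i.val ≠ 0) :
    (collapse r).toOrderHom i = 1 := if_neg h

/-- This serves to exchange the variables of a generalized join: the extension property is proved
with `K` first, whereas slices use `W` first. -/
theorem Extends.preimage {X Y C : SSet.{u}} {A : Y.Subcomplex} (hA : Extends C A) (a : X ⟶ Y)
    (b : Y ⟶ X) (hab : a ≫ b = 𝟙 X) (hba : b ≫ a = 𝟙 Y) : Extends C (A.preimage a) := by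
  intro f
  have hba' {k} (y : Y.obj k) : a.app k (b.app k y) = y :=
    ConcreteCategory.congr_hom (NatTrans.congr_app hba k) y
  have hab' {k} (x : X.obj k) : b.app k (a.app k x) = x :=
    ConcreteCategory.congr_hom (NatTrans.congr_app hab k) x
  obtain ⟨g, hg⟩ := hA (Subfunctor.lift (A.ι ≫ b) (G := A.preimage a) (by
    rintro k _ ⟨y, rfl⟩
    exact (congrArg (· ∈ A.obj k) (hba' y.1)).mpr y.2) ≫ f)
  refine ⟨a ≫ g, ?_⟩
  refine NatTrans.ext (funext fun k => ConcreteCategory.hom_ext _ _ fun x => ?_)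
  refine (ConcreteCategory.congr_hom (NatTrans.congr_app hg k) ⟨a.app k x.1, x.2⟩).trans ?_
  exact congrArg (f.app k) (Subtype.ext (hab' x.1))

section

variable {r : ℕ} {S : Finset (Fin 2)} {S' : Finset (Fin (r + 1))} {h0 : 0 ∈ S}
  {h0' : 0 ∈ S'} {K C : SSet.{u}} {p : K ⟶ C}

variable (h0') in
/-- The relation describing a map that restricts to given maps on three subcomplexes. -/
def GlueRel (p : K ⟶ C) (d : ShapeHom S S') {A B : SSet.{u}} (i : B ⟶ A)
    (H : partsJoin S' {0}ᶜ B K ⟶ C) (h : partsJoin S {0}ᶜ A K ⟶ C)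
    (k : SimplexCategoryᵒᵖ) (t : (partsJoin S' {0}ᶜ A K).obj k) (c : C.obj k) : Prop :=
  (∃ ht : t ∈ ((missFamily h0' K).obj A).obj k,
      p.app k ((missRight h0' K A).app k ⟨t, ht⟩) = c) ∨
    (∃ τ, (d.map A K).app k τ = t ∧ h.app k τ = c) ∨
      ∃ τ, (mapLeft i K).app k τ = t ∧ H.app k τ = c

variable {d : ShapeHom S S'} {A B : SSet.{u}} {i : B ⟶ A}
    {H : partsJoin S' {0}ᶜ B K ⟶ C} {h : partsJoin S {0}ᶜ A K ⟶ C}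

theorem GlueRel.map {k k' : SimplexCategoryᵒᵖ} (f : k ⟶ k')
    {t : (partsJoin S' {0}ᶜ A K).obj k} {c : C.obj k} (ht : GlueRel h0' p d i H h k t c) :
    GlueRel h0' p d i H h k' ((partsJoin S' {0}ᶜ A K).map f t) (C.map f c) := by
  rcases ht with ⟨ht, rfl⟩ | ⟨τ, rfl, rfl⟩ | ⟨τ, rfl, rfl⟩
  · refine Or.inl ⟨((missFamily h0' K).obj A).map f ht, ?_⟩
    have h₁ := NatTrans.naturality_apply (missRight h0' K A) f ⟨t, ht⟩
    have h₂ := NatTrans.naturality_apply p f ((missRight h0' K A).app k ⟨t, ht⟩)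
    exact (congrArg (p.app k') h₁).trans h₂
  · refine Or.inr (Or.inl ⟨(partsJoin S {0}ᶜ A K).map f τ, ?_, ?_⟩)
    · exact NatTrans.naturality_apply (d.map A K) f τ
    · exact NatTrans.naturality_apply h f τ
  · refine Or.inr (Or.inr ⟨(partsJoin S' {0}ᶜ B K).map f τ, ?_, ?_⟩)
    · exact NatTrans.naturality_apply (mapLeft i K) f τ
    · exact NatTrans.naturality_apply H f τ

theorem collapse_comp (d : ShapeHom S S') (hd : ∀ i, (d.hom.toOrderHom i).val = i.val) :
    d.hom ≫ collapse r = 𝟙 _ := by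
  refine SimplexCategory.Hom.ext _ _ (OrderHom.ext _ _ (funext fun i => ?_))
  change (collapse r).toOrderHom (d.hom.toOrderHom i) = i
  have := hd i
  by_cases hi : i.val = 0
  · rw [collapse_of_eq (by omega)]
    exact Fin.ext hi.symm
  · rw [collapse_of_ne (by omega)]
    have := i.isLt
    refine Fin.ext ?_
    change 1 = i.val
    simp only [SimplexCategory.len_mk] at this
    omega

theorem GlueRel.unique {B : A.Subcomplex} {H : partsJoin S' {0}ᶜ (B : SSet.{u}) K ⟶ C}
    (hd : ∀ i, (d.hom.toOrderHom i).val = i.val)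
    (hS : ∀ i, i ∈ S → d.hom.toOrderHom i ∈ S') (hH : RestrictsTo h0' p H)
    (hh : RestrictsTo h0 p h) (hHh : d.map _ K ≫ H = mapLeft B.ι K ≫ h)
    {k : SimplexCategoryᵒᵖ} {t : (partsJoin S' {0}ᶜ A K).obj k} {c c' : C.obj k}
    (hc : GlueRel h0' p d B.ι H h k t c) (hc' : GlueRel h0' p d B.ι H h k t c') : c = c' := by
  have h₁₂ (τ) (ht) : p.app k ((missRight h0' K A).app k ⟨(d.map A K).app k τ, ht⟩) =
      h.app k τ := (hh.apply τ ((shapeHom_map_mem_iff d τ).1 ht)).symm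
  have h₁₃ (τ) (ht) : p.app k ((missRight h0' K A).app k
      ⟨(mapLeft B.ι K).app k τ, ht⟩) = H.app k τ :=
    (hH.apply τ ht).symm
  have h₂₃ (τ τ') (e : (d.map A K).app k τ = (mapLeft B.ι K).app k τ') :
      h.app k τ = H.app k τ' := by
    -- The first component of `τ` is a restriction of that of its image in the larger shape, which
    -- takes values in `B`; hence `τ` itself comes from `B`.
    obtain ⟨σ, rfl⟩ : τ ∈ (SSet.Subcomplex.range (mapLeft B.ι K)).obj k := by
      have h₁ := (mem_range_mapLeft_iff B ((d.map A K).app k τ)).1 ⟨τ', e.symm⟩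
      refine (mem_range_mapLeft_iff B τ).2 fun k' x => ?_
      refine h₁ k' ⟨x.1, (mem_part_iff _ _ _).2 fun i => hS _ ((mem_part_iff _ _ _).1 x.2 i)⟩
    have e' : (mapLeft B.ι K).app k ((d.map _ K).app k σ) = (mapLeft B.ι K).app k τ' := e
    rw [← StableFamily.mapLeft_app_injective _ e']
    exact (ConcreteCategory.congr_hom (NatTrans.congr_app hHh k) σ).symm
  rcases hc with ⟨ht, rfl⟩ | ⟨τ, e, rfl⟩ | ⟨τ, e, rfl⟩ <;>
    rcases hc' with ⟨ht', rfl⟩ | ⟨τ', e', rfl⟩ | ⟨τ', e', rfl⟩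
  · rfl
  · subst e'
    exact h₁₂ _ _
  · subst e'
    exact h₁₃ _ _
  · subst e
    exact (h₁₂ _ _).symm
  · rw [shapeHom_map_injective d (collapse r) (collapse_comp d hd) hS (e.trans e'.symm)]
  · exact h₂₃ _ _ (e.trans e'.symm)
  · subst e
    exact (h₁₃ _ _).symm
  · exact (h₂₃ _ _ (e'.trans e.symm)).symm
  · rw [StableFamily.mapLeft_app_injective _ (e.trans e'.symm)]

/-- The maps `p`, `h` and `H` are prescribed on the three kinds of simplices that make up the outer
part: those that miss `0`, those over `{0, 1}`, and those over the boundary of `Δ[m]`. -/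
theorem exists_extension [SSet.Quasicategory C]
    (hd : ∀ i, (d.hom.toOrderHom i).val = i.val)
    (hS : ∀ i, i ∈ S → d.hom.toOrderHom i ∈ S') {m : ℕ}
    {H : partsJoin S' {0}ᶜ (SSet.boundary.{u} m : SSet.{u}) K ⟶ C} (hH : RestrictsTo h0' p H)
    {h : partsJoin S {0}ᶜ Δ[m] K ⟶ C} (hh : RestrictsTo h0 p h)
    (hHh : d.map _ K ≫ H = mapLeft (SSet.boundary m).ι K ≫ h) :
    ∃ g : partsJoin S' {0}ᶜ Δ[m] K ⟶ C, RestrictsTo h0' p g ∧ d.map _ K ≫ g = h ∧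
      mapLeft (SSet.boundary m).ι K ≫ g = H := by
  have hA : Extends C (((outerFamily S' (SSet.boundary m)).obj K).preimage
      (partsSwap S' {0}ᶜ Δ[m] K)) :=
    (extends_outerFamily h0' K).preimage _ (partsSwap {0}ᶜ S' K Δ[m]) rfl rfl
  obtain ⟨g, hg⟩ := hA.exists_of_rel (GlueRel h0' p d (SSet.boundary m).ι H h)
    (fun f _ _ => GlueRel.map f) (by
      rintro k t (ht | ht | ht)
      · exact ⟨_, Or.inl ⟨fun i => mem_zero_compl_iff.2 (ht i), rfl⟩⟩
      · obtain ⟨τ, hτ⟩ := exists_shapeHom_map_eq d (collapse r) hS t fun i => by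
          have h₁ : (PartsData.vertex (n := k.unop) t i).val < 2 := ht i
          refine Fin.ext ?_
          rw [hd]
          by_cases hi : (PartsData.vertex (n := k.unop) t i).val = 0
          · exact (congrArg Fin.val (collapse_of_eq hi)).trans hi.symm
          · refine (congrArg Fin.val (collapse_of_ne hi)).trans ?_
            change 1 = _
            omega
        exact ⟨_, Or.inr (Or.inl ⟨τ, hτ, rfl⟩)⟩
      · obtain ⟨τ, hτ⟩ := (mem_range_mapLeft_iff (SSet.boundary m) t).2 ht
        exact ⟨_, Or.inr (Or.inr ⟨τ, hτ, rfl⟩)⟩)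
    (fun hc hc' => hc.unique hd hS hH hh hHh hc')
  refine ⟨g, ?_, ?_, ?_⟩
  · refine NatTrans.ext (funext fun k => ConcreteCategory.hom_ext _ _ fun t => ?_)
    exact hg (Or.inl fun i => mem_zero_compl_iff.1 (t.2 i)) (Or.inl ⟨t.2, rfl⟩)
  · refine NatTrans.ext (funext fun k => ConcreteCategory.hom_ext _ _ fun t => ?_)
    refine hg (Or.inr (Or.inl fun i => ?_)) (Or.inr (Or.inl ⟨t, rfl, rfl⟩))
    exact lt_of_eq_of_lt (hd _) (PartsData.vertex (n := k.unop) t i).isLt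
  · refine NatTrans.ext (funext fun k => ConcreteCategory.hom_ext _ _ fun t => ?_)
    refine hg (Or.inr (Or.inr fun k' x => ?_)) (Or.inr (Or.inr ⟨t, rfl, rfl⟩))
    exact ((PartsData.left (X := SSet.stdSimplex.obj k.unop) t).app k' x).2

/-- The restriction of a generalized slice to the first two parts is a trivial fibration. -/
theorem res_rlp [SSet.Quasicategory C] (d : ShapeHom S S')
    (hd : ∀ i, (d.hom.toOrderHom i).val = i.val)
    (hS : ∀ i, i ∈ S → d.hom.toOrderHom i ∈ S') :
    (MorphismProperty.monomorphisms SSet.{u}).rlp (d.res h0 h0' p) := by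
  -- By the universal property, lifting against `∂Δ[m] ⟶ Δ[m]` is the extension problem of
  -- `exists_extension`.
  rw [SSet.rlp_monomorphisms]
  rintro _ _ _ ⟨m⟩
  refine ⟨fun {ρ y} sq => ?_⟩
  obtain ⟨g, hg, h₁, h₂⟩ := exists_extension hd hS (restrictsTo_uncurry ρ)
    (restrictsTo_uncurry y) (by rw [← uncurry_res (h0 := h0), sq.w, uncurry_comp])
  refine ⟨⟨⟨curry hg, uncurry_injective ?_, uncurry_injective ?_⟩⟩⟩
  · rw [uncurry_comp, uncurry_curry, h₂]
  · rw [uncurry_res, uncurry_curry, h₁]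

end

/-! ### Horn filling and invertible edges -/

section

variable {X : SSet.{u}}

theorem yonedaEquiv_δ_comp {n : ℕ} (j : Fin (n + 2)) (f : Δ[n + 1] ⟶ X) :
    SSet.yonedaEquiv (SSet.stdSimplex.δ j ≫ f) = X.δ j (SSet.yonedaEquiv f) :=
  (SSet.yonedaEquiv_naturality (SimplexCategory.δ j) f).symm

theorem δ_δ {n : ℕ} {i j : Fin (n + 2)} (h : i ≤ j) (x : X _⦋n + 2⦌) :
    X.δ i (X.δ j.succ x) = X.δ j (X.δ i.castSucc x) :=
  ConcreteCategory.congr_hom (SimplicialObject.δ_comp_δ X h) x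

/-- The filling of inner horns in terms of simplices. -/
theorem exists_simplex [SSet.Quasicategory X] {n : ℕ} {i : Fin (n + 3)} (h0 : 0 < i)
    (hn : i < Fin.last _) (s : Fin (n + 3) → X _⦋n + 1⦌)
    (hs : ∀ (j k : Fin (n + 3)) (_ : j ≠ i) (_ : k ≠ i) (hjk : j < k),
      X.δ (k.pred (Fin.ne_zero_of_lt hjk)) (s j) =
        X.δ (j.castPred (Fin.ne_last_of_lt hjk)) (s k)) :
    ∃ t : X _⦋n + 2⦌, ∀ j, j ≠ i → X.δ j t = s j := by
  have hf : SSet.horn.IsCompatible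
      (fun (j : Fin (n + 3)) (_ : j ≠ i) => SSet.yonedaEquiv.symm (s j)) := by
    rw [SSet.horn.isCompatible_iff]
    intro j k hj hk hjk
    refine SSet.yonedaEquiv.injective ?_
    rw [yonedaEquiv_δ_comp, yonedaEquiv_δ_comp, Equiv.apply_symm_apply, Equiv.apply_symm_apply]
    exact hs j k hj hk hjk
  obtain ⟨φ, hφ⟩ := hf.exists_desc
  obtain ⟨τ, hτ⟩ := SSet.Quasicategory.hornFilling h0 hn φ
  refine ⟨SSet.yonedaEquiv τ, fun j hj => ?_⟩
  rw [← yonedaEquiv_δ_comp, ← SSet.horn.ι_ι i j hj, Category.assoc, ← hτ, hφ,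
    Equiv.apply_symm_apply]

theorem exists_compStruct [SSet.Quasicategory X] {x₀ x₁ x₂ : X _⦋0⦌} (e₀₁ : SSet.Edge x₀ x₁)
    (e₁₂ : SSet.Edge x₁ x₂) :
    ∃ e₀₂ : SSet.Edge x₀ x₂, Nonempty (SSet.Edge.CompStruct e₀₁ e₁₂ e₀₂) := by
  obtain ⟨t, ht⟩ := exists_simplex (X := X) (n := 0) (i := 1) (by decide) (by decide)
    ![e₁₂.edge, e₁₂.edge, e₀₁.edge] (by
      intro j k hj hk hjk
      obtain ⟨rfl, rfl⟩ : j = 0 ∧ k = 2 := by revert j k; decide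
      exact e₁₂.src_eq.trans e₀₁.tgt_eq.symm)
  have h₀ : X.δ 0 t = e₁₂.edge := ht 0 (by decide)
  have h₂ : X.δ 2 t = e₀₁.edge := ht 2 (by decide)
  refine ⟨SSet.Edge.mk (X.δ 1 t) ?_ ?_, ⟨SSet.Edge.CompStruct.mk t h₂ h₀ rfl⟩⟩
  · exact ((δ_δ (i := 1) (j := 1) le_rfl t).symm.trans (congrArg (X.δ 1) h₂)).trans e₀₁.src_eq
  · exact ((δ_δ (i := 0) (j := 0) le_rfl t).trans (congrArg (X.δ 0) h₀)).trans e₁₂.tgt_eq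

variable {x₀ x₁ x₂ x₃ : X _⦋0⦌} {e₀₁ : SSet.Edge x₀ x₁} {e₁₂ : SSet.Edge x₁ x₂}
  {e₂₃ : SSet.Edge x₂ x₃} {e₀₂ : SSet.Edge x₀ x₂} {e₁₃ : SSet.Edge x₁ x₃} {e₀₃ : SSet.Edge x₀ x₃}

theorem nonempty_compStruct_of_horn_one [SSet.Quasicategory X]
    (f₃ : SSet.Edge.CompStruct e₀₁ e₁₂ e₀₂) (f₀ : SSet.Edge.CompStruct e₁₂ e₂₃ e₁₃)
    (f₂ : SSet.Edge.CompStruct e₀₁ e₁₃ e₀₃) :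
    Nonempty (SSet.Edge.CompStruct e₀₂ e₂₃ e₀₃) := by
  obtain ⟨t, ht⟩ := exists_simplex (X := X) (n := 1) (i := 1) (by decide) (by decide)
    ![f₀.simplex, f₀.simplex, f₂.simplex, f₃.simplex] (by
      intro j k hj hk hjk
      obtain ⟨rfl, rfl⟩ | ⟨rfl, rfl⟩ | ⟨rfl, rfl⟩ :
          (j = 0 ∧ k = 2) ∨ (j = 0 ∧ k = 3) ∨ (j = 2 ∧ k = 3) := by revert j k; decide
      · exact f₀.d₁.trans f₂.d₀.symm
      · exact f₀.d₂.trans f₃.d₀.symm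
      · exact f₂.d₂.trans f₃.d₂.symm)
  have h₀ : X.δ 0 t = f₀.simplex := ht 0 (by decide)
  have h₂ : X.δ 2 t = f₂.simplex := ht 2 (by decide)
  have h₃ : X.δ 3 t = f₃.simplex := ht 3 (by decide)
  refine ⟨SSet.Edge.CompStruct.mk (X.δ 1 t) ?_ ?_ ?_⟩
  · exact ((δ_δ (i := 1) (j := 2) (by decide) t).symm.trans (congrArg (X.δ 1) h₃)).trans f₃.d₁
  · exact ((δ_δ (i := 0) (j := 0) le_rfl t).trans (congrArg (X.δ 0) h₀)).trans f₀.d₀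
  · exact ((δ_δ (i := 1) (j := 1) le_rfl t).symm.trans (congrArg (X.δ 1) h₂)).trans f₂.d₁

theorem nonempty_compStruct_of_horn_two [SSet.Quasicategory X]
    (f₃ : SSet.Edge.CompStruct e₀₁ e₁₂ e₀₂) (f₀ : SSet.Edge.CompStruct e₁₂ e₂₃ e₁₃)
    (f₁ : SSet.Edge.CompStruct e₀₂ e₂₃ e₀₃) :
    Nonempty (SSet.Edge.CompStruct e₀₁ e₁₃ e₀₃) := by
  obtain ⟨t, ht⟩ := exists_simplex (X := X) (n := 1) (i := 2) (by decide) (by decide)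
    ![f₀.simplex, f₁.simplex, f₀.simplex, f₃.simplex] (by
      intro j k hj hk hjk
      obtain ⟨rfl, rfl⟩ | ⟨rfl, rfl⟩ | ⟨rfl, rfl⟩ :
          (j = 0 ∧ k = 1) ∨ (j = 0 ∧ k = 3) ∨ (j = 1 ∧ k = 3) := by revert j k; decide
      · exact f₀.d₀.trans f₁.d₀.symm
      · exact f₀.d₂.trans f₃.d₀.symm
      · exact f₁.d₂.trans f₃.d₁.symm)
  have h₀ : X.δ 0 t = f₀.simplex := ht 0 (by decide)
  have h₁ : X.δ 1 t = f₁.simplex := ht 1 (by decide)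
  have h₃ : X.δ 3 t = f₃.simplex := ht 3 (by decide)
  refine ⟨SSet.Edge.CompStruct.mk (X.δ 2 t) ?_ ?_ ?_⟩
  · exact ((δ_δ (i := 2) (j := 2) le_rfl t).symm.trans (congrArg (X.δ 2) h₃)).trans f₃.d₂
  · exact ((δ_δ (i := 0) (j := 1) (by decide) t).trans (congrArg (X.δ 1) h₀)).trans f₀.d₁
  · exact ((δ_δ (i := 1) (j := 1) le_rfl t).trans (congrArg (X.δ 1) h₁)).trans f₁.d₁

/-- These fillings provide the homotopy category of the 2-truncation. There an edge has a homotopy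
inverse if and only if its class is an isomorphism, so that invertible edges can be composed. -/
instance [SSet.Quasicategory X] :
    SSet.Truncated.Quasicategory₂ ((SSet.truncation 2).obj X) where
  fill21 e₀₁ e₁₂ := by
    obtain ⟨e, ⟨h⟩⟩ := exists_compStruct (.ofTruncated e₀₁) (.ofTruncated e₁₂)
    exact ⟨⟨e.toTruncated, h.toTruncated⟩⟩
  fill31 f₃ f₀ f₂ := nonempty_compStruct_of_horn_one (.ofTruncated f₃) (.ofTruncated f₀)
    (.ofTruncated f₂)
  fill32 f₃ f₀ f₁ := nonempty_compStruct_of_horn_two (.ofTruncated f₃) (.ofTruncated f₀)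
    (.ofTruncated f₁)

open SSet.Truncated in
theorem nonempty_invStruct_iff [SSet.Quasicategory X] (e : SSet.Edge x₀ x₁) :
    Nonempty e.InvStruct ↔ IsIso (HomotopyCategory₂.homMk e.toTruncated) := by
  constructor
  · rintro ⟨I⟩
    exact ⟨HomotopyCategory₂.homMk I.inv.toTruncated,
      I.homInvId.toTruncated.homotopyCategory₂_fac, I.invHomId.toTruncated.homotopyCategory₂_fac⟩
  · rintro ⟨g, h₁, h₂⟩
    obtain ⟨g, rfl⟩ := HomotopyCategory₂.homMk_surjective g
    exact ⟨⟨.ofTruncated g, .ofTruncated (.ofHomotopyCategory₂Fac h₁),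
      .ofTruncated (.ofHomotopyCategory₂Fac h₂)⟩⟩

theorem exists_invStruct_comp [SSet.Quasicategory X]
    (h₁ : ∃ e : SSet.Edge x₀ x₁, Nonempty e.InvStruct)
    (h₂ : ∃ e : SSet.Edge x₁ x₂, Nonempty e.InvStruct) :
    ∃ e : SSet.Edge x₀ x₂, Nonempty e.InvStruct := by
  obtain ⟨e₁, h₁⟩ := h₁
  obtain ⟨e₂, h₂⟩ := h₂
  rw [nonempty_invStruct_iff] at h₁ h₂
  obtain ⟨e, ⟨h⟩⟩ := exists_compStruct e₁ e₂
  refine ⟨e, (nonempty_invStruct_iff e).2 ?_⟩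
  rw [← h.toTruncated.homotopyCategory₂_fac]
  infer_instance

end

/-! ### Isomorphic functors, and lifts along trivial fibrations -/

section

variable {X Y Z : SSet.{u}}

theorem AreIsomorphic.symm {f g : X ⟶ Y} (h : AreIsomorphic f g) : AreIsomorphic g f := by
  obtain ⟨e, ⟨I⟩⟩ := h
  exact ⟨_, ⟨I.invStructInv⟩⟩

theorem AreIsomorphic.trans [SSet.Quasicategory Y] {f g h : X ⟶ Y} (h₁ : AreIsomorphic f g)
    (h₂ : AreIsomorphic g h) : AreIsomorphic f h :=
  exists_invStruct_comp h₁ h₂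

theorem AreIsomorphic.of_map {X' Y' : SSet.{u}} (k : (ihom X).obj Y ⟶ (ihom X').obj Y')
    {f g : X ⟶ Y} {f' g' : X' ⟶ Y'} (hf : k.app _ (mapVertex f) = mapVertex f')
    (hg : k.app _ (mapVertex g) = mapVertex g') (h : AreIsomorphic f g) :
    AreIsomorphic f' g' := by
  obtain ⟨e, ⟨I⟩⟩ := h
  exact ⟨(e.map k).ofEq hf hg, ⟨(I.map k).ofEq rfl⟩⟩

theorem AreIsomorphic.comp_right {f g : X ⟶ Y} (h : AreIsomorphic f g) (b : Y ⟶ Z) :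
    AreIsomorphic (f ≫ b) (g ≫ b) := by
  have hk (f : X ⟶ Y) : ((ihom X).map b).app _ (mapVertex f) = mapVertex (f ≫ b) := by
    rw [mapVertex, ← SSet.yonedaEquiv_comp, ← MonoidalClosed.curry_natural_right, Category.assoc]
    rfl
  exact h.of_map _ (hk f) (hk g)

theorem AreIsomorphic.comp_left (a : X ⟶ Y) {f g : Y ⟶ Z} (h : AreIsomorphic f g) :
    AreIsomorphic (a ≫ f) (a ≫ g) := by
  have hk (f : Y ⟶ Z) :
      ((MonoidalClosed.pre a).app Z).app _ (mapVertex f) = mapVertex (a ≫ f) := by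
    rw [mapVertex, ← SSet.yonedaEquiv_comp, MonoidalClosed.curry_pre_app, mapVertex,
      whiskerRight_fst_assoc]
  exact h.of_map _ (hk f) (hk g)

end

section

variable {W Z B : SSet.{u}}

/-- The inclusion of `W` in `W ⊗ J` at a vertex of `J`. -/
def atVertex (W : SSet.{u}) {J : SSet.{u}} (x : J _⦋0⦌) : W ⟶ W ⊗ J := lift (𝟙 W) (SSet.const x)

theorem atVertex_app_ne {J : SSet.{u}} {x y : J _⦋0⦌} (hxy : x ≠ y) {n} (w w' : W.obj n) :
    (atVertex W x).app n w ≠ (atVertex W y).app n w' := by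
  intro h
  have h₁ : (SSet.const x : W ⟶ J).app n w = (SSet.const y : W ⟶ J).app n w' :=
    congrArg Prod.snd h
  apply hxy
  have h₂ := congrArg (J.map (SimplexCategory.const ⦋0⦌ n.unop 0).op) h₁
  have hc (z : J _⦋0⦌) (v : W.obj n) :
      J.map (SimplexCategory.const ⦋0⦌ n.unop 0).op ((SSet.const z : W ⟶ J).app n v) = z := by
    refine (NatTrans.naturality_apply (SSet.const z : W ⟶ J)
      (SimplexCategory.const ⦋0⦌ n.unop 0).op v).symm.trans ?_
    have : (SimplexCategory.const ⦋0⦌ ⦋0⦌ 0).op = 𝟙 _ :=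
      congrArg Quiver.Hom.op (Subsingleton.elim _ _)
    exact (congrArg (fun k => J.map k z) this).trans (ConcreteCategory.congr_hom (J.map_id _) z)
  rwa [hc, hc] at h₂

/-- The copies of `W` at `x` and `y` are disjoint in `W ⊗ J`, so `f` and `g` define a map on their
union. It lifts over the constant homotopy in `B`, since the union includes by a monomorphism. -/
theorem exists_homotopy {π : Z ⟶ B} (hπ : (MorphismProperty.monomorphisms SSet.{u}).rlp π)
    {f g : W ⟶ Z} (h : f ≫ π = g ≫ π) {J : SSet.{u}} {x y : J _⦋0⦌} (hxy : x ≠ y) :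
    ∃ H : W ⊗ J ⟶ Z, atVertex W x ≫ H = f ∧ atVertex W y ≫ H = g := by
  let D : (W ⊗ J).Subcomplex :=
    SSet.Subcomplex.range (atVertex W x) ⊔ SSet.Subcomplex.range (atVertex W y)
  obtain ⟨φ, hφ⟩ := exists_hom_of_rel (X := (D : SSet.{u})) (C := Z)
    (fun n t z => (∃ w, (atVertex W x).app n w = t.1 ∧ f.app n w = z) ∨
      ∃ w, (atVertex W y).app n w = t.1 ∧ g.app n w = z)
    (by
      rintro n m k ⟨t, ht⟩ z (⟨w, rfl, rfl⟩ | ⟨w, rfl, rfl⟩)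
      · exact Or.inl ⟨W.map k w, NatTrans.naturality_apply (atVertex W x) k w,
          NatTrans.naturality_apply f k w⟩
      · exact Or.inr ⟨W.map k w, NatTrans.naturality_apply (atVertex W y) k w,
          NatTrans.naturality_apply g k w⟩)
    (by
      rintro n ⟨t, ⟨w, hw⟩ | ⟨w, hw⟩⟩
      · exact ⟨_, Or.inl ⟨w, hw, rfl⟩⟩
      · exact ⟨_, Or.inr ⟨w, hw, rfl⟩⟩)
    (by
      rintro n t z z' (⟨w, hw, rfl⟩ | ⟨w, hw, rfl⟩) (⟨w', hw', rfl⟩ | ⟨w', hw', rfl⟩)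
      · obtain rfl : w = w' := congrArg Prod.fst (hw.trans hw'.symm)
        rfl
      · exact absurd (hw.trans hw'.symm) (atVertex_app_ne hxy w w')
      · exact absurd (hw.trans hw'.symm) (atVertex_app_ne hxy.symm w w')
      · obtain rfl : w = w' := congrArg Prod.fst (hw.trans hw'.symm)
        rfl)
  have sq : CommSq φ D.ι π (fst W J ≫ f ≫ π) := by
    refine ⟨NatTrans.ext (funext fun n => ConcreteCategory.hom_ext _ _ ?_)⟩
    rintro ⟨t, ⟨w, hw⟩ | ⟨w, hw⟩⟩
    · refine (congrArg (π.app n) (hφ (Or.inl ⟨w, hw, rfl⟩))).trans ?_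
      subst hw
      rfl
    · refine (congrArg (π.app n) (hφ (Or.inr ⟨w, hw, rfl⟩))).trans ?_
      subst hw
      exact (ConcreteCategory.congr_hom (NatTrans.congr_app h n) w).symm
  have := hπ D.ι (inferInstanceAs (Mono D.ι))
  refine ⟨sq.lift, ?_, ?_⟩
  · refine NatTrans.ext (funext fun n => ConcreteCategory.hom_ext _ _ fun w => ?_)
    refine (ConcreteCategory.congr_hom (NatTrans.congr_app sq.fac_left n)
      ⟨(atVertex W x).app n w, Or.inl ⟨w, rfl⟩⟩).trans ?_
    exact hφ (Or.inl ⟨w, rfl, rfl⟩)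
  · refine NatTrans.ext (funext fun n => ConcreteCategory.hom_ext _ _ fun w => ?_)
    refine (ConcreteCategory.congr_hom (NatTrans.congr_app sq.fac_left n)
      ⟨(atVertex W y).app n w, Or.inr ⟨w, rfl⟩⟩).trans ?_
    exact hφ (Or.inr ⟨w, rfl, rfl⟩)

theorem mapVertex_eq {J : SSet.{u}} (x : J _⦋0⦌) (H : W ⊗ J ⟶ Z) :
    (MonoidalClosed.curry H).app _ x = mapVertex (atVertex W x ≫ H) := by
  have h : W ◁ SSet.yonedaEquiv.symm x = fst W Δ[0] ≫ atVertex W x := by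
    refine CartesianMonoidalCategory.hom_ext _ _ ?_ ?_
    · rw [whiskerLeft_fst, Category.assoc, atVertex, lift_fst, Category.comp_id]
    · rw [whiskerLeft_snd, Category.assoc, atVertex, lift_snd, SSet.yonedaEquiv_symm_zero]
      rfl
  rw [mapVertex, ← Category.assoc, ← h, MonoidalClosed.curry_natural_left]
  rw [SSet.yonedaEquiv_comp, Equiv.apply_symm_apply]

/-- Take `J` to be the coherent isomorphism: the homotopy sends its invertible edge to an invertible
edge from `f` to `g`. -/
theorem areIsomorphic_of_comp_eq {π : Z ⟶ B}
    (hπ : (MorphismProperty.monomorphisms SSet.{u}).rlp π) {f g : W ⟶ Z} (h : f ≫ π = g ≫ π) :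
    AreIsomorphic f g := by
  have hxy : SSet.coherentIso.x₀.{u} ≠ SSet.coherentIso.x₁ := by
    intro h
    have := congrArg (fun F => WalkingIso.equivBool (F.obj 0)) h
    cases this
  obtain ⟨H, rfl, rfl⟩ := exists_homotopy hπ h hxy
  refine ⟨(SSet.coherentIso.hom.map (MonoidalClosed.curry H)).ofEq (mapVertex_eq _ H)
    (mapVertex_eq _ H), ⟨(SSet.coherentIso.invStructHom.map _).ofEq rfl⟩⟩

end

/-! ### The join and the product with the cone as generalized joins -/

section

variable {X : SSet.{u}} (χ : X ⟶ Δ[1])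

/-- The sets `{0}ᶜ` and `{1}` in `Fin 2` are equal, but not by definition, so the fiber over `1` is
converted by these two inclusions. -/
theorem part_compl_le_fiberOver : part χ {0}ᶜ ≤ fiberOver χ 1 := by
  intro n x hx
  refine (SSet.stdSimplex.mem_face_iff (n := 1) (d := n.unop.len) _ _).2 fun i => ?_
  have := (SSet.stdSimplex.mem_face_iff (n := 1) (d := n.unop.len) _ _).1 hx i
  rw [Finset.mem_compl, Finset.mem_singleton] at this
  rw [Finset.mem_singleton]
  exact Fin.eq_one_of_ne_zero _ this

theorem fiberOver_le_part_compl : fiberOver χ 1 ≤ part χ {0}ᶜ := by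
  intro n x hx
  refine (SSet.stdSimplex.mem_face_iff (n := 1) (d := n.unop.len) _ _).2 fun i => ?_
  have := (SSet.stdSimplex.mem_face_iff (n := 1) (d := n.unop.len) _ _).1 hx i
  rw [Finset.mem_singleton] at this
  rw [this]
  decide

end

section

variable (W K : SSet.{u})

/-- This is the Yoneda lemma for a part that contains the identity simplex, and hence is everything.
-/
theorem yonedaEquiv_symm_app_part {W : SSet.{u}} {n : SimplexCategory} {r : ℕ}
    {χ : SSet.stdSimplex.obj n ⟶ Δ[r]} {U : Finset (Fin (r + 1))}
    (l : (part χ U : SSet.{u}) ⟶ W) (h) {k} {y : (SSet.stdSimplex.obj n : SSet.{u}).obj k}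
    (hy : y ∈ (part χ U).obj k) :
    (SSet.yonedaEquiv.symm (l.app (op n)
      ⟨SSet.yonedaEquiv (𝟙 (SSet.stdSimplex.obj n)), h⟩)).app k y = l.app k ⟨y, hy⟩ := by
  have h₁ := NatTrans.naturality_apply l (SSet.stdSimplex.objEquiv y).op
    ⟨SSet.yonedaEquiv (𝟙 (SSet.stdSimplex.obj n)), h⟩
  refine h₁.symm.trans (congrArg (l.app k) (Subtype.ext ?_))
  exact vtx_ext fun i => rfl

/-- The join is a generalized join. -/
def joinToParts : join W K ⟶ partsJoin ({0} : Finset (Fin 2)) {0}ᶜ W K where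
  app n := ↾fun (t : JoinData (SSet.stdSimplex.obj n.unop) W K) =>
    (⟨t.χ, t.left, SSet.Subcomplex.homOfLE (part_compl_le_fiberOver t.χ) ≫ t.right⟩ :
      PartsData ({0} : Finset (Fin 2)) {0}ᶜ (SSet.stdSimplex.obj n.unop) W K)
  naturality _ _ _ := rfl

/-- The generalized join that is the join. -/
def partsToJoin : partsJoin ({0} : Finset (Fin 2)) {0}ᶜ W K ⟶ join W K where
  app n := ↾fun (t : PartsData ({0} : Finset (Fin 2)) {0}ᶜ (SSet.stdSimplex.obj n.unop) W K) =>
    (⟨t.χ, t.left, SSet.Subcomplex.homOfLE (fiberOver_le_part_compl t.χ) ≫ t.right⟩ :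
      JoinData (SSet.stdSimplex.obj n.unop) W K)
  naturality _ _ _ := rfl

/-- The product with the cone is a generalized join. -/
def coneToParts : leftCone K ⊗ W ⟶ partsJoin (Finset.univ : Finset (Fin 2)) {0}ᶜ W K where
  app n := ↾fun x =>
    (⟨JoinData.χ (X := SSet.stdSimplex.obj n.unop) x.1,
      (part (JoinData.χ (X := SSet.stdSimplex.obj n.unop) x.1) Finset.univ).ι ≫
        SSet.yonedaEquiv.symm x.2,
      SSet.Subcomplex.homOfLE (part_compl_le_fiberOver _) ≫
        JoinData.right (X := SSet.stdSimplex.obj n.unop) x.1⟩ :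
      PartsData (Finset.univ : Finset (Fin 2)) {0}ᶜ (SSet.stdSimplex.obj n.unop) W K)
  naturality n m f := by
    refine ConcreteCategory.hom_ext _ _ fun x => ?_
    refine PartsData.ext_of_apply (X := SSet.stdSimplex.obj m.unop) rfl ?_ (fun _ _ _ _ => rfl)
    intro k y hy _
    exact (ConcreteCategory.congr_hom (NatTrans.congr_app
      (SSet.yonedaEquiv_symm_naturality_left f.unop x.2) k) y).symm

/-- The generalized join that is the product with the cone. -/
def partsToCone : partsJoin (Finset.univ : Finset (Fin 2)) {0}ᶜ W K ⟶ leftCone K ⊗ W where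
  app n := ↾fun (t : PartsData (Finset.univ : Finset (Fin 2)) {0}ᶜ
      (SSet.stdSimplex.obj n.unop) W K) =>
    ((⟨t.χ, SSet.stdSimplex.isTerminalObj₀.from _,
      SSet.Subcomplex.homOfLE (fiberOver_le_part_compl t.χ) ≫ t.right⟩ :
        JoinData (SSet.stdSimplex.obj n.unop) Δ[0] K),
      t.left.app n ⟨SSet.yonedaEquiv (𝟙 (SSet.stdSimplex.obj n.unop)),
        (mem_part_iff _ _ _).2 fun _ => Finset.mem_univ _⟩)
  naturality n m f := by
    refine ConcreteCategory.hom_ext (C := Type u) _ _ fun t => Prod.ext ?_ ?_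
    · refine JoinData.ext_of_apply (X := SSet.stdSimplex.obj m.unop) rfl ?_ (fun _ _ _ _ => rfl)
      intro k y hy hy'
      exact vtx_ext (n := ⦋0⦌) fun _ => Subsingleton.elim (α := Fin 1) _ _
    · refine Eq.trans ?_ (NatTrans.naturality_apply
        (PartsData.left (X := SSet.stdSimplex.obj n.unop) t) f
        ⟨SSet.yonedaEquiv (𝟙 (SSet.stdSimplex.obj n.unop)),
          (mem_part_iff _ _ _).2 fun _ => Finset.mem_univ _⟩)
      refine congrArg ((PartsData.left (X := SSet.stdSimplex.obj n.unop) t).app m) ?_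
      exact Subtype.ext (SSet.yonedaEquiv_naturality f.unop
        (𝟙 (SSet.stdSimplex.obj n.unop))).symm

theorem coneToParts_partsToCone : coneToParts W K ≫ partsToCone W K = 𝟙 _ := by
  refine NatTrans.ext (funext fun n => ConcreteCategory.hom_ext (C := Type u) _ _ fun x =>
    Prod.ext ?_ ?_)
  · refine JoinData.ext_of_apply (X := SSet.stdSimplex.obj n.unop) rfl ?_ (fun _ _ _ _ => rfl)
    intro k y hy hy'
    exact vtx_ext (n := ⦋0⦌) fun _ => Subsingleton.elim (α := Fin 1) _ _
  · exact SSet.yonedaEquiv_symm_app_id x.2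

theorem partsToCone_coneToParts : partsToCone W K ≫ coneToParts W K = 𝟙 _ := by
  refine NatTrans.ext (funext fun n => ConcreteCategory.hom_ext _ _ fun t => ?_)
  refine PartsData.ext_of_apply (X := SSet.stdSimplex.obj n.unop) rfl ?_ (fun _ _ _ _ => rfl)
  exact fun k y hy _ => yonedaEquiv_symm_app_part _ _ hy

variable {W} in
theorem mapLeft_partsToCone {W' : SSet.{u}} (g : W ⟶ W') :
    mapLeft g K ≫ partsToCone W' K = partsToCone W K ≫ leftCone K ◁ g := rfl

/-- The morphism of shapes that forgets the map to the first variable over `1`. -/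
def forgetOne : ShapeHom (Finset.univ : Finset (Fin 2)) ({0} : Finset (Fin 2)) where
  hom := 𝟙 _
  mem _ _ := Finset.mem_univ _
  zero _ := Iff.rfl

/-- This identifies the canonical map `K^◁ × W ⟶ W ⋆ K` with a morphism of shapes, so that `φ`
becomes a restriction between generalized slices. -/
theorem partsToCone_coneToJoin :
    partsToCone W K ≫ coneToJoin W K = forgetOne.map W K ≫ partsToJoin W K := by
  refine NatTrans.ext (funext fun n => ConcreteCategory.hom_ext _ _ fun t => ?_)
  refine JoinData.ext_of_apply (X := SSet.stdSimplex.obj n.unop) ?_ ?_ ?_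
  · refine Eq.trans ?_ ((congrArg (PartsData.χ (X := SSet.stdSimplex.obj n.unop) t ≫ ·)
      (SSet.stdSimplex.map_id ⦋1⦌)).trans (Category.comp_id _)).symm
    refine (SSet.yonedaEquiv_symm_comp _ _).trans ?_
    exact Equiv.symm_apply_apply _ _
  · intro k y hy hy'
    exact yonedaEquiv_symm_app_part (PartsData.left (X := SSet.stdSimplex.obj n.unop) t) _ _
  · intro k y hy hy'
    refine congrArg ((PartsData.right (X := SSet.stdSimplex.obj n.unop) t).app k) ?_
    exact Subtype.ext (vtx_ext fun i => rfl)

end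

/-! ### The slice and the fiber as generalized slices -/

section

variable {W K C : SSet.{u}} {p : K ⟶ C}

theorem zero_mem_singleton : (0 : Fin 2) ∈ ({0} : Finset (Fin 2)) := Finset.mem_singleton_self 0

theorem vtx_joinInr {n : SimplexCategoryᵒᵖ} (x : K.obj n) (i) :
    vtx (SSet.yonedaEquiv (JoinData.χ (X := SSet.stdSimplex.obj n.unop)
      ((joinInr W K).app n x))) i = 1 := rfl

/-- A simplex of the join lying over `1` has empty part over `0`, so only its component in `K`
remains. -/
theorem joinInr_eq_of_vertex {n : SimplexCategoryᵒᵖ}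
    (t : JoinData (SSet.stdSimplex.obj n.unop) W K)
    (ht : ∀ i, vtx (SSet.yonedaEquiv t.χ) i ∈ ({0}ᶜ : Finset (Fin 2))) (h) :
    (joinInr W K).app n (t.right.app n ⟨SSet.yonedaEquiv (𝟙 (SSet.stdSimplex.obj n.unop)), h⟩) =
      t := by
  have hv (i) : vtx (SSet.yonedaEquiv t.χ) i = 1 := by
    have := ht i
    rw [Finset.mem_compl, Finset.mem_singleton] at this
    exact Fin.eq_one_of_ne_zero _ this
  refine JoinData.ext_of_apply (X := SSet.stdSimplex.obj n.unop) ?_ ?_ ?_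
  · exact SSet.yonedaEquiv.injective (vtx_ext (n := ⦋1⦌) fun i => (vtx_joinInr _ i).trans (hv i).symm)
  · exact fun k x hx _ => (isEmpty_fiberOver_zero _ k ⟨x, hx⟩).elim
  · exact fun k y _ hy => yonedaEquiv_symm_app_part t.right _ _

theorem restrictsTo_partsToJoin_iff {f : join W K ⟶ C} :
    RestrictsTo zero_mem_singleton p (partsToJoin W K ≫ f) ↔ joinInr W K ≫ f = p := by
  constructor
  · intro h
    refine NatTrans.ext (funext fun n => ConcreteCategory.hom_ext _ _ fun x => ?_)
    have hx (i) : PartsData.vertex (n := n.unop)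
        ((joinToParts W K).app n ((joinInr W K).app n x)) i ∈ ({0}ᶜ : Finset (Fin 2)) := by
      have : (1 : Fin 2) ∈ ({0}ᶜ : Finset (Fin 2)) := by decide
      exact (congrArg (· ∈ ({0}ᶜ : Finset (Fin 2))) (vtx_joinInr (W := W) x i)).mpr this
    refine (h.apply ((joinToParts W K).app n ((joinInr W K).app n x)) hx).trans ?_
    exact congrArg (p.app n) (SSet.yonedaEquiv_symm_app_id x)
  · rintro rfl
    refine NatTrans.ext (funext fun n => ConcreteCategory.hom_ext _ _ fun t => ?_)
    refine congrArg (f.app n) ?_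
    exact (joinInr_eq_of_vertex ((partsToJoin W K).app n t.1) t.2
      (part_compl_le_fiberOver _ _ ((mem_part_iff _ _ _).2 fun i => t.2 i))).symm

theorem zero_mem_univ : (0 : Fin 2) ∈ (Finset.univ : Finset (Fin 2)) := Finset.mem_univ 0

theorem joinInr_whiskerRight_coneToParts_mem {n : SimplexCategoryᵒᵖ} (x : (K ⊗ W).obj n) :
    (joinInr Δ[0] K ▷ W ≫ coneToParts W K).app n x ∈
      ((missFamily zero_mem_univ K).obj W).obj n := by
  intro i
  have : (1 : Fin 2) ∈ ({0}ᶜ : Finset (Fin 2)) := by decide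
  exact (congrArg (· ∈ ({0}ᶜ : Finset (Fin 2))) (vtx_joinInr (W := Δ[0]) x.1 i)).mpr this

theorem restrictsTo_partsToCone_iff {f : leftCone K ⊗ W ⟶ C} :
    RestrictsTo zero_mem_univ p (partsToCone W K ≫ f) ↔
      joinInr Δ[0] K ▷ W ≫ f = fst K W ≫ p := by
  constructor
  · intro h
    refine NatTrans.ext (funext fun n => ConcreteCategory.hom_ext _ _ fun x => ?_)
    have h₁ := h.apply _ (joinInr_whiskerRight_coneToParts_mem x)
    have h₂ := ConcreteCategory.congr_hom (NatTrans.congr_app (coneToParts_partsToCone W K) n)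
      ((joinInr Δ[0] K ▷ W).app n x)
    refine (congrArg (f.app n) h₂).symm.trans (h₁.trans ?_)
    exact congrArg (p.app n) (SSet.yonedaEquiv_symm_app_id x.1)
  · intro h
    refine NatTrans.ext (funext fun n => ConcreteCategory.hom_ext _ _ fun t => ?_)
    let x : (K ⊗ W).obj n := show K.obj n × W.obj n from
      ((missRight zero_mem_univ K W).app n t, ((partsToCone W K).app n t.1).2)
    have h₁ := ConcreteCategory.congr_hom (NatTrans.congr_app h n) x
    have h₂ : (partsToCone W K).app n t.1 = (joinInr Δ[0] K ▷ W).app n x :=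
      Prod.ext (joinInr_eq_of_vertex ((partsToCone W K).app n t.1).1 t.2
        (part_compl_le_fiberOver _ _ ((mem_part_iff _ _ _).2 fun i => t.2 i))).symm rfl
    exact (congrArg (f.app n) h₂).trans h₁

/-- The slice as a generalized slice. -/
def sliceToParts (p : K ⟶ C) : slice p ⟶ partsSlice zero_mem_singleton p where
  app n := ↾fun f =>
    { base := SSet.yonedaEquiv (SSet.stdSimplex.isTerminalObj₀.from (SSet.stdSimplex.obj n.unop))
      hom := partsToJoin _ K ≫ f.1
      comm := restrictsTo_partsToJoin_iff.2 f.2 }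
  naturality n m f := by
    refine ConcreteCategory.hom_ext _ _ fun x => ?_
    refine StableFamily.RelMap.ext' _ _ ?_ rfl
    exact vtx_ext (n := ⦋0⦌) fun _ => Subsingleton.elim (α := Fin 1) _ _

/-- The slice as a generalized slice. -/
def partsToSlice (p : K ⟶ C) : partsSlice zero_mem_singleton p ⟶ slice p where
  app n := ↾fun (f : (missFamily zero_mem_singleton K).RelMap _ n.unop) =>
    ⟨joinToParts _ K ≫ f.hom, restrictsTo_partsToJoin_iff.1 f.comm⟩
  naturality _ _ _ := rfl

theorem sliceToParts_partsToSlice (p : K ⟶ C) : sliceToParts p ≫ partsToSlice p = 𝟙 _ := rfl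

theorem partsToSlice_sliceToParts (p : K ⟶ C) : partsToSlice p ≫ sliceToParts p = 𝟙 _ := by
  refine NatTrans.ext (funext fun n => ConcreteCategory.hom_ext _ _ fun x => ?_)
  refine StableFamily.RelMap.ext' _ _ ?_ rfl
  exact vtx_ext (n := ⦋0⦌) fun _ => Subsingleton.elim (α := Fin 1) _ _

theorem terminal_mapVertex (p : K ⟶ C) (W : SSet.{u}) :
    SSet.stdSimplex.isTerminalObj₀.from W ≫ SSet.yonedaEquiv.symm (mapVertex p) =
      MonoidalClosed.curry (fst K W ≫ p) := by
  rw [mapVertex, Equiv.symm_apply_apply, ← MonoidalClosed.curry_natural_left,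
    whiskerLeft_fst_assoc]

/-- The map to the fiber of `C ^ (K^◁) ⟶ C ^ K` corresponding to a map from a product. -/
def toConeFiber (f : leftCone K ⊗ W ⟶ C) (hf : joinInr Δ[0] K ▷ W ≫ f = fst K W ≫ p) :
    W ⟶ coneFiber p :=
  pullback.lift (MonoidalClosed.curry f) (SSet.stdSimplex.isTerminalObj₀.from W) (by
    rw [terminal_mapVertex, MonoidalClosed.curry_pre_app, hf])

/-- The map from a product corresponding to a map to the fiber of `C ^ (K^◁) ⟶ C ^ K`. -/
def ofConeFiber (ρ : W ⟶ coneFiber p) : leftCone K ⊗ W ⟶ C :=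
  MonoidalClosed.uncurry (ρ ≫ pullback.fst _ _)

theorem ofConeFiber_toConeFiber (f : leftCone K ⊗ W ⟶ C)
    (hf : joinInr Δ[0] K ▷ W ≫ f = fst K W ≫ p) : ofConeFiber (toConeFiber f hf) = f := by
  rw [ofConeFiber, toConeFiber, pullback.lift_fst, MonoidalClosed.uncurry_curry]

theorem ofConeFiber_comp {W' : SSet.{u}} (g : W' ⟶ W) (ρ : W ⟶ coneFiber p) :
    ofConeFiber (g ≫ ρ) = leftCone K ◁ g ≫ ofConeFiber ρ := by
  rw [ofConeFiber, Category.assoc, MonoidalClosed.uncurry_natural_left, ofConeFiber]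

theorem ofConeFiber_injective {ρ ρ' : W ⟶ coneFiber p} (h : ofConeFiber ρ = ofConeFiber ρ') :
    ρ = ρ' :=
  pullback.hom_ext (MonoidalClosed.uncurry_injective h)
    (SSet.stdSimplex.isTerminalObj₀.hom_ext _ _)

theorem joinInr_ofConeFiber (ρ : W ⟶ coneFiber p) :
    joinInr Δ[0] K ▷ W ≫ ofConeFiber ρ = fst K W ≫ p := by
  refine MonoidalClosed.curry_injective ?_
  rw [← MonoidalClosed.curry_pre_app, ofConeFiber, MonoidalClosed.curry_uncurry, Category.assoc,
    pullback.condition, ← terminal_mapVertex, ← Category.assoc]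
  exact congrArg (· ≫ _) (SSet.stdSimplex.isTerminalObj₀.hom_ext _ _)

/-- The fiber of `C ^ (K^◁) ⟶ C ^ K` as a generalized slice. -/
def coneFiberToParts (p : K ⟶ C) : coneFiber p ⟶ partsSlice zero_mem_univ p :=
  curry (restrictsTo_partsToCone_iff.2 (joinInr_ofConeFiber (𝟙 (coneFiber p))))

theorem joinInr_coneToParts_uncurry (ρ : W ⟶ partsSlice zero_mem_univ p) :
    joinInr Δ[0] K ▷ W ≫ coneToParts W K ≫ uncurry ρ = fst K W ≫ p := by
  refine restrictsTo_partsToCone_iff.1 ?_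
  have h : partsToCone W K ≫ coneToParts W K ≫ uncurry ρ = uncurry ρ := by
    rw [← Category.assoc, partsToCone_coneToParts, Category.id_comp]
  rw [h]
  exact restrictsTo_uncurry ρ

/-- The fiber of `C ^ (K^◁) ⟶ C ^ K` as a generalized slice. -/
def partsToConeFiber (p : K ⟶ C) : partsSlice zero_mem_univ p ⟶ coneFiber p :=
  toConeFiber _ (joinInr_coneToParts_uncurry (𝟙 (partsSlice zero_mem_univ p)))

theorem uncurry_comp_coneFiberToParts (ρ : W ⟶ coneFiber p) :
    uncurry (ρ ≫ coneFiberToParts p) = partsToCone W K ≫ ofConeFiber ρ := by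
  rw [uncurry_comp, coneFiberToParts, uncurry_curry]
  have h := ofConeFiber_comp ρ (𝟙 (coneFiber p))
  rw [Category.comp_id] at h
  rw [h]
  rfl

theorem coneToParts_naturality {W' : SSet.{u}} (g : W' ⟶ W) :
    leftCone K ◁ g ≫ coneToParts W K = coneToParts W' K ≫ mapLeft g K := by
  have h := congrArg (fun z => coneToParts W' K ≫ z ≫ coneToParts W K)
    (mapLeft_partsToCone (K := K) g)
  simp only [Category.assoc, partsToCone_coneToParts, Category.comp_id] at h
  rw [h, ← Category.assoc (coneToParts W' K), coneToParts_partsToCone, Category.id_comp]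

theorem ofConeFiber_comp_partsToConeFiber (ρ : W ⟶ partsSlice zero_mem_univ p) :
    ofConeFiber (ρ ≫ partsToConeFiber p) = coneToParts W K ≫ uncurry ρ := by
  rw [ofConeFiber_comp, partsToConeFiber, ofConeFiber_toConeFiber, ← Category.assoc,
    coneToParts_naturality, Category.assoc, ← uncurry_comp, Category.comp_id]

theorem coneFiberToParts_partsToConeFiber (p : K ⟶ C) :
    coneFiberToParts p ≫ partsToConeFiber p = 𝟙 _ := by
  refine ofConeFiber_injective ?_
  have h := uncurry_comp_coneFiberToParts (𝟙 (coneFiber p))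
  rw [Category.id_comp] at h
  rw [ofConeFiber_comp_partsToConeFiber, h, ← Category.assoc, coneToParts_partsToCone,
    Category.id_comp]

theorem partsToConeFiber_coneFiberToParts (p : K ⟶ C) :
    partsToConeFiber p ≫ coneFiberToParts p = 𝟙 _ := by
  refine uncurry_injective ?_
  have h := ofConeFiber_comp_partsToConeFiber (𝟙 (partsSlice zero_mem_univ p))
  rw [Category.id_comp] at h
  rw [uncurry_comp_coneFiberToParts, h, ← Category.assoc, partsToCone_coneToParts,
    Category.id_comp]

/-- By the universal property the two sides may be compared on the simplices `x` of the slice, where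
the equality is `partsToCone_coneToJoin`. -/
theorem sliceComparison_coneFiberToParts (p : K ⟶ C) :
    sliceComparison p ≫ coneFiberToParts p =
      sliceToParts p ≫ forgetOne.res zero_mem_univ zero_mem_singleton p := by
  refine uncurry_injective ?_
  refine restrictsTo_ext (restrictsTo_uncurry _) (restrictsTo_uncurry _) fun {n} x => ?_
  rw [← uncurry_comp, ← Category.assoc, uncurry_comp_coneFiberToParts, uncurry_res]
  have h₁ : ofConeFiber (x ≫ sliceComparison p) =
      coneToJoin (SSet.stdSimplex.obj n) K ≫ Subtype.val (SSet.yonedaEquiv x) := by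
    have h : x ≫ sliceToCone p = MonoidalClosed.curry
        (coneToJoin (SSet.stdSimplex.obj n) K ≫ Subtype.val (SSet.yonedaEquiv x)) :=
      SSet.yonedaEquiv.injective (SSet.yonedaEquiv_comp x (sliceToCone p))
    rw [ofConeFiber, Category.assoc, sliceComparison, pullback.lift_fst, h,
      MonoidalClosed.uncurry_curry]
  have h₂ : mapLeft x K ≫ uncurry (sliceToParts p) =
      partsToJoin _ K ≫ Subtype.val (SSet.yonedaEquiv x) := mapLeft_uncurry _ x
  rw [h₁, ← Category.assoc, partsToCone_coneToJoin, Category.assoc, ← h₂]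
  rfl

end

/-! ### Permanence properties of quasicategories and equivalences -/

section

variable {K C : SSet.{u}}

theorem joinInr_injective (W : SSet.{u}) (n) : Function.Injective ((joinInr W K).app n) := by
  intro x y h
  let R (t : {t : JoinData (SSet.stdSimplex.obj n.unop) W K //
      SSet.yonedaEquiv (𝟙 (SSet.stdSimplex.obj n.unop)) ∈ (fiberOver t.χ 1).obj n}) : K.obj n :=
    t.1.right.app n ⟨_, t.2⟩
  have hR (x : K.obj n) : R ⟨(joinInr W K).app n x,
      (SSet.stdSimplex.mem_face_iff (n := 1) (d := n.unop.len) _ _).2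
        fun i => Finset.mem_singleton.2 (vtx_joinInr (W := W) x i)⟩ = x :=
    SSet.yonedaEquiv_symm_app_id x
  exact (hR x).symm.trans ((congrArg R (Subtype.ext h)).trans (hR y))

instance (W : SSet.{u}) : Mono (joinInr W K) := by
  have h (n) : Mono ((joinInr W K).app n) :=
    (mono_iff_injective _).2 (joinInr_injective W n)
  exact NatTrans.mono_of_mono_app _

/-- As `joinInr` is a monomorphism, `restrictCone` is an inner fibration, and so is its pullback to
the point. -/
instance [SSet.Quasicategory C] (p : K ⟶ C) : SSet.Quasicategory (coneFiber p) := by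
  rw [SSet.quasicategory_iff_of_isTerminal (pullback.snd (restrictCone K C) _)
    SSet.stdSimplex.isTerminalObj₀, SSet.innerFibration_iff]
  exact MorphismProperty.pullback_snd _ _ (SSet.mem_innerFibrations (restrictCone K C))

theorem quasicategory_of_rlp {X Y : SSet.{u}} [SSet.Quasicategory Y] {π : X ⟶ Y}
    (hπ : (MorphismProperty.monomorphisms SSet.{u}).rlp π) : SSet.Quasicategory X := by
  have : SSet.InnerFibration π := ⟨fun _ _ i hi =>
    hπ i (SSet.innerHornInclusions_le_monomorphisms _ hi)⟩
  exact SSet.quasicategory_of_innerFibration π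

theorem quasicategory_of_retract {X Y : SSet.{u}} [SSet.Quasicategory Y] {i : X ⟶ Y} {r : Y ⟶ X}
    (h : i ≫ r = 𝟙 X) : SSet.Quasicategory X where
  hornFilling' n k σ h0 hn := by
    obtain ⟨τ, hτ⟩ := SSet.Quasicategory.hornFilling h0 hn (σ ≫ i)
    refine ⟨τ ≫ r, ?_⟩
    rw [← Category.assoc, ← hτ, Category.assoc, h, Category.comp_id]

theorem exists_section {X Y : SSet.{u}} {π : X ⟶ Y}
    (hπ : (MorphismProperty.monomorphisms SSet.{u}).rlp π) : ∃ s : Y ⟶ X, s ≫ π = 𝟙 Y := by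
  have sq : CommSq (initial.to X) (initial.to Y) π (𝟙 Y) := ⟨initialIsInitial.hom_ext _ _⟩
  have := hπ (initial.to Y) (inferInstanceAs (Mono (initial.to Y)))
  exact ⟨sq.lift, sq.fac_right⟩

theorem IsInftyEquivalence.of_iso {X Y X' Y' : SSet.{u}} {φ : X ⟶ Y} {φ' : X' ⟶ Y'}
    (a : X ≅ X') (b : Y ≅ Y') (h : φ ≫ b.hom = a.hom ≫ φ') (hφ : IsInftyEquivalence φ') :
    IsInftyEquivalence φ := by
  obtain ⟨ψ, h₁, h₂⟩ := hφ
  refine ⟨b.hom ≫ ψ ≫ a.inv, ?_, ?_⟩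
  · have := (h₁.comp_left a.hom).comp_right a.inv
    rwa [Category.comp_id, a.hom_inv_id, ← Category.assoc, ← h, Category.assoc,
      Category.assoc] at this
  · have := (h₂.comp_left b.hom).comp_right b.inv
    rw [Category.comp_id, b.hom_inv_id] at this
    have h' : a.inv ≫ φ = φ' ≫ b.inv := by
      rw [Iso.inv_comp_eq, ← Category.assoc, ← h, Category.assoc, b.hom_inv_id, Category.comp_id]
    rwa [Category.assoc, Category.assoc, h', ← Category.assoc ψ, ← Category.assoc]

/-- One-sided inverses of `ψ` agree up to isomorphism: `φ ≅ φ ≫ ψ ≫ φ' ≅ φ'`. -/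
theorem isInftyEquivalence_of_inverses {X Y : SSet.{u}} [SSet.Quasicategory X]
    [SSet.Quasicategory Y] {φ φ' : X ⟶ Y} {ψ : Y ⟶ X} (h : AreIsomorphic (φ ≫ ψ) (𝟙 X))
    (h' : AreIsomorphic (ψ ≫ φ') (𝟙 Y)) : IsInftyEquivalence φ := by
  refine ⟨ψ, h, ?_⟩
  have h₁ : AreIsomorphic (φ ≫ ψ ≫ φ') φ := by
    simpa only [Category.comp_id] using h'.comp_left φ
  have h₂ : AreIsomorphic (φ ≫ ψ ≫ φ') φ' := by
    simpa only [Category.assoc, Category.id_comp] using h.comp_right φ'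
  exact ((h₁.symm.trans h₂).comp_left ψ).trans h'

end

/-! ### The equivalence between the two generalized slices -/

section

/-- The morphism of shapes given by a map on vertices. -/
def ShapeHom.ofOrderHom {r r' : ℕ} {S : Finset (Fin (r + 1))} {S' : Finset (Fin (r' + 1))}
    (f : Fin (r + 1) →o Fin (r' + 1)) (mem : ∀ i, f i ∈ S' → i ∈ S)
    (zero : ∀ i, f i ∈ ({0}ᶜ : Finset (Fin (r' + 1))) ↔ i ∈ ({0}ᶜ : Finset (Fin (r + 1)))) :
    ShapeHom S S' where
  hom := SimplexCategory.mkHom f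
  mem := mem
  zero := zero

variable {K C : SSet.{u}} (p : K ⟶ C)

theorem quasicategory_partsSlice_univ [SSet.Quasicategory C] : SSet.Quasicategory (partsSlice zero_mem_univ p) :=
  quasicategory_of_retract (partsToConeFiber_coneFiberToParts p)

/-- The degeneration of the second part of a generalized slice. -/
def degenerate : ShapeHom ({0, 1} : Finset (Fin 3)) ({0} : Finset (Fin 2)) :=
  .ofOrderHom ⟨![0, 1, 1], by decide⟩ (by decide) (by decide)

/-- The shape `{0, 1}` in `⦋2⦌` interpolates between the two constructions: its edge `01` has the
shape of the product with the cone, its edge `02` that of the join. -/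
def face01 : ShapeHom (Finset.univ : Finset (Fin 2)) ({0, 1} : Finset (Fin 3)) :=
  .ofOrderHom ⟨![0, 1], by decide⟩ (by decide) (by decide)

def face02 : ShapeHom ({0} : Finset (Fin 2)) ({0, 1} : Finset (Fin 3)) :=
  .ofOrderHom ⟨![0, 2], by decide⟩ (by decide) (by decide)

theorem zero_mem_pair (i : Fin 3) : (0 : Fin 3) ∈ ({0, i} : Finset (Fin 3)) :=
  Finset.mem_insert_self 0 _

theorem degenerate_face01 :
    degenerate.res (zero_mem_pair 1) zero_mem_singleton p ≫
      face01.res zero_mem_univ (zero_mem_pair 1) p =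
        forgetOne.res zero_mem_univ zero_mem_singleton p :=
  res_comp_res _ _ _ (by ext i; revert i; decide)

theorem degenerate_face02 :
    degenerate.res (zero_mem_pair 1) zero_mem_singleton p ≫
      face02.res zero_mem_singleton (zero_mem_pair 1) p = 𝟙 _ :=
  (res_comp_res _ _ (.ofOrderHom .id (fun _ => id) (fun _ => Iff.rfl))
    (by ext i; revert i; decide)).trans (res_eq_id _ rfl)

theorem face01_rlp [SSet.Quasicategory C] : (MorphismProperty.monomorphisms SSet.{u}).rlp
    (face01.res zero_mem_univ (zero_mem_pair 1) p) :=
  res_rlp _ (by decide) (by decide)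

/-- The generalized slice of shape `{0, 1}` in `⦋2⦌` is trivially fibered over the one for the
product with the cone, and `degenerate` and `face02` exhibit the slice as a retract of it. -/
theorem quasicategory_partsSlice_singleton [SSet.Quasicategory C] :
    SSet.Quasicategory (partsSlice zero_mem_singleton p) := by
  have := quasicategory_partsSlice_univ p
  have := quasicategory_of_rlp (face01_rlp p)
  exact quasicategory_of_retract (degenerate_face02 p)

theorem zero_mem_triple : (0 : Fin 4) ∈ ({0, 1, 3} : Finset (Fin 4)) := by decide

/-- In the shape `{0, 1, 3}`, the vertex `2` of join type stands between the vertices `1` and `3` of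
cone type. Passing from `1` to `2` defines the inverse, and passing on to `3` shows that nothing was
lost. -/
theorem isInftyEquivalence_res [SSet.Quasicategory C] :
    IsInftyEquivalence (forgetOne.res zero_mem_univ zero_mem_singleton p) := by
  have := quasicategory_partsSlice_univ p
  have := quasicategory_partsSlice_singleton p
  let h₂ := zero_mem_pair 1
  let h₂' := zero_mem_pair 2
  let h₃ : (0 : Fin 3) ∈ (Finset.univ : Finset (Fin 3)) := Finset.mem_univ 0
  let h₄ := zero_mem_triple
  -- the faces of the generalized slice with three parts
  let d₀₁ : ShapeHom (Finset.univ : Finset (Fin 2)) ({0, 1, 3} : Finset (Fin 4)) :=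
    .ofOrderHom ⟨![0, 1], by decide⟩ (by decide) (by decide)
  let d₀₂ : ShapeHom ({0} : Finset (Fin 2)) ({0, 1, 3} : Finset (Fin 4)) :=
    .ofOrderHom ⟨![0, 2], by decide⟩ (by decide) (by decide)
  let d₀₃ : ShapeHom (Finset.univ : Finset (Fin 2)) ({0, 1, 3} : Finset (Fin 4)) :=
    .ofOrderHom ⟨![0, 3], by decide⟩ (by decide) (by decide)
  let d₀₁₂ : ShapeHom ({0, 1} : Finset (Fin 3)) ({0, 1, 3} : Finset (Fin 4)) :=
    .ofOrderHom ⟨![0, 1, 2], by decide⟩ (by decide) (by decide)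
  let d₀₁₃ : ShapeHom (Finset.univ : Finset (Fin 3)) ({0, 1, 3} : Finset (Fin 4)) :=
    .ofOrderHom ⟨![0, 1, 3], by decide⟩ (by decide) (by decide)
  let d₀₂₃ : ShapeHom ({0, 2} : Finset (Fin 3)) ({0, 1, 3} : Finset (Fin 4)) :=
    .ofOrderHom ⟨![0, 2, 3], by decide⟩ (by decide) (by decide)
  -- the faces of the other generalized slices with two parts
  let a₀₁ : ShapeHom ({0} : Finset (Fin 2)) ({0, 2} : Finset (Fin 3)) :=
    .ofOrderHom ⟨![0, 1], by decide⟩ (by decide) (by decide)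
  let a₀₂ : ShapeHom (Finset.univ : Finset (Fin 2)) ({0, 2} : Finset (Fin 3)) :=
    .ofOrderHom ⟨![0, 2], by decide⟩ (by decide) (by decide)
  let b₀₁ : ShapeHom (Finset.univ : Finset (Fin 2)) (Finset.univ : Finset (Fin 3)) :=
    .ofOrderHom ⟨![0, 1], by decide⟩ (by decide) (by decide)
  let b₀₂ : ShapeHom (Finset.univ : Finset (Fin 2)) (Finset.univ : Finset (Fin 3)) :=
    .ofOrderHom ⟨![0, 2], by decide⟩ (by decide) (by decide)
  let δ : ShapeHom (Finset.univ : Finset (Fin 3)) (Finset.univ : Finset (Fin 2)) :=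
    .ofOrderHom ⟨![0, 1, 1], by decide⟩ (by decide) (by decide)
  have hδ₁ : δ.res h₃ zero_mem_univ p ≫ b₀₁.res zero_mem_univ h₃ p = 𝟙 _ :=
    (res_comp_res _ _ (.ofOrderHom .id (fun _ => id) (fun _ => Iff.rfl))
      (by ext i; revert i; decide)).trans (res_eq_id _ rfl)
  have hδ₂ : δ.res h₃ zero_mem_univ p ≫ b₀₂.res zero_mem_univ h₃ p = 𝟙 _ :=
    (res_comp_res _ _ (.ofOrderHom .id (fun _ => id) (fun _ => Iff.rfl))
      (by ext i; revert i; decide)).trans (res_eq_id _ rfl)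
  have e₁ : d₀₁₂.res h₂ h₄ p ≫ face01.res zero_mem_univ h₂ p = d₀₁.res zero_mem_univ h₄ p :=
    res_comp_res _ _ _ (by ext i; revert i; decide)
  have e₂ : d₀₁₂.res h₂ h₄ p ≫ face02.res zero_mem_singleton h₂ p =
      d₀₂.res zero_mem_singleton h₄ p := res_comp_res _ _ _ (by ext i; revert i; decide)
  have e₃ : d₀₁₃.res h₃ h₄ p ≫ b₀₁.res zero_mem_univ h₃ p = d₀₁.res zero_mem_univ h₄ p :=
    res_comp_res _ _ _ (by ext i; revert i; decide)
  have e₄ : d₀₁₃.res h₃ h₄ p ≫ b₀₂.res zero_mem_univ h₃ p = d₀₃.res zero_mem_univ h₄ p :=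
    res_comp_res _ _ _ (by ext i; revert i; decide)
  have e₅ : d₀₂₃.res h₂' h₄ p ≫ a₀₁.res zero_mem_singleton h₂' p =
      d₀₂.res zero_mem_singleton h₄ p := res_comp_res _ _ _ (by ext i; revert i; decide)
  have e₆ : d₀₂₃.res h₂' h₄ p ≫ a₀₂.res zero_mem_univ h₂' p = d₀₃.res zero_mem_univ h₄ p :=
    res_comp_res _ _ _ (by ext i; revert i; decide)
  have ha : (MorphismProperty.monomorphisms SSet.{u}).rlp (a₀₁.res zero_mem_singleton h₂' p) :=
    res_rlp _ (by decide) (by decide)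
  have hb : (MorphismProperty.monomorphisms SSet.{u}).rlp (b₀₁.res zero_mem_univ h₃ p) :=
    res_rlp _ (by decide) (by decide)
  have hd : (MorphismProperty.monomorphisms SSet.{u}).rlp (d₀₁.res zero_mem_univ h₄ p) :=
    res_rlp _ (by decide) (by decide)
  obtain ⟨t, ht⟩ := exists_section hd
  obtain ⟨s, hs⟩ := exists_section ha
  let ψ := t ≫ d₀₂.res zero_mem_singleton h₄ p
  -- On the face `013` both `t` and the degeneracy restrict to the identity on `01`; hence they are
  -- isomorphic, and so are their restrictions to `03`.
  have i₁ : AreIsomorphic (t ≫ d₀₃.res zero_mem_univ h₄ p) (𝟙 _) := by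
    have := areIsomorphic_of_comp_eq hb (f := t ≫ d₀₁₃.res h₃ h₄ p)
      (g := δ.res h₃ zero_mem_univ p) (by rw [Category.assoc, e₃, ht, hδ₁])
    have := this.comp_right (b₀₂.res zero_mem_univ h₃ p)
    rwa [Category.assoc, e₄, hδ₂] at this
  -- On the face `023` both `t` and `ψ ≫ s` restrict to `ψ` on `02`; on `03` this exhibits a right
  -- inverse of `ψ`.
  have i₂ : AreIsomorphic (t ≫ d₀₃.res zero_mem_univ h₄ p)
      (ψ ≫ s ≫ a₀₂.res zero_mem_univ h₂' p) := by
    have := areIsomorphic_of_comp_eq ha (f := t ≫ d₀₂₃.res h₂' h₄ p) (g := ψ ≫ s)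
      (by rw [Category.assoc, e₅, Category.assoc, hs, Category.comp_id])
    have := this.comp_right (a₀₂.res zero_mem_univ h₂' p)
    rwa [Category.assoc, e₆, Category.assoc] at this
  -- On the face `012` the composite with `t` and the degeneracy both restrict to `forgetOne.res` on
  -- `01`; on `02` the degeneracy is the identity.
  have i₃ : AreIsomorphic (forgetOne.res zero_mem_univ zero_mem_singleton p ≫ ψ) (𝟙 _) := by
    have := areIsomorphic_of_comp_eq (face01_rlp p)
      (f := forgetOne.res zero_mem_univ zero_mem_singleton p ≫ t ≫ d₀₁₂.res h₂ h₄ p)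
      (g := degenerate.res h₂ zero_mem_singleton p)
      (by rw [degenerate_face01, Category.assoc, Category.assoc, e₁, ht, Category.comp_id])
    have := this.comp_right (face02.res zero_mem_singleton h₂ p)
    rwa [Category.assoc, Category.assoc, e₂, degenerate_face02] at this
  exact isInftyEquivalence_of_inverses i₃ (i₂.symm.trans i₁)

end

end InftySlice
end

theorem mainTheorem6 {K C : SSet.{u}} [SSet.Quasicategory C] (p : K ⟶ C) :
    SSet.Quasicategory (InftySlice.slice p) ∧
      SSet.Quasicategory (InftySlice.coneFiber p) ∧
        InftySlice.IsInftyEquivalence (InftySlice.sliceComparison p) := by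
  have := InftySlice.quasicategory_partsSlice_singleton p
  refine ⟨InftySlice.quasicategory_of_retract (InftySlice.sliceToParts_partsToSlice p),
    inferInstance, ?_⟩
  exact (InftySlice.isInftyEquivalence_res p).of_iso
    ⟨_, _, InftySlice.sliceToParts_partsToSlice p, InftySlice.partsToSlice_sliceToParts p⟩
    ⟨_, _, InftySlice.coneFiberToParts_partsToConeFiber p,
      InftySlice.partsToConeFiber_coneFiberToParts p⟩
    (InftySlice.sliceComparison_coneFiberToParts p)
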